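/- **Setting.** Let $(\Omega_1,\mathcal A_1)$, $(\Omega_2,\mathcal A_2)$ be measurable spaces, $\mathcal P$, $\mathcal Q$ sets of probability measures on them, $P_0\in\mathcal P$, $Q_0\in\mathcal Q$, and $\mathcal P\otimes\mathcal Q=\{P\otimes Q: P\in\mathcal P, Q\in\mathcal Q\}$. For probability measures $P,Q$ let $\frac{dP}{dQ}$ be the $[0,\infty]$-valued likelihood ratio, i.e. $P(A)=\int_A \frac{dP}{dQ}\,dQ+P(A\cap\{\frac{dP}{dQ}=\infty\})$ for all measurable $A$, and $Q(\frac{dP}{dQ}=\infty)=0$. A curve $t\mapsto P_t$ of probability measures, defined near $0$, is $L_2(P_0)$-differentiable with tangent $g\in L_2(P_0)$ if, as $t\to0$, $\|2((dP_t/dP_0)^{1/2}-1)-tg\|_{L_2(P_0)}=o(|t|)$ and $P_t(dP_t/dP_0=\infty)=o(t^2)$. The tangent cone $K(P_0,\mathcal P)$ is the set of all $g\in L_2(P_0)$ with $\int g\,dP_0=0$ that are tangents of such curves $(-\varepsilon,\varepsilon)\to\mathcal P$ through $P_0$ at $t=0$; the tangent space $T(P_0,\mathcal P)$ is the $L_2(P_0)$-closure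 of its linear span. An experiment with parameter set $\Theta$ is a family $(P_h)_{h\in\Theta}$ of probability measures on one measurable space. Experiments $E_n=(P_{n,h})_{h\in\Theta}$ converge weakly to $E=(P_h)_{h\in\Theta}$ if, for all finite $Z\subseteq\Theta$ and all $s\in\Theta$, the law of $(dP_{n,h}/dP_{n,s})_{h\in Z}$ under $P_{n,s}$ converges weakly to the law of $(dP_h/dP_s)_{h\in Z}$ under $P_s$. An experiment $(P_h)_{h\in H}$ indexed by a real Hilbert space $H$ is a Gaussian shift on $H$ if there is a linear map $L:H\to L_2(P_0)$ such that $L(h)$ has law $N(0,\|h\|^2)$ under $P_0$ and $dP_h/dP_0=\exp(L(h)-\frac12\|h\|^2)$ for all $h\in H$. A sequence of experiments indexed by $H$ is locally asymptotically normal (LAN) if it converges weakly to a Gaussian shift on $H$. **Theorem.** Let $d\in(0,1)$, and let $n_1=n_1(n)$, $n_2=n_2(n)$ be natural numbers with $n_1+n_2=n$ and $\lim_{n\to\infty} n_2/n=d$. Write $T=T(P_0\otimes Q_0,\mathcal P\otimes\mathcal Q)$. 1. Every $g\in T$ has a unique representation $g(\omega_1,\omega_2)=g_1(\omega_1)+g_2(\omega_2)$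 ($P_0\otimes Q_0$-a.s.) with $g_1\in T(P_0,\mathcal P)$ and $g_2\in T(Q_0,\mathcal Q)$. 2. With these representations, $\langle g,h\rangle_d=(1-d)\int g_1h_1\,dP_0+d\int g_2h_2\,dQ_0$ is an inner product on $T$, and $H_d=(T,\langle\cdot,\cdot\rangle_d)$ is a Hilbert space. 3. For every $g\in T$ let curves $t\mapsto P^g_t$, $t\mapsto Q^g_t$ of probability measures on $\Omega_1$, $\Omega_2$ with $P^g_0=P_0$, $Q^g_0=Q_0$ be given such that $t\mapsto P^g_t\otimes Q^g_t$ is $L_2(P_0\otimes Q_0)$-differentiable with tangent $g$ (the curves need not lie in $\mathcal P$, $\mathcal Q$). Put $$P_{n,g}=\bigl(P^g_{1/\sqrt n}\bigr)^{n_1}\otimes\bigl(Q^g_{1/\sqrt n}\bigr)^{n_2},\qquad E_{d,n}=\bigl(\Omega_1^{n_1}\times\Omega_2^{n_2},\ \mathcal A_1^{n_1}\otimes\mathcal A_2^{n_2},\ \{P_{n,g}:g\in H_d\}\bigr).$$ Then $(E_{d,n})_n$ converges weakly to every Gaussian shift $E_d$ on $H_d$. Such a Gaussian shift exists, so $(E_{d,n})_n$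 is LAN. -/

import Mathlib

open MeasureTheory ProbabilityTheory Filter Topology Asymptotics
open scoped ENNReal NNReal

universe u v w

/-! ### Likelihood ratios -/

section LikelihoodRatio

variable {Ω : Type u} [MeasurableSpace Ω]

/-- `L` is (a version of) the likelihood ratio `dP/dQ : Ω → [0, ∞]`, without any assumption of
absolute continuity. -/
structure IsLikelihoodRatio (L : Ω → ℝ≥0∞) (P Q : Measure Ω) : Prop where
  measurable : Measurable L
  apply_eq : ∀ A : Set Ω, MeasurableSet A → P A = ∫⁻ ω in A, L ω ∂Q + P (A ∩ {ω | L ω = ∞})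
  infinite_null : Q {ω | L ω = ∞} = 0

/-- The likelihood ratio `dP/dQ`, as the quotient of the densities of `P` and `Q` with respect to
`P + Q`. In `[0, ∞]` one has `a / 0 = ∞` for `a ≠ 0` and `0 / 0 = 0`. -/
noncomputable def likelihoodRatio (P Q : Measure Ω) (ω : Ω) : ℝ≥0∞ :=
  P.rnDeriv (P + Q) ω / Q.rnDeriv (P + Q) ω

theorem measurable_likelihoodRatio (P Q : Measure Ω) : Measurable (likelihoodRatio P Q) :=
  (P.measurable_rnDeriv (P + Q)).div (Q.measurable_rnDeriv (P + Q))

theorem isLikelihoodRatio_likelihoodRatio (P Q : Measure Ω) [IsFiniteMeasure P]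
    [IsFiniteMeasure Q] : IsLikelihoodRatio (likelihoodRatio P Q) P Q := by
  have hm := measurable_likelihoodRatio P Q
  have hS : MeasurableSet {ω | likelihoodRatio P Q ω = ∞} := hm (measurableSet_singleton ∞)
  have hPm := P.measurable_rnDeriv (P + Q)
  have hQm := Q.measurable_rnDeriv (P + Q)
  have hP : (P + Q).withDensity (P.rnDeriv (P + Q)) = P :=
    Measure.withDensity_rnDeriv_eq _ _ (Measure.absolutelyContinuous_of_le
      (Measure.le_add_right le_rfl))
  have hQ : (P + Q).withDensity (Q.rnDeriv (P + Q)) = Q :=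
    Measure.withDensity_rnDeriv_eq _ _ (Measure.absolutelyContinuous_of_le
      (Measure.le_add_left le_rfl))
  have hPf : ∀ᵐ ω ∂(P + Q), P.rnDeriv (P + Q) ω < ∞ := Measure.rnDeriv_lt_top P (P + Q)
  have hQf : ∀ᵐ ω ∂(P + Q), Q.rnDeriv (P + Q) ω < ∞ := Measure.rnDeriv_lt_top Q (P + Q)
  have hPA : ∀ A, MeasurableSet A → P A = ∫⁻ ω in A, P.rnDeriv (P + Q) ω ∂(P + Q) := by
    intro A hA
    rw [← withDensity_apply _ hA, hP]
  have hQA : ∀ A, MeasurableSet A → Q A = ∫⁻ ω in A, Q.rnDeriv (P + Q) ω ∂(P + Q) := by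
    intro A hA
    rw [← withDensity_apply _ hA, hQ]
  refine ⟨hm, fun A hA => ?_, ?_⟩
  · have h1 : ∫⁻ ω in A, likelihoodRatio P Q ω ∂Q =
        ∫⁻ ω in A, Q.rnDeriv (P + Q) ω * likelihoodRatio P Q ω ∂(P + Q) := by
      have h0 := setLIntegral_withDensity_eq_setLIntegral_mul (P + Q) hQm hm hA
      rw [hQ] at h0
      exact h0
    rw [h1, hPA A hA, hPA _ (hA.inter hS), Set.inter_comm, ← Measure.restrict_restrict hS,
      ← lintegral_indicator hS,
      ← lintegral_add_left (f := fun ω => Q.rnDeriv (P + Q) ω * likelihoodRatio P Q ω) (hQm.mul hm)]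
    refine lintegral_congr_ae (ae_restrict_of_ae ?_)
    filter_upwards [hPf, hQf] with ω h2 h3
    by_cases h4 : Q.rnDeriv (P + Q) ω = 0
    · by_cases h5 : P.rnDeriv (P + Q) ω = 0
      · simp [Set.indicator, h4, h5]
      · have : likelihoodRatio P Q ω = ∞ := by
          simp [likelihoodRatio, h4, ENNReal.div_zero h5]
        simp [Set.indicator, h4, this]
    · have : likelihoodRatio P Q ω ≠ ∞ := ENNReal.div_ne_top h2.ne h4
      simp [Set.indicator, this]
      exact (ENNReal.mul_div_cancel h4 h3.ne).symm
  · rw [hQA _ hS, ← lintegral_indicator hS, lintegral_eq_zero_iff (hQm.indicator hS)]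
    filter_upwards [hPf] with ω h2
    by_cases h4 : Q.rnDeriv (P + Q) ω = 0
    · simp [Set.indicator, h4]
    · have : likelihoodRatio P Q ω ≠ ∞ := ENNReal.div_ne_top h2.ne h4
      simp [Set.indicator, this]

end LikelihoodRatio

/-! ### `L₂`-differentiable curves, tangent cones and tangent spaces -/

section Tangents

variable {Ω : Type u} [MeasurableSpace Ω]

/-- The curve `t ↦ P t` of probability measures is `L₂(P 0)`-differentiable (at `t = 0`) with
tangent `g`. Only the values `P t` for small `|t|` matter, so that a curve that is given on an
interval `(-ε, ε)` may be extended arbitrarily to `ℝ`. -/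
structure IsL2Differentiable (P : ℝ → ProbabilityMeasure Ω) (g : Ω → ℝ) : Prop where
  memLp : MemLp g 2 (P 0 : Measure Ω)
  isLittleO_norm :
    (fun t : ℝ => (eLpNorm
      (fun ω => 2 * (√(likelihoodRatio (P t : Measure Ω) (P 0 : Measure Ω) ω).toReal - 1) - t * g ω)
      2 (P 0 : Measure Ω)).toReal) =o[𝓝[≠] 0] (fun t : ℝ => |t|)
  isLittleO_singular :
    (fun t : ℝ => (P t : Measure Ω).real
      {ω | likelihoodRatio (P t : Measure Ω) (P 0 : Measure Ω) ω = ∞}) =o[𝓝[≠] 0]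
        (fun t : ℝ => t ^ 2)

/-- The tangent cone `K(P₀, 𝒫)` of the family `𝒫 = Pfam`: all tangents of `L₂`-differentiable curves
`(-ε, ε) → 𝒫` through `P₀`. -/
def tangentCone (P₀ : ProbabilityMeasure Ω) (Pfam : Set (ProbabilityMeasure Ω)) :
    Set (Lp ℝ 2 (P₀ : Measure Ω)) :=
  {g | ∫ ω, g ω ∂(P₀ : Measure Ω) = 0 ∧
    ∃ ε : ℝ, 0 < ε ∧ ∃ P : ℝ → ProbabilityMeasure Ω,
      P 0 = P₀ ∧ (∀ t ∈ Set.Ioo (-ε) ε, P t ∈ Pfam) ∧ IsL2Differentiable P g}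

/-- The tangent space `T(P₀, 𝒫)`: the `L₂(P₀)`-closure of the linear hull of the tangent cone. -/
noncomputable def tangentSpace (P₀ : ProbabilityMeasure Ω) (Pfam : Set (ProbabilityMeasure Ω)) :
    Submodule ℝ (Lp ℝ 2 (P₀ : Measure Ω)) :=
  (Submodule.span ℝ (tangentCone P₀ Pfam)).topologicalClosure

end Tangents

/-! ### Statistical experiments -/

/-- A statistical experiment with parameter set `Θ`. -/
structure Experiment (Θ : Type v) where
  Ω : Type w
  [measurableSpace : MeasurableSpace Ω]
  P : Θ → ProbabilityMeasure Ω

attribute [instance] Experiment.measurableSpace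

/-- The law of the vector of likelihood ratios `(dP_h/dP_s)_{h ∈ Z}` under `P_s`. -/
noncomputable def Experiment.likelihoodLaw {Θ : Type v} (E : Experiment.{v, w} Θ) (Z : Finset Θ)
    (s : Θ) : ProbabilityMeasure (Z → ℝ≥0∞) :=
  (E.P s).map (f := fun ω (h : Z) => likelihoodRatio (E.P h : Measure E.Ω) (E.P s : Measure E.Ω) ω)
    (measurable_pi_lambda _ fun _ => measurable_likelihoodRatio _ _).aemeasurable

/-- Weak convergence of a sequence of experiments with common parameter set `Θ`: for every finite
`Z ⊆ Θ` and every `s ∈ Θ`, the laws of the likelihood ratio vectors converge weakly. -/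
def WeaklyConvergesTo {Θ : Type v} (E : ℕ → Experiment.{v, u} Θ) (E' : Experiment.{v, w} Θ) :
    Prop :=
  ∀ (Z : Finset Θ) (s : Θ),
    Tendsto (fun n => (E n).likelihoodLaw Z s) atTop (𝓝 (E'.likelihoodLaw Z s))

section GaussianShift

variable {H : Type v} [NormedAddCommGroup H] [InnerProductSpace ℝ H]

/-- A linear map `L : H → L₂(P₀)` is a standard Gaussian process if `L h` has law `N(0, ‖h‖²)`
for all `h`. -/
def IsStandardGaussianProcess {Ω : Type w} [MeasurableSpace Ω] {P₀ : Measure Ω}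
    (L : H →ₗ[ℝ] Lp ℝ 2 P₀) : Prop :=
  ∀ h : H, P₀.map (L h) = gaussianReal 0 (‖h‖₊ ^ 2)

/-- The experiment `E` is a Gaussian shift on `H`. -/
def IsGaussianShift (E : Experiment.{v, w} H) : Prop :=
  ∃ L : H →ₗ[ℝ] Lp ℝ 2 (E.P 0 : Measure E.Ω), IsStandardGaussianProcess L ∧
    ∀ h : H, likelihoodRatio (E.P h : Measure E.Ω) (E.P 0 : Measure E.Ω)
      =ᵐ[(E.P 0 : Measure E.Ω)] fun ω => ENNReal.ofReal (Real.exp (L h ω - ‖h‖ ^ 2 / 2))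

/-- Local asymptotic normality: weak convergence to a Gaussian shift on `H`. -/
def IsLAN (E : ℕ → Experiment.{v, u} H) : Prop :=
  ∃ E' : Experiment.{v, v} H, IsGaussianShift E' ∧ WeaklyConvergesTo E E'

end GaussianShift

/-! ### A real vector space with a prescribed inner product -/

/-- The vector space `V`, to be equipped with the inner product `c` (whatever other structure `V`
carries). -/
def WithInner {V : Type v} [AddCommGroup V] [Module ℝ V] (_c : InnerProductSpace.Core ℝ V) :
    Type v := V

namespace WithInner

variable {V : Type v} [AddCommGroup V] [Module ℝ V] (c : InnerProductSpace.Core ℝ V)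

noncomputable instance : NormedAddCommGroup (WithInner c) :=
  @InnerProductSpace.Core.toNormedAddCommGroup ℝ V _ _ _ c

noncomputable instance : InnerProductSpace ℝ (WithInner c) :=
  @InnerProductSpace.ofCore ℝ V _ _ _ c.toCore

variable {c} in
/-- The underlying vector. -/
def val (g : WithInner c) : V := g

end WithInner

/-! ### The two-sample problem -/

section TwoSample

variable {Ω₁ : Type u} {Ω₂ : Type v} [MeasurableSpace Ω₁] [MeasurableSpace Ω₂]

/-- The family `𝒫 ⊗ 𝒬` of product measures. -/
def productFamily (Pfam : Set (ProbabilityMeasure Ω₁)) (Qfam : Set (ProbabilityMeasure Ω₂)) :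
    Set (ProbabilityMeasure (Ω₁ × Ω₂)) :=
  {R | ∃ P ∈ Pfam, ∃ Q ∈ Qfam, R = P.prod Q}

/-- `g = g₁ ∘ π₁ + g₂ ∘ π₂` as elements of `L₂(P₀ ⊗ Q₀)`. -/
def IsSumOfMarginals {P₀ : ProbabilityMeasure Ω₁} {Q₀ : ProbabilityMeasure Ω₂}
    (g : Lp ℝ 2 (P₀.prod Q₀ : Measure (Ω₁ × Ω₂)))
    (g₁ : Lp ℝ 2 (P₀ : Measure Ω₁)) (g₂ : Lp ℝ 2 (Q₀ : Measure Ω₂)) : Prop :=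
  g =ᵐ[(P₀.prod Q₀ : Measure (Ω₁ × Ω₂))] fun ω => g₁ ω.1 + g₂ ω.2

/-- The experiment with sample space `Ω₁^{n₁} × Ω₂^{n₂}` and the measures
`P_{1/√n}^{n₁} ⊗ Q_{1/√n}^{n₂}`, where `t ↦ P_t` and `t ↦ Q_t` are the curves `p g` and `q g` that
belong to the parameter `g`. -/
noncomputable def twoSampleExperiment {Θ : Type w} (p : Θ → ℝ → ProbabilityMeasure Ω₁)
    (q : Θ → ℝ → ProbabilityMeasure Ω₂) (n n₁ n₂ : ℕ) : Experiment.{w, max u v} Θ where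
  Ω := (Fin n₁ → Ω₁) × (Fin n₂ → Ω₂)
  P g := (ProbabilityMeasure.pi fun _ : Fin n₁ => p g (1 / √(n : ℝ))).prod
    (ProbabilityMeasure.pi fun _ : Fin n₂ => q g (1 / √(n : ℝ)))

end TwoSample

/-! ### Identification of likelihood ratios -/

section LikelihoodRatioLemmas

variable {Ω : Type*} [MeasurableSpace Ω]

/-! Tangents of a product. Write a_t = 2(√(dP_t/dP_0) − 1) and b_t for Q_t. The root score of P_t ⊗
Q_t is w_t = a_t(x) + b_t(y) + a_t(x)b_t(y)/2, that is, w_t + 2 = 2(1 + a_t/2)(1 + b_t/2).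
Integrating out y leaves a_t + B_t(1 + a_t/2) with B_t = ∫ b_t. The means A_t, B_t lie in [−2, 0]
and are dominated by |∫ w_t|, and ∫ w_t = O(t²) because (1 + w_t/2)² is a density up to a singular
mass o(t²). Hence B_t = o(t), and a_t/t converges in L₂: differentiability of the product curve
forces that of its factors. The product term is negligible after division by t, so g = g₁ + g₂ with
marginal tangents (`tangent_prod_ae_eq`). Tangents have mean zero, so the two summands are
orthogonal, and (g₁, g₂) ↦ g₁ + g₂ is injective with closed range; the range therefore contains the
closed span T. The form ⟨·,·⟩_d has a norm equivalent to that of L₂ on T, whence completeness.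

Asymptotic normality. Under P₀^{n₁} ⊗ Q₀^{n₂} the log-likelihood ratios are sums of independent
terms 2 log(1 + y/2), with y the root score of one observation. The logarithm is cut off at y = −1,
which changes something only with vanishing probability. A second order expansion under the integral
(`tendsto_integral_div_sq`) gives mean −t²‖g‖²/2 and second moment t²‖g‖² to leading order, and
powers of characteristic functions converge (`tendsto_integral_cexp_pow`). Applied to arbitrary
linear combinations, with sample fractions 1 − d and d, this yields the characteristic function of
(L(h_k) − ‖h_k‖²/2)_k, where the norm is that of H_d.

Finally the base measure is changed to P_{n,s} (`tendsto_likelihoodRatioLaw_of_base`): the ratios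
are divided by dP_{n,s}/dR_n and weighted with it, and no mass is lost in the limit because the
measures of a Gaussian shift are mutually absolutely continuous. A Gaussian shift is built by
mapping a Hilbert basis to independent standard normal coordinates. -/

theorem IsLikelihoodRatio.restrict_ne_top {L : Ω → ℝ≥0∞} {P Q : Measure Ω}
    (h : IsLikelihoodRatio L P Q) : P.restrict {ω | L ω ≠ ∞} = Q.withDensity L := by
  have hS : MeasurableSet {ω | L ω ≠ ∞} := (h.measurable (measurableSet_singleton ∞)).compl
  ext A hA
  rw [Measure.restrict_apply hA, h.apply_eq _ (hA.inter hS), withDensity_apply _ hA]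
  have h1 : A ∩ {ω | L ω ≠ ∞} ∩ {ω | L ω = ∞} = ∅ := by ext; simp +contextual
  rw [h1, measure_empty, add_zero, Set.inter_comm, ← Measure.restrict_restrict hS,
    Measure.restrict_eq_self_of_ae_mem (ae_restrict_of_ae (by
      rw [ae_iff]; simpa using h.infinite_null))]

theorem ae_eq_rnDeriv_of_restrict_eq_withDensity {f : Ω → ℝ≥0∞} {P Q : Measure Ω}
    [IsFiniteMeasure P] [IsFiniteMeasure Q] (hf : Measurable f) {S : Set Ω} (hS : MeasurableSet S)
    (hQ : Q Sᶜ = 0) (h : P.restrict S = Q.withDensity f) : f =ᵐ[Q] P.rnDeriv Q := by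
  refine Measure.eq_rnDeriv (s := P.restrict Sᶜ) hf ?_ ?_
  · refine ⟨S, hS, ?_, hQ⟩
    rw [Measure.restrict_apply hS, Set.inter_compl_self, measure_empty]
  · rw [← h, add_comm, Measure.restrict_add_restrict_compl hS]

theorem likelihoodRatio_ae_eq_rnDeriv (P Q : Measure Ω) [IsFiniteMeasure P] [IsFiniteMeasure Q] :
    likelihoodRatio P Q =ᵐ[Q] P.rnDeriv Q := by
  have h := isLikelihoodRatio_likelihoodRatio P Q
  refine ae_eq_rnDeriv_of_restrict_eq_withDensity h.measurable
    (h.measurable (measurableSet_singleton ∞)).compl ?_ h.restrict_ne_top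
  rw [compl_compl]
  exact h.infinite_null

theorem likelihoodRatio_ae_lt_top (P Q : Measure Ω) [IsFiniteMeasure P] [IsFiniteMeasure Q] :
    ∀ᵐ ω ∂Q, likelihoodRatio P Q ω < ∞ := by
  rw [ae_iff]
  simpa using (isLikelihoodRatio_likelihoodRatio P Q).infinite_null

/-- Criterion behind the identifications for products and for the constructed Gaussian shift: a set
S carries Q and P has density f on S. The rest of P lives off S, hence is singular to Q, and the
Lebesgue decomposition is unique. -/
theorem likelihoodRatio_ae_eq_of_restrict_eq_withDensity {f : Ω → ℝ≥0∞} {P Q : Measure Ω}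
    [IsFiniteMeasure P] [IsFiniteMeasure Q] (hf : Measurable f) {S : Set Ω} (hS : MeasurableSet S)
    (hQ : Q Sᶜ = 0) (h : P.restrict S = Q.withDensity f) : likelihoodRatio P Q =ᵐ[Q] f :=
  (likelihoodRatio_ae_eq_rnDeriv P Q).trans
    (ae_eq_rnDeriv_of_restrict_eq_withDensity hf hS hQ h).symm

/-- The likelihood ratio may be computed with respect to any dominating measure. -/
theorem likelihoodRatio_ae_eq_div {P Q ν : Measure Ω} [IsFiniteMeasure P] [IsFiniteMeasure Q]
    [IsFiniteMeasure ν] (hP : P ≪ ν) (hQ : Q ≪ ν) :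
    likelihoodRatio P Q =ᵐ[P + Q] fun ω => P.rnDeriv ν ω / Q.rnDeriv ν ω := by
  have hPQ : P + Q ≪ ν := by
    intro s hs
    simp [hP hs, hQ hs]
  have h1 := hPQ.ae_le (Measure.rnDeriv_mul_rnDeriv (κ := ν)
    (Measure.absolutelyContinuous_of_le (Measure.le_add_right le_rfl : P ≤ P + Q)))
  have h2 := hPQ.ae_le (Measure.rnDeriv_mul_rnDeriv (κ := ν)
    (Measure.absolutelyContinuous_of_le (Measure.le_add_left le_rfl : Q ≤ P + Q)))
  filter_upwards [h1, h2, Measure.rnDeriv_pos hPQ, hPQ.ae_le (Measure.rnDeriv_lt_top (P + Q) ν)]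
    with ω h3 h4 h5 h6
  rw [← h3, ← h4, Pi.mul_apply, Pi.mul_apply, ENNReal.mul_div_mul_right _ _ h5.ne' h6.ne]
  rfl

/-- The chain rule for likelihood ratios. -/
theorem likelihoodRatio_ae_eq_div_likelihoodRatio (P Q R : Measure Ω) [IsFiniteMeasure P]
    [IsFiniteMeasure Q] [IsFiniteMeasure R] :
    likelihoodRatio P Q =ᵐ[R.withDensity (likelihoodRatio Q R)]
      fun ω => likelihoodRatio P R ω / likelihoodRatio Q R ω := by
  -- A common dominating measure. The quotients hold almost surely for different sums of measures;
  -- the part of Q that is absolutely continuous with respect to R is dominated by all of them, and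
  -- on it dR/dν is positive and finite and cancels.
  set ν := P + Q + R with hν
  have hP : P ≪ ν := Measure.absolutelyContinuous_of_le (by
    rw [hν, add_assoc]; exact Measure.le_add_right le_rfl)
  have hQ : Q ≪ ν := Measure.absolutelyContinuous_of_le
    (Measure.le_add_right (Measure.le_add_left le_rfl))
  have hR : R ≪ ν := Measure.absolutelyContinuous_of_le (Measure.le_add_left le_rfl)
  have hac := withDensity_absolutelyContinuous R (likelihoodRatio Q R)
  have hacQ : R.withDensity (likelihoodRatio Q R) ≪ P + Q := by
    rw [← (isLikelihoodRatio_likelihoodRatio Q R).restrict_ne_top]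
    exact (Measure.absolutelyContinuous_of_le Measure.restrict_le_self).trans
      (Measure.absolutelyContinuous_of_le (Measure.le_add_left le_rfl))
  have hadd : ∀ M : Measure Ω, R ≪ M + R := fun M =>
    Measure.absolutelyContinuous_of_le (Measure.le_add_left le_rfl)
  filter_upwards [hacQ.ae_le (likelihoodRatio_ae_eq_div hP hQ),
    (hac.trans (hadd P)).ae_le (likelihoodRatio_ae_eq_div hP hR),
    (hac.trans (hadd Q)).ae_le (likelihoodRatio_ae_eq_div hQ hR),
    hac.ae_le (Measure.rnDeriv_pos hR), (hac.trans hR).ae_le (Measure.rnDeriv_lt_top R ν)]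
    with ω h1 h2 h3 h4 h5
  rw [h1, h2, h3, div_eq_mul_inv (P.rnDeriv ν ω) (R.rnDeriv ν ω),
    div_eq_mul_inv (Q.rnDeriv ν ω) (R.rnDeriv ν ω), ENNReal.mul_div_mul_right _ _ (ENNReal.inv_ne_zero.2 h5.ne) (ENNReal.inv_ne_top.2 h4.ne')]

/-! ### Likelihood ratios of product measures. -/

theorem measurable_pi_prod_apply {n : ℕ} {f : Ω → ℝ≥0∞} (hf : Measurable f) :
    Measurable fun ω : Fin n → Ω => ∏ i, f (ω i) :=
  Finset.measurable_prod _ fun i _ => hf.comp (measurable_pi_apply i)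

theorem lintegral_pi_prod (Q : Measure Ω) [IsProbabilityMeasure Q] {n : ℕ}
    {f : Fin n → Ω → ℝ≥0∞} (hf : ∀ i, Measurable (f i)) :
    ∫⁻ ω : Fin n → Ω, ∏ i, f i (ω i) ∂(Measure.pi fun _ => Q) = ∏ i, ∫⁻ ω, f i ω ∂Q := by
  have hind : iIndepFun (fun i (ω : Fin n → Ω) => f i (ω i)) (Measure.pi fun _ : Fin n => Q) :=
    iIndepFun_pi (X := fun i => f i) fun i => (hf i).aemeasurable
  rw [lintegral_prod_eq_prod_lintegral_of_indepFun Finset.univ _ hind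
    fun i => (hf i).comp (measurable_pi_apply i)]
  refine Finset.prod_congr rfl fun i _ => ?_
  exact (measurePreserving_eval (fun _ : Fin n => Q) i).lintegral_comp (hf i)

theorem pi_withDensity (Q : Measure Ω) [IsProbabilityMeasure Q] {n : ℕ} {f : Ω → ℝ≥0∞}
    (hf : Measurable f) [SigmaFinite (Q.withDensity f)] :
    Measure.pi (fun _ : Fin n => Q.withDensity f) =
      (Measure.pi fun _ => Q).withDensity fun ω => ∏ i, f (ω i) := by
  refine Measure.pi_eq fun s hs => ?_
  rw [withDensity_apply _ (MeasurableSet.univ_pi hs), ← lintegral_indicator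
    (MeasurableSet.univ_pi hs)]
  have h1 : ∀ ω : Fin n → Ω, (Set.univ.pi s).indicator (fun ω => ∏ i, f (ω i)) ω =
      ∏ i, (s i).indicator f (ω i) := by
    intro ω
    by_cases h : ω ∈ Set.univ.pi s
    · rw [Set.indicator_of_mem h]
      exact Finset.prod_congr rfl fun i _ => (Set.indicator_of_mem (h i trivial) _).symm
    · rw [Set.indicator_of_notMem h]
      simp only [Set.mem_pi, Set.mem_univ, true_implies, not_forall] at h
      obtain ⟨i, hi⟩ := h
      exact (Finset.prod_eq_zero (Finset.mem_univ i) (Set.indicator_of_notMem hi _)).symm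
  simp_rw [h1]
  rw [lintegral_pi_prod Q fun i => hf.indicator (hs i)]
  exact Finset.prod_congr rfl fun i _ => by
    rw [lintegral_indicator (hs i), withDensity_apply _ (hs i)]

/-- The box of points with all coordinate ratios finite carries the power of Q, and both restriction
to boxes and densities commute with products of measures. -/
theorem likelihoodRatio_pi (P Q : Measure Ω) [IsProbabilityMeasure P] [IsProbabilityMeasure Q]
    (n : ℕ) :
    likelihoodRatio (Measure.pi fun _ : Fin n => P) (Measure.pi fun _ => Q)
      =ᵐ[Measure.pi fun _ => Q] fun ω => ∏ i, likelihoodRatio P Q (ω i) := by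
  have h := isLikelihoodRatio_likelihoodRatio P Q
  set S := {ω | likelihoodRatio P Q ω ≠ ∞} with hSdef
  have hS : MeasurableSet S := (h.measurable (measurableSet_singleton ∞)).compl
  refine likelihoodRatio_ae_eq_of_restrict_eq_withDensity (measurable_pi_prod_apply h.measurable)
    (MeasurableSet.univ_pi fun _ => hS) (S := Set.univ.pi fun _ => S) ?_ ?_
  · have : ∀ᵐ ω ∂(Measure.pi fun _ : Fin n => Q), ω ∈ Set.univ.pi fun _ => S := by
      have h2 : ∀ i : Fin n, ∀ᵐ ω ∂(Measure.pi fun _ : Fin n => Q), ω i ∈ S := fun i =>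
        (measurePreserving_eval (fun _ : Fin n => Q) i).quasiMeasurePreserving.ae
          ((likelihoodRatio_ae_lt_top P Q).mono fun ω hω => hω.ne)
      filter_upwards [ae_all_iff.2 h2] with ω hω i _ using hω i
    exact this
  · have : IsFiniteMeasure (Q.withDensity (likelihoodRatio P Q)) := by
      rw [← h.restrict_ne_top]; infer_instance
    rw [Measure.restrict_pi_pi, h.restrict_ne_top, pi_withDensity Q h.measurable]

theorem likelihoodRatio_prod {Ω' : Type*} [MeasurableSpace Ω'] (P Q : Measure Ω)
    (P' Q' : Measure Ω') [IsProbabilityMeasure P] [IsProbabilityMeasure Q]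
    [IsProbabilityMeasure P'] [IsProbabilityMeasure Q'] :
    likelihoodRatio (P.prod P') (Q.prod Q')
      =ᵐ[Q.prod Q'] fun ω => likelihoodRatio P Q ω.1 * likelihoodRatio P' Q' ω.2 := by
  have h := isLikelihoodRatio_likelihoodRatio P Q
  have h' := isLikelihoodRatio_likelihoodRatio P' Q'
  have hS : MeasurableSet {ω | likelihoodRatio P Q ω ≠ ∞} :=
    (h.measurable (measurableSet_singleton ∞)).compl
  have hS' : MeasurableSet {ω | likelihoodRatio P' Q' ω ≠ ∞} :=
    (h'.measurable (measurableSet_singleton ∞)).compl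
  refine likelihoodRatio_ae_eq_of_restrict_eq_withDensity
    ((h.measurable.comp measurable_fst).mul (h'.measurable.comp measurable_snd)) (hS.prod hS') ?_ ?_
  · have : ∀ᵐ ω ∂(Q.prod Q'), ω ∈
        {ω | likelihoodRatio P Q ω ≠ ∞} ×ˢ {ω | likelihoodRatio P' Q' ω ≠ ∞} := by
      filter_upwards [Measure.quasiMeasurePreserving_fst.ae (likelihoodRatio_ae_lt_top P Q),
        Measure.quasiMeasurePreserving_snd.ae (likelihoodRatio_ae_lt_top P' Q')] with ω h1 h2
        using ⟨h1.ne, h2.ne⟩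
    exact this
  · have : IsFiniteMeasure (Q.withDensity (likelihoodRatio P Q)) := by
      rw [← h.restrict_ne_top]; infer_instance
    have : IsFiniteMeasure (Q'.withDensity (likelihoodRatio P' Q')) := by
      rw [← h'.restrict_ne_top]; infer_instance
    rw [← Measure.prod_restrict, h.restrict_ne_top, h'.restrict_ne_top,
      prod_withDensity h.measurable h'.measurable]

/-! ### Mass of the absolutely continuous part. -/

theorem lintegral_likelihoodRatio_add (P Q : Measure Ω) [IsProbabilityMeasure P]
    [IsFiniteMeasure Q] :
    ∫⁻ ω, likelihoodRatio P Q ω ∂Q + P {ω | likelihoodRatio P Q ω = ∞} = 1 := by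
  have := (isLikelihoodRatio_likelihoodRatio P Q).apply_eq Set.univ MeasurableSet.univ
  simpa using this.symm

theorem lintegral_likelihoodRatio_le_one (P Q : Measure Ω) [IsProbabilityMeasure P]
    [IsFiniteMeasure Q] : ∫⁻ ω, likelihoodRatio P Q ω ∂Q ≤ 1 :=
  (lintegral_likelihoodRatio_add P Q) ▸ le_self_add

theorem integrable_likelihoodRatio (P Q : Measure Ω) [IsProbabilityMeasure P]
    [IsFiniteMeasure Q] : Integrable (fun ω => (likelihoodRatio P Q ω).toReal) Q :=
  integrable_toReal_of_lintegral_ne_top (measurable_likelihoodRatio P Q).aemeasurable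
    ((lintegral_likelihoodRatio_le_one P Q).trans_lt ENNReal.one_lt_top).ne

theorem integral_likelihoodRatio (P Q : Measure Ω) [IsProbabilityMeasure P]
    [IsFiniteMeasure Q] : ∫ ω, (likelihoodRatio P Q ω).toReal ∂Q =
      1 - P.real {ω | likelihoodRatio P Q ω = ∞} := by
  rw [integral_toReal (measurable_likelihoodRatio P Q).aemeasurable (likelihoodRatio_ae_lt_top P Q)]
  have h := congrArg ENNReal.toReal (lintegral_likelihoodRatio_add P Q)
  rw [ENNReal.toReal_add ((lintegral_likelihoodRatio_le_one P Q).trans_lt ENNReal.one_lt_top).ne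
    (measure_ne_top _ _)] at h
  rw [Measure.real]
  simp only [ENNReal.toReal_one] at h
  linarith

end LikelihoodRatioLemmas

/-! ### Convergence in `L₂` and second order expansions -/

section L2

variable {Ω : Type*} [MeasurableSpace Ω] {μ : Measure Ω} {ι : Type*} {l : Filter ι}

/-- The functions `u i` converge to `g` in `L₂(μ)` along the filter `l`. -/
structure TendstoL2 (l : Filter ι) (μ : Measure Ω) (u : ι → Ω → ℝ) (g : Ω → ℝ) : Prop where
  memLp : ∀ i, MemLp (u i) 2 μ
  memLp_lim : MemLp g 2 μ
  tendsto_eLpNorm : Tendsto (fun i => eLpNorm (u i - g) 2 μ) l (𝓝 0)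

namespace TendstoL2

variable {u v : ι → Ω → ℝ} {g h : Ω → ℝ}

theorem tendsto_toLp (hu : TendstoL2 l μ u g) :
    Tendsto (fun i => (hu.memLp i).toLp (u i)) l (𝓝 (hu.memLp_lim.toLp g)) :=
  (Lp.tendsto_Lp_iff_tendsto_eLpNorm'' u hu.memLp g hu.memLp_lim).2 hu.tendsto_eLpNorm

theorem integral_mul (hu : TendstoL2 l μ u g) (hv : TendstoL2 l μ v h) :
    Tendsto (fun i => ∫ ω, u i ω * v i ω ∂μ) l (𝓝 (∫ ω, g ω * h ω ∂μ)) := by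
  have key : ∀ {a b : Ω → ℝ} (ha : MemLp a 2 μ) (hb : MemLp b 2 μ),
      inner ℝ (ha.toLp a) (hb.toLp b) = ∫ ω, a ω * b ω ∂μ := by
    intro a b ha hb
    rw [L2.inner_def]
    refine integral_congr_ae ?_
    filter_upwards [ha.coeFn_toLp, hb.coeFn_toLp] with ω h1 h2
    rw [h1, h2]
    simp [mul_comm]
  have := hu.tendsto_toLp.inner (𝕜 := ℝ) hv.tendsto_toLp
  simpa only [key] using this

theorem integral_sq (hu : TendstoL2 l μ u g) :
    Tendsto (fun i => ∫ ω, u i ω ^ 2 ∂μ) l (𝓝 (∫ ω, g ω ^ 2 ∂μ)) := by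
  simpa only [sq] using hu.integral_mul hu

theorem const [IsFiniteMeasure μ] (c : ℝ) : TendstoL2 l μ (fun _ _ => c) fun _ => c :=
  ⟨fun _ => memLp_const c, memLp_const c, by simp [tendsto_const_nhds]⟩

theorem integral [IsFiniteMeasure μ] (hu : TendstoL2 l μ u g) :
    Tendsto (fun i => ∫ ω, u i ω ∂μ) l (𝓝 (∫ ω, g ω ∂μ)) := by
  simpa using hu.integral_mul (const 1)

theorem add (hu : TendstoL2 l μ u g) (hv : TendstoL2 l μ v h) :
    TendstoL2 l μ (fun i => u i + v i) (g + h) := by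
  refine ⟨fun i => (hu.memLp i).add (hv.memLp i), hu.memLp_lim.add hv.memLp_lim, ?_⟩
  have := hu.tendsto_eLpNorm.add hv.tendsto_eLpNorm
  rw [add_zero] at this
  refine tendsto_of_tendsto_of_tendsto_of_le_of_le tendsto_const_nhds this (fun _ => zero_le) ?_
  intro i
  dsimp only
  rw [add_sub_add_comm]
  exact eLpNorm_add_le ((hu.memLp i).sub hu.memLp_lim).aestronglyMeasurable
    ((hv.memLp i).sub hv.memLp_lim).aestronglyMeasurable (by norm_num)

theorem const_mul (hu : TendstoL2 l μ u g) (c : ℝ) :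
    TendstoL2 l μ (fun i ω => c * u i ω) fun ω => c * g ω := by
  refine ⟨fun i => (hu.memLp i).const_mul c, hu.memLp_lim.const_mul c, ?_⟩
  have := ENNReal.Tendsto.const_mul (a := ‖c‖ₑ) hu.tendsto_eLpNorm (Or.inr enorm_ne_top)
  rw [mul_zero] at this
  refine this.congr fun i => ?_
  rw [← eLpNorm_const_smul]
  congr 1
  ext ω
  simp [mul_sub]

theorem sub (hu : TendstoL2 l μ u g) (hv : TendstoL2 l μ v h) :
    TendstoL2 l μ (fun i => u i - v i) (g - h) := by
  have := hu.add (hv.const_mul (-1))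
  convert this using 1
  · ext i ω; simp [sub_eq_add_neg]
  · ext ω; simp [sub_eq_add_neg]

theorem sum {κ : Type*} (s : Finset κ) {u : κ → ι → Ω → ℝ} {g : κ → Ω → ℝ}
    (hu : ∀ k, TendstoL2 l μ (u k) (g k)) :
    TendstoL2 l μ (fun i => ∑ k ∈ s, u k i) (∑ k ∈ s, g k) := by
  classical
  induction s using Finset.induction_on with
  | empty => exact ⟨fun _ => by simp, by simp, by simp [tendsto_const_nhds]⟩
  | insert a s ha ih => simpa only [Finset.sum_insert ha] using (hu a).add ih

theorem comp {κ : Type*} {l' : Filter κ} {t : κ → ι} (hu : TendstoL2 l μ u g)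
    (ht : Tendsto t l' l) : TendstoL2 l' μ (fun k => u (t k)) g :=
  ⟨fun k => hu.memLp (t k), hu.memLp_lim, hu.tendsto_eLpNorm.comp ht⟩

theorem congr_lim (hu : TendstoL2 l μ u g) (hgh : g =ᵐ[μ] h) : TendstoL2 l μ u h := by
  refine ⟨hu.memLp, (memLp_congr_ae hgh).1 hu.memLp_lim, hu.tendsto_eLpNorm.congr fun i => ?_⟩
  refine eLpNorm_congr_ae ?_
  filter_upwards [hgh] with ω h1
  simp [h1]

theorem ae_eq_of_tendsto [l.NeBot] (hu : TendstoL2 l μ u g) (hv : TendstoL2 l μ u h) :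
    g =ᵐ[μ] h := by
  have := tendsto_nhds_unique hu.tendsto_toLp hv.tendsto_toLp
  exact (MemLp.toLp_eq_toLp_iff _ _).1 this

theorem of_integral_sq (hu : ∀ i, MemLp (u i) 2 μ) (hg : MemLp g 2 μ)
    (h : Tendsto (fun i => ∫ ω, (u i ω - g ω) ^ 2 ∂μ) l (𝓝 0)) : TendstoL2 l μ u g := by
  refine ⟨hu, hg, ?_⟩
  have h1 : ∀ i, eLpNorm (u i - g) 2 μ = ENNReal.ofReal (√(∫ ω, (u i ω - g ω) ^ 2 ∂μ)) := by
    intro i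
    rw [((hu i).sub hg).eLpNorm_eq_integral_rpow_norm (by norm_num) (by norm_num),
      Real.sqrt_eq_rpow]
    simp
  simp_rw [h1]
  have := (ENNReal.continuous_ofReal.comp Real.continuous_sqrt).continuousAt.tendsto.comp h
  simpa [Function.comp_def] using this

end TendstoL2

/-- The Lindeberg condition. Chebyshev's inequality makes the sets {δ ≤ |y i|} asymptotically null;
with u = y/t, the bound u² ≤ 2g² + 2(u − g)² leaves one term that vanishes by absolute continuity of
the integral of g² and one that vanishes by L₂ convergence. -/
theorem tendsto_integral_indicator_sq [IsFiniteMeasure μ] {t : ι → ℝ} {y : ι → Ω → ℝ} {g : Ω → ℝ}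
    (ht : Tendsto t l (𝓝 0)) (ht0 : ∀ᶠ i in l, t i ≠ 0)
    (hy : TendstoL2 l μ (fun i ω => (t i)⁻¹ * y i ω) g) (hym : ∀ i, Measurable (y i))
    {δ : ℝ} (hδ : 0 < δ) :
    Tendsto (fun i => ∫ ω in {ω | δ ≤ |y i ω|}, ((t i)⁻¹ * y i ω) ^ 2 ∂μ) l (𝓝 0) := by
  have hA : ∀ i, MeasurableSet {ω | δ ≤ |y i ω|} := fun i =>
    measurableSet_le measurable_const (hym i).abs
  have hμ : Tendsto (fun i => μ {ω | δ ≤ |y i ω|}) l (𝓝 0) := by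
    have h1 : Tendsto (fun i => (t i) ^ 2 * (∫ ω, ((t i)⁻¹ * y i ω) ^ 2 ∂μ) / δ ^ 2) l (𝓝 0) := by
      have := ((ht.pow 2).mul hy.integral_sq).div_const (δ ^ 2)
      simpa using this
    have h2 : Tendsto (fun i => μ.real {ω | δ ≤ |y i ω|}) l (𝓝 0) := by
      refine tendsto_of_tendsto_of_tendsto_of_le_of_le' tendsto_const_nhds h1
        (Eventually.of_forall fun i => measureReal_nonneg) ?_
      filter_upwards [ht0] with i hi
      have h3 : Integrable (fun ω => ((t i)⁻¹ * y i ω) ^ 2) μ := (hy.memLp i).integrable_sq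
      have h4 : (fun ω => y i ω ^ 2) = fun ω => t i ^ 2 * ((t i)⁻¹ * y i ω) ^ 2 := by
        ext ω; field_simp
      have h5 : Integrable (fun ω => y i ω ^ 2) μ := by
        rw [h4]; exact h3.const_mul _
      have h6 := mul_meas_ge_le_integral_of_nonneg (ae_of_all μ fun ω => sq_nonneg (y i ω)) h5 (δ ^ 2)
      have h7 : {ω | δ ^ 2 ≤ y i ω ^ 2} = {ω | δ ≤ |y i ω|} := by
        ext ω
        simp only [Set.mem_ofPred_eq]
        rw [← sq_abs (y i ω), pow_le_pow_iff_left₀ hδ.le (abs_nonneg _) two_ne_zero]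
      rw [h7, h4, integral_const_mul] at h6
      rw [le_div_iff₀ (by positivity), mul_comm]
      exact h6
    have h3 := (ENNReal.continuous_ofReal.tendsto 0).comp h2
    simpa [Function.comp_def, Measure.real, ENNReal.ofReal_toReal (measure_ne_top μ _)] using h3
  have hg2 := hy.memLp_lim.integrable_sq
  have h1 : Tendsto (fun i => ∫ ω in {ω | δ ≤ |y i ω|}, g ω ^ 2 ∂μ) l (𝓝 0) :=
    hg2.tendsto_setIntegral_nhds_zero hμ
  have h0 : TendstoL2 l μ (fun i => (fun ω => (t i)⁻¹ * y i ω) - g) (g - g) :=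
    hy.sub ⟨fun _ => hy.memLp_lim, hy.memLp_lim, by simp [tendsto_const_nhds]⟩
  have h2 := h0.integral_sq
  have h3 := (h1.const_mul 2).add (h2.const_mul 2)
  simp only [Pi.sub_apply, sub_self, ne_eq, OfNat.ofNat_ne_zero, not_false_eq_true, zero_pow,
    integral_zero, mul_zero, add_zero] at h3
  refine tendsto_of_tendsto_of_tendsto_of_le_of_le tendsto_const_nhds h3
    (fun i => integral_nonneg fun ω => sq_nonneg _) fun i => ?_
  have h4 : Integrable (fun ω => ((t i)⁻¹ * y i ω - g ω) ^ 2) μ := (h0.memLp i).integrable_sq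
  calc ∫ ω in {ω | δ ≤ |y i ω|}, ((t i)⁻¹ * y i ω) ^ 2 ∂μ
      ≤ ∫ ω in {ω | δ ≤ |y i ω|}, (2 * g ω ^ 2 + 2 * ((t i)⁻¹ * y i ω - g ω) ^ 2) ∂μ := by
        refine integral_mono (hy.memLp i).integrable_sq.integrableOn
          ((hg2.const_mul 2).add (h4.const_mul 2)).integrableOn fun ω => ?_
        dsimp only
        -- The difference of the two sides is exactly this square.
        nlinarith [sq_nonneg ((t i)⁻¹ * y i ω - 2 * g ω)]
    _ = 2 * ∫ ω in {ω | δ ≤ |y i ω|}, g ω ^ 2 ∂μ +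
          2 * ∫ ω in {ω | δ ≤ |y i ω|}, ((t i)⁻¹ * y i ω - g ω) ^ 2 ∂μ := by
        rw [integral_add (hg2.const_mul 2).integrableOn (h4.const_mul 2).integrableOn,
          integral_const_mul, integral_const_mul]
    _ ≤ _ := by
        gcongr 2 * _ + 2 * ?_
        exact setIntegral_le_integral h4 (ae_of_all _ fun ω => sq_nonneg _)

/-- Second order expansion under the integral: if `y i / t i` converges in `L₂` and `G` has a second
order contact with `c y²` at `0`, then `∫ G(y i) / (t i)²` converges. -/
theorem tendsto_integral_div_sq [IsFiniteMeasure μ] {t : ι → ℝ} {y : ι → Ω → ℝ} {g : Ω → ℝ}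
    (ht : Tendsto t l (𝓝 0)) (ht0 : ∀ᶠ i in l, t i ≠ 0)
    (hy : TendstoL2 l μ (fun i ω => (t i)⁻¹ * y i ω) g) (hym : ∀ i, Measurable (y i))
    {G : ℝ → ℝ} (hG : Measurable G) {c C K : ℝ} (hC : ∀ x, |G x| ≤ C * x ^ 2)
    (hK : ∀ x, |x| ≤ 1 / 2 → |G x - c * x ^ 2| ≤ K * |x| ^ 3) :
    Tendsto (fun i => (∫ ω, G (y i ω) ∂μ) / t i ^ 2) l (𝓝 (c * ∫ ω, g ω ^ 2 ∂μ)) := by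
  have hlim := hy.integral_sq
  set σ := ∫ ω, g ω ^ 2 ∂μ with hσ
  have hσ0 : 0 ≤ σ := integral_nonneg fun _ => sq_nonneg _
  have hR : ∀ x, |G x - c * x ^ 2| ≤ (C + |c|) * x ^ 2 := by
    intro x
    calc |G x - c * x ^ 2| ≤ |G x| + |c * x ^ 2| := abs_sub _ _
      _ ≤ C * x ^ 2 + |c| * x ^ 2 := by
        gcongr
        · exact hC x
        · rw [abs_mul, abs_of_nonneg (sq_nonneg x)]
      _ = _ := by ring
  have hCc : 0 ≤ C + |c| := by
    have := (abs_nonneg _).trans (hR 1)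
    simpa using this
  have hK0 : 0 ≤ K := by
    have := (abs_nonneg _).trans (hK (1 / 2) (by norm_num [abs_of_pos]))
    have h2 : (0 : ℝ) < |1 / 2| ^ 3 := by positivity
    exact nonneg_of_mul_nonneg_left this h2
  have hsq : ∀ᶠ i in l, ∀ ω, y i ω ^ 2 = t i ^ 2 * ((t i)⁻¹ * y i ω) ^ 2 := by
    filter_upwards [ht0] with i hi ω
    field_simp
  have hrem : Tendsto (fun i => (∫ ω, G (y i ω) ∂μ) / t i ^ 2 - c * ∫ ω, ((t i)⁻¹ * y i ω) ^ 2 ∂μ)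
      l (𝓝 0) := by
    rw [Metric.tendsto_nhds]
    intro ε hε
    -- The bound 1/2 keeps the cubic estimate valid on {|y| < δ}. The other one makes K δ (σ + 1) at
    -- most ε/4, where σ + 1 eventually bounds ∫ u².
    set δ := min (1 / 2) (ε / (4 * (K + 1) * (σ + 1))) with hδ
    have hδ0 : 0 < δ := by positivity
    have hev1 := (hlim.eventually (gt_mem_nhds (lt_add_one σ)))
    have hev2 := (tendsto_integral_indicator_sq ht ht0 hy hym hδ0).const_mul (C + |c|)
    rw [mul_zero] at hev2
    filter_upwards [ht0, hsq, hev1, hev2.eventually (gt_mem_nhds (half_pos hε))] with i hi hsqi h1 h2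
    have hui := (hy.memLp i).integrable_sq
    have hyi : Integrable (fun ω => y i ω ^ 2) μ := by
      simp_rw [hsqi]; exact hui.const_mul _
    have hGi : Integrable (fun ω => G (y i ω)) μ := by
      refine (hyi.const_mul C).mono' (hG.comp (hym i)).aestronglyMeasurable
        (ae_of_all _ fun ω => ?_)
      simpa using hC (y i ω)
    have hti : 0 < t i ^ 2 := by positivity
    have hA : MeasurableSet {ω | δ ≤ |y i ω|} := measurableSet_le measurable_const (hym i).abs
    have hind : Integrable ({ω | δ ≤ |y i ω|}.indicator fun ω => ((t i)⁻¹ * y i ω) ^ 2) μ :=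
      hui.indicator hA
    rw [dist_zero_right, Real.norm_eq_abs]
    have h3 : (∫ ω, G (y i ω) ∂μ) / t i ^ 2 - c * ∫ ω, ((t i)⁻¹ * y i ω) ^ 2 ∂μ =
        ∫ ω, (G (y i ω) - c * y i ω ^ 2) / t i ^ 2 ∂μ := by
      rw [integral_div, integral_sub hGi (hyi.const_mul c), integral_const_mul]
      simp_rw [hsqi]
      rw [integral_const_mul]
      field_simp
    rw [h3]
    -- Where |y| < δ the cubic bound gives K δ y²; elsewhere only the crude quadratic bound is used,
    -- and the Lindeberg condition absorbs it.
    calc |∫ ω, (G (y i ω) - c * y i ω ^ 2) / t i ^ 2 ∂μ|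
        ≤ ∫ ω, |(G (y i ω) - c * y i ω ^ 2) / t i ^ 2| ∂μ := abs_integral_le_integral_abs
      _ ≤ ∫ ω, (K * δ * ((t i)⁻¹ * y i ω) ^ 2 + (C + |c|) *
            {ω | δ ≤ |y i ω|}.indicator (fun ω => ((t i)⁻¹ * y i ω) ^ 2) ω) ∂μ := by
          refine integral_mono ?_ ((hui.const_mul _).add (hind.const_mul _)) fun ω => ?_
          · exact ((hGi.sub (hyi.const_mul c)).div_const _).abs
          · dsimp only
            rw [abs_div, abs_of_pos hti, div_le_iff₀ hti]
            by_cases hω : δ ≤ |y i ω|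
            · rw [Set.indicator_of_mem (show ω ∈ {ω | δ ≤ |y i ω|} from hω)]
              have h4 := hR (y i ω)
              have h5 : 0 ≤ K * δ * ((t i)⁻¹ * y i ω) ^ 2 * t i ^ 2 := by positivity
              rw [hsqi ω] at h4
              rw [hsqi ω]
              linarith
            · rw [Set.indicator_of_notMem (show ω ∉ {ω | δ ≤ |y i ω|} from hω)]
              push Not at hω
              have h4 := hK (y i ω) (hω.le.trans (min_le_left _ _))
              have h5 : K * |y i ω| ^ 3 ≤ K * δ * (y i ω ^ 2) := by
                rw [pow_succ, sq_abs]
                have := mul_le_mul_of_nonneg_left hω.le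
                  (mul_nonneg hK0 (sq_nonneg (y i ω)))
                linarith
              calc _ ≤ _ := h4.trans h5
                _ = _ := by rw [hsqi ω]; ring
      _ = K * δ * (∫ ω, ((t i)⁻¹ * y i ω) ^ 2 ∂μ) + (C + |c|) *
            ∫ ω in {ω | δ ≤ |y i ω|}, ((t i)⁻¹ * y i ω) ^ 2 ∂μ := by
          rw [integral_add (hui.const_mul _) (hind.const_mul _), integral_const_mul,
            integral_const_mul, integral_indicator hA]
      _ < ε := by
          have h4 : K * δ * (∫ ω, ((t i)⁻¹ * y i ω) ^ 2 ∂μ) ≤ ε / 4 := by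
            have hδ2 : δ ≤ ε / (4 * (K + 1) * (σ + 1)) := min_le_right _ _
            calc K * δ * (∫ ω, ((t i)⁻¹ * y i ω) ^ 2 ∂μ)
                ≤ (K + 1) * (ε / (4 * (K + 1) * (σ + 1))) * (σ + 1) := by
                  gcongr
                  · linarith
              _ = ε / 4 := by field_simp
          linarith
  have := hrem.add (hlim.const_mul c)
  simpa using this

end L2

/-! ### Triangular arrays -/

section TriangularArray

/-! ### Taylor bounds of the kind required by `tendsto_integral_div_sq`: quadratic everywhere, cubic
near 0. -/

theorem abs_cos_sub_one_le (x : ℝ) : |Real.cos x - 1| ≤ 1 * x ^ 2 := by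
  have h1 := Real.one_sub_sq_div_two_le_cos (x := x)
  have h2 := Real.cos_le_one x
  rw [abs_le]
  constructor <;> nlinarith [sq_nonneg x]

theorem abs_cos_sub_one_add_le (x : ℝ) (hx : |x| ≤ 1 / 2) :
    |Real.cos x - 1 - -(1 / 2) * x ^ 2| ≤ 1 * |x| ^ 3 := by
  have h := Real.cos_bound (x := x) (by linarith)
  have h1 : Real.cos x - 1 - -(1 / 2) * x ^ 2 = Real.cos x - (1 - x ^ 2 / 2) := by ring
  rw [h1]
  refine h.trans ?_
  have h2 : 0 ≤ |x| ^ 3 := by positivity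
  have h3 : |x| ^ 4 = |x| ^ 3 * |x| := by ring
  rw [h3]
  nlinarith [mul_nonneg h2 (abs_nonneg x)]

theorem abs_sin_sub_self_le_cube (x : ℝ) (hx : |x| ≤ 1) : |Real.sin x - x| ≤ 1 * |x| ^ 3 := by
  have h := Real.sin_bound (x := x) hx
  have h2 : 0 ≤ |x| ^ 3 := by positivity
  have h3 : |x| ^ 5 ≤ |x| ^ 3 := pow_le_pow_of_le_one (abs_nonneg x) hx (by norm_num)
  have h4 : |x ^ 3 / 6| = |x| ^ 3 / 6 := by rw [abs_div, abs_pow]; norm_num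
  calc |Real.sin x - x| = |(Real.sin x - (x - x ^ 3 / 6)) - x ^ 3 / 6| := by ring_nf
    _ ≤ |Real.sin x - (x - x ^ 3 / 6)| + |x ^ 3 / 6| := abs_sub _ _
    _ ≤ 1 * |x| ^ 3 := by
      rw [h4]
      linarith

theorem abs_sin_sub_self_le_sq (x : ℝ) : |Real.sin x - x| ≤ 2 * x ^ 2 := by
  rcases le_total |x| 1 with hx | hx
  · have h := abs_sin_sub_self_le_cube x hx
    have h3 : |x| ^ 3 = x ^ 2 * |x| := by rw [pow_succ, sq_abs]
    rw [h3] at h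
    nlinarith [mul_le_mul_of_nonneg_left hx (sq_nonneg x), sq_nonneg x]
  · have h1 := abs_sub (Real.sin x) x
    have h2 : |Real.sin x| ≤ |x| := Real.abs_sin_le_abs
    have h3 : |x| ≤ x ^ 2 := by rw [← sq_abs]; nlinarith
    linarith

theorem norm_pow_sub_pow_le_of_norm_le_one {z w : ℂ} (hz : ‖z‖ ≤ 1) (hw : ‖w‖ ≤ 1) (k : ℕ) :
    ‖z ^ k - w ^ k‖ ≤ k * ‖z - w‖ := by
  induction k with
  | zero => simp
  | succ k ih =>
    have h1 : z ^ (k + 1) - w ^ (k + 1) = z ^ k * (z - w) + (z ^ k - w ^ k) * w := by ring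
    rw [h1]
    have h2 : ‖z ^ k‖ ≤ 1 := by rw [norm_pow]; exact pow_le_one₀ (norm_nonneg _) hz
    calc _ ≤ ‖z ^ k‖ * ‖z - w‖ + ‖z ^ k - w ^ k‖ * ‖w‖ := by
          refine (norm_add_le _ _).trans ?_
          rw [norm_mul, norm_mul]
      _ ≤ 1 * ‖z - w‖ + k * ‖z - w‖ * 1 := by gcongr
      _ = _ := by push_cast; ring

variable {ι : Type*} {l : Filter ι}

/-- Compare z with w = exp(t² a), whose k-th power is exactly exp(k t² a). Both lie in the closed
unit disc, w because Re a ≤ 0, so |z^k − w^k| ≤ k|z − w| = (k t²)·|z − w|/t², which tends to κ · 0.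
-/
theorem tendsto_pow_exp {t : ι → ℝ} {k : ι → ℕ} {z : ι → ℂ} {κ : ℝ} {a : ℂ}
    (ht : Tendsto t l (𝓝 0)) (ht0 : ∀ᶠ i in l, t i ≠ 0)
    (hk : Tendsto (fun i => k i * t i ^ 2) l (𝓝 κ)) (hz : ∀ i, ‖z i‖ ≤ 1)
    (ha : a.re ≤ 0) (hza : Tendsto (fun i => (z i - 1) / (t i : ℂ) ^ 2) l (𝓝 a)) :
    Tendsto (fun i => z i ^ k i) l (𝓝 (Complex.exp (κ * a))) := by
  set w : ι → ℂ := fun i => Complex.exp ((t i : ℂ) ^ 2 * a) with hwdef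
  have hw : ∀ i, ‖w i‖ ≤ 1 := by
    intro i
    rw [hwdef, Complex.norm_exp, Real.exp_le_one_iff]
    have : ((t i : ℂ) ^ 2 * a).re = t i ^ 2 * a.re := by
      rw [← Complex.ofReal_pow, Complex.re_ofReal_mul]
    rw [this]
    exact mul_nonpos_of_nonneg_of_nonpos (sq_nonneg _) ha
  have hsc : Tendsto (fun i => (t i : ℂ) ^ 2) l (𝓝[≠] 0) := by
    refine tendsto_nhdsWithin_iff.2 ⟨?_, ht0.mono fun i hi => by simpa using hi⟩
    have := ((Complex.continuous_ofReal.tendsto 0).comp ht).pow 2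
    simpa using this
  have hwa : Tendsto (fun i => (w i - 1) / (t i : ℂ) ^ 2) l (𝓝 a) := by
    have hd : HasDerivAt (fun s : ℂ => Complex.exp (s * a)) a 0 := by
      have := ((hasDerivAt_id (0 : ℂ)).mul_const a).cexp
      simpa using this
    have := (hasDerivAt_iff_tendsto_slope.1 hd).comp hsc
    refine this.congr fun i => ?_
    simp [slope_def_field, hwdef]
  have hdiff : Tendsto (fun i => z i ^ k i - w i ^ k i) l (𝓝 0) := by
    have h1 : Tendsto (fun i => (k i * t i ^ 2) * ‖(z i - w i) / (t i : ℂ) ^ 2‖) l (𝓝 0) := by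
      have := hk.mul (hza.sub hwa).norm
      simp only [sub_self, norm_zero, mul_zero] at this
      refine this.congr fun i => ?_
      congr 2
      ring
    refine squeeze_zero_norm' ?_ h1
    filter_upwards [ht0] with i hi
    refine (norm_pow_sub_pow_le_of_norm_le_one (hz i) (hw i) (k i)).trans (le_of_eq ?_)
    rw [norm_div, norm_pow, Complex.norm_real, Real.norm_eq_abs, sq_abs]
    field_simp
  have hwk : Tendsto (fun i => w i ^ k i) l (𝓝 (Complex.exp (κ * a))) := by
    have h1 : ∀ i, w i ^ k i = Complex.exp (((k i * t i ^ 2 : ℝ) : ℂ) * a) := by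
      intro i
      rw [hwdef, ← Complex.exp_nat_mul]
      push_cast
      ring_nf
    simp_rw [h1]
    exact (Complex.continuous_exp.tendsto _).comp
      (((Complex.continuous_ofReal.tendsto κ).comp hk).mul_const a)
  simpa using hdiff.add hwk

variable {Ω : Type*} [MeasurableSpace Ω] {μ : Measure Ω}

/-- Central limit theorem for a row of k i independent copies of X i, in terms of characteristic
functions. Mean and second moment are both of order t², so the squared mean plays no role and no
centring is needed. -/
theorem tendsto_integral_cexp_pow [IsProbabilityMeasure μ] {t : ι → ℝ} {X : ι → Ω → ℝ} {g : Ω → ℝ}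
    {m κ : ℝ} {k : ι → ℕ} (ht : Tendsto t l (𝓝 0)) (ht0 : ∀ᶠ i in l, t i ≠ 0)
    (hX : TendstoL2 l μ (fun i ω => (t i)⁻¹ * X i ω) g) (hXm : ∀ i, Measurable (X i))
    (hm : Tendsto (fun i => (∫ ω, X i ω ∂μ) / t i ^ 2) l (𝓝 m))
    (hk : Tendsto (fun i => k i * t i ^ 2) l (𝓝 κ)) :
    Tendsto (fun i => (∫ ω, Complex.exp (X i ω * Complex.I) ∂μ) ^ k i) l
      (𝓝 (Complex.exp (κ * (m * Complex.I - (∫ ω, g ω ^ 2 ∂μ) / 2)))) := by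
  have hcos := tendsto_integral_div_sq ht ht0 hX hXm (G := fun x => Real.cos x - 1)
    (Real.measurable_cos.sub_const 1) abs_cos_sub_one_le abs_cos_sub_one_add_le
  -- Here c = 0, since sin x − x has no quadratic term: to this order the imaginary part sees only
  -- the mean.
  have hsin := tendsto_integral_div_sq ht ht0 hX hXm (G := fun x => Real.sin x - x) (c := 0)
    (Real.measurable_sin.sub measurable_id) (K := 1) abs_sin_sub_self_le_sq
    (fun x hx => by simpa using abs_sin_sub_self_le_cube x (by linarith))
  rw [zero_mul] at hsin
  have hsm := hsin.add hm
  rw [zero_add] at hsm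
  have hXi : ∀ᶠ i in l, Integrable (X i) μ := by
    filter_upwards [ht0] with i hi
    have h1 := ((hX.memLp i).integrable (by norm_num)).const_mul (t i)
    refine h1.congr (ae_of_all _ fun ω => ?_)
    dsimp only
    field_simp
  have hsini : ∀ i, Integrable (fun ω => Real.sin (X i ω)) μ := fun i =>
    (integrable_const (1 : ℝ)).mono' (Real.measurable_sin.comp (hXm i)).aestronglyMeasurable
      (ae_of_all _ fun ω => Real.abs_sin_le_one _)
  have hcosi : ∀ i, Integrable (fun ω => Real.cos (X i ω)) μ := fun i =>
    (integrable_const (1 : ℝ)).mono' (Real.measurable_cos.comp (hXm i)).aestronglyMeasurable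
      (ae_of_all _ fun ω => Real.abs_cos_le_one _)
  refine tendsto_pow_exp ht ht0 hk (fun i => ?_) ?_ ?_
  · refine (norm_integral_le_of_norm_le_const (C := 1) (ae_of_all _ fun ω => ?_)).trans (by simp)
    rw [Complex.norm_exp_ofReal_mul_I]
  · have : 0 ≤ ∫ ω, g ω ^ 2 ∂μ := integral_nonneg fun _ => sq_nonneg _
    have h2 : (m * Complex.I - ((∫ ω, g ω ^ 2 ∂μ : ℝ) : ℂ) / 2).re = - ((∫ ω, g ω ^ 2 ∂μ) / 2) := by
      rw [← Complex.ofReal_ofNat, ← Complex.ofReal_div]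
      simp
    rw [h2]
    linarith
  · have h1 := ((Complex.continuous_ofReal.tendsto _).comp hcos).add
      (((Complex.continuous_ofReal.tendsto _).comp hsm).mul_const Complex.I)
    refine Tendsto.congr' ?_ (h1.trans (le_of_eq ?_))
    · filter_upwards [hXi] with i hi
      have h2 : ∫ ω, Complex.exp (X i ω * Complex.I) ∂μ =
          (∫ ω, Real.cos (X i ω) ∂μ : ℝ) + (∫ ω, Real.sin (X i ω) ∂μ : ℝ) * Complex.I := by
        simp_rw [Complex.exp_mul_I]
        rw [← integral_complex_ofReal, ← integral_complex_ofReal, ← integral_mul_const,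
          ← integral_add]
        · simp
        · exact (hcosi i).ofReal
        · exact (hsini i).ofReal.mul_const _
      rw [h2]
      simp only [Function.comp_apply]
      rw [integral_sub (hcosi i) (integrable_const 1), integral_sub (hsini i) hi]
      simp only [integral_const, probReal_univ, smul_eq_mul, one_mul]
      push_cast
      ring
    · congr 1
      push_cast
      ring

/-- The function `y ↦ 2 log (1 + y / 2)`, cut off at `y = -1`. -/
noncomputable def truncLog (y : ℝ) : ℝ := 2 * Real.log (1 + max y (-1) / 2)

theorem measurable_truncLog : Measurable truncLog := by
  unfold truncLog
  fun_prop

/-- For a root score y, 1 + y/2 is the root of the likelihood ratio, so `truncLog y` is its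
logarithm as long as y > −1 and the ratio is finite. The cutoff keeps away from y = −2, near which
the logarithm is unbounded and no quadratic bound could hold. -/
theorem exp_truncLog {y : ℝ} (hy : -1 < y) : Real.exp (truncLog y) = (1 + y / 2) ^ 2 := by
  rw [truncLog, max_eq_left hy.le, two_mul, Real.exp_add, Real.exp_log (by linarith), sq]

/-- The first bound serves the expansion of the mean, the second the L₂ convergence. -/
theorem truncLog_bounds (y : ℝ) :
    |truncLog y - y| ≤ 3 * y ^ 2 ∧ (truncLog y - y) ^ 2 ≤ 9 * y ^ 2 := by
  rcases le_total (-1) y with hy | hy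
  · have hx : 0 < 1 + y / 2 := by linarith
    have h1 := Real.log_le_sub_one_of_pos hx
    have h2 := Real.one_sub_inv_le_log_of_pos hx
    rw [truncLog, max_eq_left hy]
    set L := Real.log (1 + y / 2)
    have h3 : 1 - (1 + y / 2)⁻¹ = y / (2 + y) := by
      have h4 : (2 + y) ≠ 0 := by linarith
      field_simp
      ring
    rw [h3] at h2
    have hy2 : 0 < 2 + y := by linarith
    -- After multiplication by 2 + y this says y²(1 + y) ≥ 0, which is where y ≥ −1 enters.
    have h5 : y / 2 - y ^ 2 / 2 ≤ y / (2 + y) := by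
      rw [le_div_iff₀ hy2]
      nlinarith [mul_nonneg (sq_nonneg y) (by linarith : (0 : ℝ) ≤ 1 + y)]
    have h6 : -y ^ 2 ≤ 2 * L - y := by linarith
    have h7 : 2 * L - y ≤ 0 := by linarith
    refine ⟨by rw [abs_le]; constructor <;> nlinarith [sq_nonneg y], ?_⟩
    have h8 : -(3 * |y|) ≤ 2 * L - y := by
      rcases le_total 0 y with h0 | h0
      · rw [abs_of_nonneg h0]
        have : 0 ≤ y / (2 + y) := div_nonneg h0 hy2.le
        linarith
      · rw [abs_of_nonpos h0]
        have : y ≤ y / (2 + y) := by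
          rw [le_div_iff₀ hy2]
          nlinarith
        linarith
    calc (2 * L - y) ^ 2 ≤ (3 * |y|) ^ 2 := by
          rw [sq_le_sq, abs_of_nonpos h7, abs_of_nonneg (by positivity)]; linarith
      _ = 9 * y ^ 2 := by rw [mul_pow, sq_abs]; norm_num
  · rw [truncLog, max_eq_right hy]
    have hlog1 : Real.log (1 + -1 / 2) ≤ 0 := Real.log_nonpos (by norm_num) (by norm_num)
    have hlog2 : -1 ≤ Real.log (1 + -1 / 2) := by
      have := Real.one_sub_inv_le_log_of_pos (x := 1 + -1 / 2) (by norm_num)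
      norm_num at this ⊢
      exact this
    set L := Real.log (1 + -1 / 2)
    have h1 : |2 * L - y| ≤ 3 * |y| := by
      rw [abs_of_nonpos (by linarith : y ≤ 0), abs_le]
      constructor <;> linarith
    constructor
    · refine h1.trans ?_
      have : |y| ≤ y ^ 2 := by rw [abs_of_nonpos (by linarith : y ≤ 0)]; nlinarith
      linarith
    · calc (2 * L - y) ^ 2 ≤ (3 * |y|) ^ 2 := by
            rw [← sq_abs]
            exact pow_le_pow_left₀ (abs_nonneg _) h1 2
        _ = 9 * y ^ 2 := by rw [mul_pow, sq_abs]; norm_num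

theorem truncLog_cube (y : ℝ) (hy : |y| ≤ 1 / 2) :
    |truncLog y - y - -(1 / 4) * y ^ 2| ≤ 1 * |y| ^ 3 := by
  have hy1 := abs_le.1 hy
  rw [truncLog, max_eq_left (by linarith)]
  have hx : |-(y / 2)| = |y| / 2 := by rw [abs_neg, abs_div]; norm_num
  have h := Real.abs_log_sub_add_sum_range_le (x := -(y / 2)) (by rw [hx]; linarith) 2
  rw [hx] at h
  norm_num [Finset.sum_range_succ] at h
  have h1 : 2 * Real.log (1 + y / 2) - y - -(1 / 4) * y ^ 2 =
      2 * (-(y / 2) + (y / 2) ^ 2 / 2 + Real.log (1 + y / 2)) := by ring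
  rw [h1, abs_mul, abs_of_pos (by norm_num : (0 : ℝ) < 2)]
  have h2 : (|y| / 2) ^ 3 / (1 - |y| / 2) ≤ |y| ^ 3 / 2 := by
    rw [div_le_iff₀ (by linarith)]
    nlinarith [pow_nonneg (abs_nonneg y) 3]
  linarith

/-- The linearisation error has second moment o(t²): `tendsto_integral_div_sq` is applied with c = 0
to the squared error, which is at most 9x⁴ ≤ 9|x|³ near 0. -/
theorem TendstoL2.truncLog [IsFiniteMeasure μ] {t : ι → ℝ} {y : ι → Ω → ℝ} {g : Ω → ℝ}
    (ht : Tendsto t l (𝓝 0)) (ht0 : ∀ᶠ i in l, t i ≠ 0) (hy2 : ∀ i, MemLp (y i) 2 μ)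
    (hy : TendstoL2 l μ (fun i ω => (t i)⁻¹ * y i ω) g) (hym : ∀ i, Measurable (y i)) :
    TendstoL2 l μ (fun i ω => (t i)⁻¹ * _root_.truncLog (y i ω)) g := by
  have hm : ∀ i, MemLp (fun ω => _root_.truncLog (y i ω) - y i ω) 2 μ := by
    intro i
    have hme := (measurable_truncLog.comp (hym i)).sub (hym i)
    refine (memLp_two_iff_integrable_sq hme.aestronglyMeasurable).2 ?_
    refine ((hy2 i).integrable_sq.const_mul 9).mono' (hme.pow_const 2).aestronglyMeasurable
      (ae_of_all _ fun ω => ?_)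
    rw [Real.norm_of_nonneg (sq_nonneg _)]
    exact (truncLog_bounds (y i ω)).2
  have h := tendsto_integral_div_sq ht ht0 hy hym (G := fun x => (_root_.truncLog x - x) ^ 2) (c := 0)
    (C := 9) (K := 9)
    ((measurable_truncLog.sub measurable_id).pow_const 2)
    (fun x => by rw [abs_of_nonneg (sq_nonneg _)]; exact (truncLog_bounds x).2)
    (fun x hx => by
      rw [zero_mul, sub_zero, abs_of_nonneg (sq_nonneg _), ← sq_abs]
      have h1 := pow_le_pow_left₀ (abs_nonneg _) (truncLog_bounds x).1 2
      have h2 : (3 * x ^ 2) ^ 2 = 9 * |x| ^ 3 * |x| := by rw [← sq_abs x]; ring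
      have h3 : 0 ≤ 9 * |x| ^ 3 := by positivity
      nlinarith)
  rw [zero_mul] at h
  have h0 : TendstoL2 l μ (fun i ω => (t i)⁻¹ * (_root_.truncLog (y i ω) - y i ω)) fun _ => 0 := by
    refine TendstoL2.of_integral_sq (fun i => (hm i).const_mul _) (memLp_const 0) (h.congr fun i => ?_)
    simp_rw [sub_zero, mul_pow]
    rw [integral_const_mul, inv_pow]
    ring
  have := h0.add hy
  convert this using 1
  · ext i ω
    simp only [Pi.add_apply]
    ring
  · ext ω; simp

/-- The limit −1/2 is the sum of two quarters: −1/4 is the quadratic coefficient of `truncLog`, and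
another −1/4 comes from the mean of y itself. -/
theorem tendsto_integral_truncLog [IsFiniteMeasure μ] {t : ι → ℝ} {y : ι → Ω → ℝ} {g : Ω → ℝ}
    (ht : Tendsto t l (𝓝 0)) (ht0 : ∀ᶠ i in l, t i ≠ 0) (hy2 : ∀ i, MemLp (y i) 2 μ)
    (hy : TendstoL2 l μ (fun i ω => (t i)⁻¹ * y i ω) g) (hym : ∀ i, Measurable (y i))
    (hE : Tendsto (fun i => (∫ ω, y i ω ∂μ) / t i ^ 2) l (𝓝 (-(∫ ω, g ω ^ 2 ∂μ) / 4))) :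
    Tendsto (fun i => (∫ ω, truncLog (y i ω) ∂μ) / t i ^ 2) l (𝓝 (-(∫ ω, g ω ^ 2 ∂μ) / 2)) := by
  have h := tendsto_integral_div_sq ht ht0 hy hym (G := fun x => truncLog x - x)
    (measurable_truncLog.sub measurable_id) (fun x => (truncLog_bounds x).1) truncLog_cube
  have h2 := h.add hE
  refine Tendsto.congr (fun i => ?_) (h2.trans (le_of_eq (by congr 1; ring)))
  have hyi : Integrable (y i) μ := (hy2 i).integrable (by norm_num)
  have hi : Integrable (fun ω => truncLog (y i ω) - y i ω) μ := by
    refine ((hy2 i).integrable_sq.const_mul 3).mono'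
      ((measurable_truncLog.comp (hym i)).sub (hym i)).aestronglyMeasurable (ae_of_all _ fun ω => ?_)
    exact (truncLog_bounds (y i ω)).1
  rw [← add_div, ← integral_add hi hyi]
  simp

/-- The indicator of (−∞, −1] is bounded by x² and vanishes near 0, so its expansion has c = 0 and K
= 0. With about 1/t² observations, the cutoff is then active with vanishing probability. -/
theorem tendsto_measureReal_le_neg_one [IsFiniteMeasure μ] {t : ι → ℝ} {y : ι → Ω → ℝ} {g : Ω → ℝ}
    (ht : Tendsto t l (𝓝 0)) (ht0 : ∀ᶠ i in l, t i ≠ 0)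
    (hy : TendstoL2 l μ (fun i ω => (t i)⁻¹ * y i ω) g) (hym : ∀ i, Measurable (y i)) :
    Tendsto (fun i => μ.real {ω | y i ω ≤ -1} / t i ^ 2) l (𝓝 0) := by
  have h := tendsto_integral_div_sq ht ht0 hy hym (c := 0) (C := 1) (K := 0)
    (G := (Set.Iic (-1)).indicator fun _ => 1)
    (measurable_const.indicator measurableSet_Iic)
    (fun x => by
      by_cases hx : x ∈ Set.Iic (-1 : ℝ)
      · rw [Set.indicator_of_mem hx]
        have : x ≤ -1 := hx
        rw [abs_one]; nlinarith
      · rw [Set.indicator_of_notMem hx, abs_zero]; positivity)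
    (fun x hx => by
      rw [Set.indicator_of_notMem (by have := (abs_le.1 hx).1; simp; linarith)]
      simp)
  rw [zero_mul] at h
  refine h.congr fun i => ?_
  congr 1
  have : (fun ω => (Set.Iic (-1 : ℝ)).indicator (fun _ => (1 : ℝ)) (y i ω)) =
      {ω | y i ω ≤ -1}.indicator 1 := by
    ext ω
    simp [Set.indicator]
  rw [this, integral_indicator_one (measurableSet_le (hym i) measurable_const)]

end TriangularArray

/-! ### Partial integration in `L₂` of a product -/

section Marginals

variable {Ω₁ : Type*} {Ω₂ : Type*} [MeasurableSpace Ω₁] [MeasurableSpace Ω₂]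
  {P : Measure Ω₁} {Q : Measure Ω₂} [IsProbabilityMeasure Q]
  {ι : Type*} {l : Filter ι}

theorem eLpNorm_two_sq {Ω : Type*} [MeasurableSpace Ω] (μ : Measure Ω) (f : Ω → ℝ) :
    eLpNorm f 2 μ ^ 2 = ∫⁻ ω, ‖f ω‖ₑ ^ 2 ∂μ := by
  have := eLpNorm_nnreal_pow_eq_lintegral (μ := μ) (f := f) (p := 2) (by norm_num)
  norm_num at this
  exact_mod_cast this

/-- Jensen's inequality on each fibre; Q has mass one. -/
theorem eLpNorm_integral_prod_le {F : Ω₁ × Ω₂ → ℝ} (hF : AEStronglyMeasurable F (P.prod Q)) :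
    eLpNorm (fun x => ∫ y, F (x, y) ∂Q) 2 P ≤ eLpNorm F 2 (P.prod Q) := by
  rw [← ENNReal.pow_le_pow_left_iff two_ne_zero, eLpNorm_two_sq, eLpNorm_two_sq,
    lintegral_prod _ (hF.enorm.pow_const 2)]
  refine lintegral_mono_ae ?_
  filter_upwards [hF.prodMk_left] with x hx
  rw [← eLpNorm_two_sq Q]
  gcongr
  calc ‖∫ y, F (x, y) ∂Q‖ₑ ≤ ∫⁻ y, ‖F (x, y)‖ₑ ∂Q := enorm_integral_le_lintegral_enorm _
    _ = eLpNorm (fun y => F (x, y)) 1 Q := eLpNorm_one_eq_lintegral_enorm.symm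
    _ ≤ eLpNorm (fun y => F (x, y)) 2 Q :=
      eLpNorm_le_eLpNorm_of_exponent_le (by norm_num) hx

theorem memLp_integral_prod [SFinite P] {F : Ω₁ × Ω₂ → ℝ} (hF : MemLp F 2 (P.prod Q)) :
    MemLp (fun x => ∫ y, F (x, y) ∂Q) 2 P :=
  ⟨hF.aestronglyMeasurable.integral_prod_right',
    (eLpNorm_integral_prod_le hF.aestronglyMeasurable).trans_lt hF.eLpNorm_lt_top⟩

theorem TendstoL2.integral_prod [IsFiniteMeasure P] {w : ι → Ω₁ × Ω₂ → ℝ} {g : Ω₁ × Ω₂ → ℝ}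
    (h : TendstoL2 l (P.prod Q) w g) :
    TendstoL2 l P (fun i x => ∫ y, w i (x, y) ∂Q) fun x => ∫ y, g (x, y) ∂Q := by
  refine ⟨fun i => memLp_integral_prod (h.memLp i), memLp_integral_prod h.memLp_lim, ?_⟩
  refine tendsto_of_tendsto_of_tendsto_of_le_of_le tendsto_const_nhds h.tendsto_eLpNorm
    (fun _ => zero_le) fun i => ?_
  refine le_trans (le_of_eq (eLpNorm_congr_ae ?_))
    (eLpNorm_integral_prod_le ((h.memLp i).sub h.memLp_lim).aestronglyMeasurable)
  filter_upwards [((h.memLp i).integrable (by norm_num)).prod_right_ae,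
    (h.memLp_lim.integrable (by norm_num)).prod_right_ae] with x h1 h2
  simp only [Pi.sub_apply]
  rw [integral_sub h1 h2]

theorem TendstoL2.comp_measurePreserving {Ω Ω' : Type*} [MeasurableSpace Ω] [MeasurableSpace Ω']
    {μ : Measure Ω} {μ' : Measure Ω'} {φ : Ω' → Ω} (hφ : MeasurePreserving φ μ' μ)
    {u : ι → Ω → ℝ} {g : Ω → ℝ} (h : TendstoL2 l μ u g) :
    TendstoL2 l μ' (fun i => u i ∘ φ) (g ∘ φ) := by
  refine ⟨fun i => (h.memLp i).comp_measurePreserving hφ,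
    h.memLp_lim.comp_measurePreserving hφ, h.tendsto_eLpNorm.congr fun i => ?_⟩
  rw [← eLpNorm_comp_measurePreserving ((h.memLp i).sub h.memLp_lim).aestronglyMeasurable hφ]
  rfl

theorem integrable_one_add_half_sq {Ω : Type*} [MeasurableSpace Ω] {μ : Measure Ω}
    [IsProbabilityMeasure μ] {a : Ω → ℝ} (ha : MemLp a 2 μ) :
    Integrable (fun ω => (1 + a ω / 2) ^ 2) μ := by
  have ha2 : MemLp (fun ω => a ω / 2) 2 μ := by
    simpa only [div_eq_inv_mul] using ha.const_mul (2⁻¹ : ℝ)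
  exact ((memLp_const (1 : ℝ)).add ha2).integrable_sq

theorem integral_one_add_half_sq {Ω : Type*} [MeasurableSpace Ω] {μ : Measure Ω}
    [IsProbabilityMeasure μ] {a : Ω → ℝ} (ha : MemLp a 2 μ) :
    ∫ ω, (1 + a ω / 2) ^ 2 ∂μ = 1 + ∫ ω, a ω ∂μ + (∫ ω, a ω ^ 2 ∂μ) / 4 := by
  have hi : Integrable a μ := ha.integrable (by norm_num)
  have h1 : Integrable (fun ω => 1 + a ω) μ := (integrable_const 1).add hi
  have h2 : (fun ω => (1 + a ω / 2) ^ 2) = fun ω => (1 + a ω) + a ω ^ 2 / 4 := by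
    ext ω; ring
  rw [h2, integral_add h1 (ha.integrable_sq.div_const 4), integral_add (integrable_const 1) hi,
    integral_div]
  simp

/-- σ and τ are the singular masses, so that 1 + a/2 and 1 + b/2 have squared norms 1 − σ and 1 − τ.
The mean of w = a + b + ab/2 is of second order and, by signs, dominates both marginal means. -/
theorem tendsto_integral_marginals_of_prod [IsProbabilityMeasure P] {t : ι → ℝ} {a : ι → Ω₁ → ℝ} {b : ι → Ω₂ → ℝ} {σ τ : ι → ℝ}
    {g : Ω₁ × Ω₂ → ℝ} (ht : Tendsto t l (𝓝 0)) (ht0 : ∀ᶠ i in l, t i ≠ 0)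
    (ha : ∀ i, MemLp (a i) 2 P) (hb : ∀ i, MemLp (b i) 2 Q)
    (ha2 : ∀ i ω, -2 ≤ a i ω) (hb2 : ∀ i ω, -2 ≤ b i ω)
    (hσ : ∀ i, 0 ≤ σ i) (hτ : ∀ i, 0 ≤ τ i)
    (hEa : ∀ i, ∫ ω, a i ω ∂P = -σ i - (∫ ω, a i ω ^ 2 ∂P) / 4)
    (hEb : ∀ i, ∫ ω, b i ω ∂Q = -τ i - (∫ ω, b i ω ^ 2 ∂Q) / 4)
    (hs : Tendsto (fun i => (σ i + τ i - σ i * τ i) / t i ^ 2) l (𝓝 0))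
    (hw : TendstoL2 l (P.prod Q) (fun i ω => (t i)⁻¹ * (a i ω.1 + b i ω.2 + a i ω.1 * b i ω.2 / 2))
      g) :
    Tendsto (fun i => (t i)⁻¹ * ∫ ω, a i ω ∂P) l (𝓝 0) ∧
      Tendsto (fun i => (t i)⁻¹ * ∫ ω, b i ω ∂Q) l (𝓝 0) := by
  have hai : ∀ i, Integrable (a i) P := fun i => (ha i).integrable (by norm_num)
  have hbi : ∀ i, Integrable (b i) Q := fun i => (hb i).integrable (by norm_num)
  have hai2 : ∀ i, Integrable (fun ω => a i ω ^ 2) P := fun i => (ha i).integrable_sq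
  have hbi2 : ∀ i, Integrable (fun ω => b i ω ^ 2) Q := fun i => (hb i).integrable_sq
  have ha2' : ∀ i, -2 ≤ ∫ ω, a i ω ∂P := fun i => by
    have := integral_mono (integrable_const (-2 : ℝ)) (hai i) (ha2 i)
    simpa using this
  have hb2' : ∀ i, -2 ≤ ∫ ω, b i ω ∂Q := fun i => by
    have := integral_mono (integrable_const (-2 : ℝ)) (hbi i) (hb2 i)
    simpa using this
  have ha0 : ∀ i, ∫ ω, a i ω ∂P ≤ 0 := fun i => by
    rw [hEa]
    have : 0 ≤ ∫ ω, a i ω ^ 2 ∂P := integral_nonneg fun _ => sq_nonneg _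
    linarith [hσ i]
  have hb0 : ∀ i, ∫ ω, b i ω ∂Q ≤ 0 := fun i => by
    rw [hEb]
    have : 0 ≤ ∫ ω, b i ω ^ 2 ∂Q := integral_nonneg fun _ => sq_nonneg _
    linarith [hτ i]
  -- the integral of the product term is of second order
  have hab : ∀ i, Integrable (fun ω : Ω₁ × Ω₂ => a i ω.1 + b i ω.2) (P.prod Q) := fun i =>
    ((hai i).comp_fst Q).add ((hbi i).comp_snd P)
  have hwi : ∀ i, Integrable (fun ω : Ω₁ × Ω₂ => a i ω.1 + b i ω.2 + a i ω.1 * b i ω.2 / 2)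
      (P.prod Q) := fun i => (hab i).add (((hai i).mul_prod (hbi i)).div_const 2)
  have hEw : ∀ i, ∫ ω, (a i ω.1 + b i ω.2 + a i ω.1 * b i ω.2 / 2) ∂(P.prod Q) =
      ∫ ω, a i ω ∂P + ∫ ω, b i ω ∂Q + (∫ ω, a i ω ∂P) * (∫ ω, b i ω ∂Q) / 2 := by
    intro i
    rw [integral_add (hab i) (((hai i).mul_prod (hbi i)).div_const 2),
      integral_add ((hai i).comp_fst Q) ((hbi i).comp_snd P), integral_div, integral_prod_mul,
      integral_fun_fst, integral_fun_snd]
    simp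
  have hA1 : ∀ i, ∫ ω, (1 + a i ω / 2) ^ 2 ∂P = 1 - σ i := fun i => by
    rw [integral_one_add_half_sq (ha i), hEa]; ring
  have hB1 : ∀ i, ∫ ω, (1 + b i ω / 2) ^ 2 ∂Q = 1 - τ i := fun i => by
    rw [integral_one_add_half_sq (hb i), hEb]; ring
  -- Since w + 2 = 2(1 + a/2)(1 + b/2), w² = 4(1 + a/2)²(1 + b/2)² − 4w − 4, and the product
  -- integrates to (1 − σ)(1 − τ). Thus ∫ w = −(∫ w²)/4 − (σ + τ − στ).
  have hEw2 : ∀ i, ∫ ω, (a i ω.1 + b i ω.2 + a i ω.1 * b i ω.2 / 2) ^ 2 ∂(P.prod Q) =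
      -4 * (∫ ω, (a i ω.1 + b i ω.2 + a i ω.1 * b i ω.2 / 2) ∂(P.prod Q)) -
        4 * (σ i + τ i - σ i * τ i) := by
    intro i
    have hA := integrable_one_add_half_sq (ha i)
    have hB := integrable_one_add_half_sq (hb i)
    have hw4 : Integrable (fun ω : Ω₁ × Ω₂ =>
        4 * (a i ω.1 + b i ω.2 + a i ω.1 * b i ω.2 / 2) + 4) (P.prod Q) :=
      ((hwi i).const_mul 4).add (integrable_const 4)
    have h1 : (fun ω : Ω₁ × Ω₂ => (a i ω.1 + b i ω.2 + a i ω.1 * b i ω.2 / 2) ^ 2) = fun ω =>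
        4 * ((1 + a i ω.1 / 2) ^ 2 * (1 + b i ω.2 / 2) ^ 2) -
          (4 * (a i ω.1 + b i ω.2 + a i ω.1 * b i ω.2 / 2) + 4) := by
      ext ω; ring
    rw [h1, integral_sub ((hA.mul_prod hB).const_mul 4) hw4, integral_add ((hwi i).const_mul 4)
      (integrable_const 4), integral_const_mul, integral_const_mul, integral_prod_mul
      (fun ω => (1 + a i ω / 2) ^ 2) fun ω => (1 + b i ω / 2) ^ 2, hA1, hB1]
    simp only [integral_const, probReal_univ, smul_eq_mul]
    ring
  have hEwlim : Tendsto (fun i => (t i)⁻¹ * ∫ ω, (a i ω.1 + b i ω.2 + a i ω.1 * b i ω.2 / 2)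
      ∂(P.prod Q)) l (𝓝 0) := by
    have h1 := ((hw.integral_sq.div_const 4).neg.sub hs).mul ht
    rw [mul_zero] at h1
    refine h1.congr' ?_
    filter_upwards [ht0] with i hi
    have h2 : ∫ ω, ((t i)⁻¹ * (a i ω.1 + b i ω.2 + a i ω.1 * b i ω.2 / 2)) ^ 2 ∂(P.prod Q) =
        ((t i)⁻¹) ^ 2 * ∫ ω, (a i ω.1 + b i ω.2 + a i ω.1 * b i ω.2 / 2) ^ 2 ∂(P.prod Q) := by
      rw [← integral_const_mul]
      exact integral_congr_ae (ae_of_all _ fun ω => mul_pow _ _ _)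
    rw [h2, hEw2]
    generalize ∫ ω, (a i ω.1 + b i ω.2 + a i ω.1 * b i ω.2 / 2) ∂(P.prod Q) = W
    field_simp
    ring
  -- With A, B in [−2, 0], A + B + AB/2 = A + B(1 + A/2) ≤ A ≤ 0, and likewise with A and B
  -- exchanged.
  have hbig : ∀ i, |∫ ω, a i ω ∂P| ≤
        |∫ ω, (a i ω.1 + b i ω.2 + a i ω.1 * b i ω.2 / 2) ∂(P.prod Q)| ∧
      |∫ ω, b i ω ∂Q| ≤
        |∫ ω, (a i ω.1 + b i ω.2 + a i ω.1 * b i ω.2 / 2) ∂(P.prod Q)| := by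
    intro i
    rw [hEw]
    have h1 := ha0 i
    have h2 := hb0 i
    have h3 := ha2' i
    have h4 := hb2' i
    set A := ∫ ω, a i ω ∂P
    set B := ∫ ω, b i ω ∂Q
    have h5 : B * (1 + A / 2) ≤ 0 := mul_nonpos_of_nonpos_of_nonneg h2 (by linarith)
    have h6 : A * (1 + B / 2) ≤ 0 := mul_nonpos_of_nonpos_of_nonneg h1 (by linarith)
    have h7 : A + B + A * B / 2 ≤ 0 := by linarith
    rw [abs_of_nonpos h1, abs_of_nonpos h2, abs_of_nonpos h7]
    constructor <;> linarith
  have hsmall : ∀ c : ι → ℝ, (∀ i, |c i| ≤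
      |∫ ω, (a i ω.1 + b i ω.2 + a i ω.1 * b i ω.2 / 2) ∂(P.prod Q)|) →
      Tendsto (fun i => (t i)⁻¹ * c i) l (𝓝 0) := by
    intro c hc
    refine squeeze_zero_norm (fun i => ?_) (by simpa only [norm_zero] using hEwlim.norm)
    rw [norm_mul, norm_mul]
    exact mul_le_mul_of_nonneg_left (hc i) (norm_nonneg _)
  exact ⟨hsmall _ fun i => (hbig i).1, hsmall _ fun i => (hbig i).2⟩
/-- If `(a i ⊕ b i + (a i ⊗ b i) / 2) / t i` converges in `L₂(P ⊗ Q)`, where `1 + a i / 2` and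
`1 + b i / 2` are square roots of sub-probability densities, then `a i / t i` converges. -/
theorem TendstoL2.fst_of_prod [IsProbabilityMeasure P]
    {t : ι → ℝ} {a : ι → Ω₁ → ℝ} {b : ι → Ω₂ → ℝ} {σ τ : ι → ℝ}
    {g : Ω₁ × Ω₂ → ℝ} (ht : Tendsto t l (𝓝 0)) (ht0 : ∀ᶠ i in l, t i ≠ 0)
    (ha : ∀ i, MemLp (a i) 2 P) (hb : ∀ i, MemLp (b i) 2 Q)
    (ha2 : ∀ i ω, -2 ≤ a i ω) (hb2 : ∀ i ω, -2 ≤ b i ω)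
    (hσ : ∀ i, 0 ≤ σ i) (hτ : ∀ i, 0 ≤ τ i)
    (hEa : ∀ i, ∫ ω, a i ω ∂P = -σ i - (∫ ω, a i ω ^ 2 ∂P) / 4)
    (hEb : ∀ i, ∫ ω, b i ω ∂Q = -τ i - (∫ ω, b i ω ^ 2 ∂Q) / 4)
    (hs : Tendsto (fun i => (σ i + τ i - σ i * τ i) / t i ^ 2) l (𝓝 0))
    (hw : TendstoL2 l (P.prod Q) (fun i ω => (t i)⁻¹ * (a i ω.1 + b i ω.2 + a i ω.1 * b i ω.2 / 2))
      g) :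
    TendstoL2 l P (fun i ω => (t i)⁻¹ * a i ω) (fun x => ∫ y, g (x, y) ∂Q) := by
  have hbl := (tendsto_integral_marginals_of_prod ht ht0 ha hb ha2 hb2 hσ hτ hEa hEb hs hw).2
  have hbi : ∀ i, Integrable (b i) Q := fun i => (hb i).integrable (by norm_num)
  have hA1 : ∀ i, ∫ ω, (1 + a i ω / 2) ^ 2 ∂P = 1 - σ i := fun i => by
    rw [integral_one_add_half_sq (ha i), hEa]; ring
  have hproj := hw.integral_prod
  -- Integrating w over the second variable gives a + B(1 + a/2) with B = ∫ b. This is the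
  -- correction to be removed; its squared norm is (B/t)²(1 − σ) ≤ (B/t)².
  have h0 : TendstoL2 l P (fun i ω => -((t i)⁻¹ * ∫ y, b i y ∂Q) * (1 + a i ω / 2)) fun _ => 0 := by
    have hai' : ∀ i, MemLp (fun ω => a i ω / 2) 2 P := fun i => by
      simpa only [div_eq_inv_mul] using (ha i).const_mul (2⁻¹ : ℝ)
    have hm : ∀ i, MemLp (fun ω => -((t i)⁻¹ * ∫ y, b i y ∂Q) * (1 + a i ω / 2)) 2 P := fun i =>
      ((memLp_const (1 : ℝ)).add (hai' i)).const_mul (-((t i)⁻¹ * ∫ y, b i y ∂Q))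
    refine TendstoL2.of_integral_sq hm (memLp_const 0) ?_
    have h1 := hbl.pow 2
    simp only [ne_eq, OfNat.ofNat_ne_zero, not_false_eq_true, zero_pow] at h1
    refine tendsto_of_tendsto_of_tendsto_of_le_of_le tendsto_const_nhds h1
      (fun i => integral_nonneg fun _ => sq_nonneg _) fun i => ?_
    simp_rw [sub_zero, mul_pow]
    rw [integral_const_mul, neg_sq, ← mul_pow]
    exact mul_le_of_le_one_right (sq_nonneg _) (by rw [hA1]; linarith [hσ i])
  have h2 := hproj.add h0
  convert h2 using 1
  · ext i ω
    simp only [Pi.add_apply]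
    have h3 : ∫ y, (t i)⁻¹ * (a i ω + b i y + a i ω * b i y / 2) ∂Q =
        (t i)⁻¹ * (a i ω + ∫ y, b i y ∂Q + a i ω * (∫ y, b i y ∂Q) / 2) := by
      have hcb : Integrable (fun y => a i ω + b i y) Q := (integrable_const _).add (hbi i)
      rw [integral_const_mul, integral_add hcb
        (((hbi i).const_mul _).div_const 2), integral_add (integrable_const _) (hbi i),
        integral_div, integral_const_mul]
      simp
    rw [h3]
    ring
  · ext ω; simp

end Marginals

/-! ### `L₂`-differentiable curves and their products -/

section RootScore

variable {Ω : Type*} [MeasurableSpace Ω]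

/-- The function `2 ((dP/dQ)^{1/2} - 1)`. -/
noncomputable def rootScore (P Q : Measure Ω) (ω : Ω) : ℝ :=
  2 * (√(likelihoodRatio P Q ω).toReal - 1)

theorem measurable_rootScore (P Q : Measure Ω) : Measurable (rootScore P Q) :=
  (((measurable_likelihoodRatio P Q).ennreal_toReal.sqrt).sub_const 1).const_mul 2

theorem neg_two_le_rootScore (P Q : Measure Ω) (ω : Ω) : -2 ≤ rootScore P Q ω := by
  have := Real.sqrt_nonneg (likelihoodRatio P Q ω).toReal
  rw [rootScore]
  linarith

theorem one_add_rootScore_sq (P Q : Measure Ω) (ω : Ω) :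
    (1 + rootScore P Q ω / 2) ^ 2 = (likelihoodRatio P Q ω).toReal := by
  rw [rootScore]
  have : 1 + 2 * (√(likelihoodRatio P Q ω).toReal - 1) / 2 = √(likelihoodRatio P Q ω).toReal := by
    ring
  rw [this, Real.sq_sqrt ENNReal.toReal_nonneg]

theorem memLp_rootScore (P Q : Measure Ω) [IsProbabilityMeasure P] [IsProbabilityMeasure Q] :
    MemLp (rootScore P Q) 2 Q := by
  have h1 : MemLp (fun ω => √(likelihoodRatio P Q ω).toReal) 2 Q := by
    refine (memLp_two_iff_integrable_sq
      ((measurable_likelihoodRatio P Q).ennreal_toReal.sqrt).aestronglyMeasurable).2 ?_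
    refine (integrable_likelihoodRatio P Q).congr (ae_of_all _ fun ω => ?_)
    exact (Real.sq_sqrt ENNReal.toReal_nonneg).symm
  exact (h1.sub (memLp_const (1 : ℝ))).const_mul 2

/-- The square of 1 + y/2 is the likelihood ratio, which integrates to one minus the singular mass.
This identity is the reason why the mean of a root score is of second order. -/
theorem integral_rootScore (P Q : Measure Ω) [IsProbabilityMeasure P] [IsProbabilityMeasure Q] :
    ∫ ω, rootScore P Q ω ∂Q = -P.real {ω | likelihoodRatio P Q ω = ∞} -
      (∫ ω, rootScore P Q ω ^ 2 ∂Q) / 4 := by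
  have h := integral_one_add_half_sq (memLp_rootScore P Q)
  simp_rw [one_add_rootScore_sq] at h
  rw [integral_likelihoodRatio] at h
  linarith

/-- Division by t turns the two little-o conditions into limits, the form in which `TendstoL2`
applies. At t = 0 the quotient is 0, so square integrability holds for every t. -/
theorem isL2Differentiable_iff {p : ℝ → ProbabilityMeasure Ω} {g : Ω → ℝ} :
    IsL2Differentiable p g ↔
      TendstoL2 (𝓝[≠] 0) (p 0 : Measure Ω) (fun t ω => t⁻¹ * rootScore (p t) (p 0) ω) g ∧
      Tendsto (fun t : ℝ => (p t : Measure Ω).real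
        {ω | likelihoodRatio (p t : Measure Ω) (p 0 : Measure Ω) ω = ∞} / t ^ 2) (𝓝[≠] 0) (𝓝 0) := by
  have hne : ∀ᶠ t : ℝ in 𝓝[≠] 0, t ≠ 0 := eventually_mem_nhdsWithin
  have key : ∀ g : Ω → ℝ, MemLp g 2 (p 0 : Measure Ω) → ∀ᶠ t : ℝ in 𝓝[≠] 0,
      (eLpNorm (fun ω =>
        2 * (√(likelihoodRatio (p t : Measure Ω) (p 0 : Measure Ω) ω).toReal - 1) - t * g ω)
        2 (p 0 : Measure Ω)).toReal / |t| =
      (eLpNorm ((fun ω => t⁻¹ * rootScore (p t) (p 0) ω) - g) 2 (p 0 : Measure Ω)).toReal := by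
    intro g hg
    filter_upwards [hne] with t ht
    have h1 : ((fun ω => t⁻¹ * rootScore (p t : Measure Ω) (p 0) ω) - g) = t⁻¹ • (fun ω =>
        2 * (√(likelihoodRatio (p t : Measure Ω) (p 0 : Measure Ω) ω).toReal - 1) - t * g ω) := by
      ext ω
      simp only [Pi.sub_apply, Pi.smul_apply, smul_eq_mul, rootScore]
      field_simp
    rw [h1, eLpNorm_const_smul, ENNReal.toReal_mul, toReal_enorm, norm_inv, Real.norm_eq_abs]
    field_simp
  constructor
  · rintro ⟨hg, h1, h2⟩
    have hm : ∀ t : ℝ, MemLp (fun ω => t⁻¹ * rootScore (p t) (p 0) ω) 2 (p 0 : Measure Ω) :=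
      fun t => (memLp_rootScore _ _).const_mul _
    refine ⟨⟨hm, hg, ?_⟩, ?_⟩
    · have h3 := (h1.tendsto_div_nhds_zero.congr' (key g hg))
      have h4 := (ENNReal.continuous_ofReal.tendsto 0).comp h3
      rw [ENNReal.ofReal_zero] at h4
      refine h4.congr fun t => ?_
      exact ENNReal.ofReal_toReal ((hm t).sub hg).eLpNorm_lt_top.ne
    · exact h2.tendsto_div_nhds_zero
  · rintro ⟨⟨_, hg, h1⟩, h2⟩
    refine ⟨hg, ?_, ?_⟩
    · refine (isLittleO_iff_tendsto' ?_).2 ?_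
      · filter_upwards [hne] with t ht h
        exact absurd (abs_eq_zero.1 h) ht
      · have h3 := (ENNReal.continuousAt_toReal ENNReal.zero_ne_top).tendsto.comp h1
        exact h3.congr' ((key g hg).mono fun t ht => ht.symm)
    · refine (isLittleO_iff_tendsto' ?_).2 h2
      filter_upwards [hne] with t ht h
      exact absurd (pow_eq_zero_iff two_ne_zero |>.1 h) ht

theorem IsL2Differentiable.tendsto_integral_rootScore {p : ℝ → ProbabilityMeasure Ω} {g : Ω → ℝ}
    (h : IsL2Differentiable p g) :
    Tendsto (fun t : ℝ => (∫ ω, rootScore (p t) (p 0) ω ∂(p 0 : Measure Ω)) / t ^ 2) (𝓝[≠] 0)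
      (𝓝 (-(∫ ω, g ω ^ 2 ∂(p 0 : Measure Ω)) / 4)) := by
  obtain ⟨h1, h2⟩ := isL2Differentiable_iff.1 h
  have h3 := h2.neg.sub (h1.integral_sq.div_const 4)
  rw [neg_zero, zero_sub, ← neg_div] at h3
  refine h3.congr' ?_
  filter_upwards [eventually_mem_nhdsWithin] with t (ht : t ≠ 0)
  have h4 : ∫ ω, (t⁻¹ * rootScore (p t) (p 0) ω) ^ 2 ∂(p 0 : Measure Ω) =
      (t⁻¹) ^ 2 * ∫ ω, rootScore (p t) (p 0) ω ^ 2 ∂(p 0 : Measure Ω) := by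
    rw [← integral_const_mul]
    exact integral_congr_ae (ae_of_all _ fun ω => mul_pow _ _ _)
  rw [integral_rootScore, h4]
  field_simp

theorem IsL2Differentiable.congr_tangent {p : ℝ → ProbabilityMeasure Ω} {g g' : Ω → ℝ}
    (h : IsL2Differentiable p g) (hg : g =ᵐ[(p 0 : Measure Ω)] g') : IsL2Differentiable p g' := by
  rw [isL2Differentiable_iff] at h ⊢
  exact ⟨h.1.congr_lim hg, h.2⟩

theorem IsL2Differentiable.congr_curve {p p' : ℝ → ProbabilityMeasure Ω} {g : Ω → ℝ}
    (h : IsL2Differentiable p g) (h0 : p 0 = p' 0) (hp : ∀ᶠ t in 𝓝[≠] 0, p t = p' t) :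
    IsL2Differentiable p' g := by
  obtain ⟨h1, h2, h3⟩ := h
  rw [h0] at h1 h2 h3
  refine ⟨h1, h2.congr' ?_ EventuallyEq.rfl, h3.congr' ?_ EventuallyEq.rfl⟩
  · filter_upwards [hp] with t ht; rw [ht]
  · filter_upwards [hp] with t ht; rw [ht]

end RootScore

section ProductCurves

variable {Ω₁ : Type*} {Ω₂ : Type*} [MeasurableSpace Ω₁] [MeasurableSpace Ω₂]

theorem rootScore_prod (P Q : Measure Ω₁) (P' Q' : Measure Ω₂) [IsProbabilityMeasure P]
    [IsProbabilityMeasure Q] [IsProbabilityMeasure P'] [IsProbabilityMeasure Q'] :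
    rootScore (P.prod P') (Q.prod Q') =ᵐ[Q.prod Q'] fun ω =>
      rootScore P Q ω.1 + rootScore P' Q' ω.2 + rootScore P Q ω.1 * rootScore P' Q' ω.2 / 2 := by
  filter_upwards [likelihoodRatio_prod P Q P' Q'] with ω h
  simp only [rootScore]
  rw [h, ENNReal.toReal_mul, Real.sqrt_mul ENNReal.toReal_nonneg]
  ring

/-- The masses of the absolutely continuous parts multiply: 1 − s = (1 − σ)(1 − τ). -/
theorem measureReal_likelihoodRatio_prod_eq_top (P Q : Measure Ω₁) (P' Q' : Measure Ω₂)
    [IsProbabilityMeasure P] [IsProbabilityMeasure Q] [IsProbabilityMeasure P']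
    [IsProbabilityMeasure Q'] :
    (P.prod P').real {ω | likelihoodRatio (P.prod P') (Q.prod Q') ω = ∞} =
      P.real {ω | likelihoodRatio P Q ω = ∞} + P'.real {ω | likelihoodRatio P' Q' ω = ∞} -
        P.real {ω | likelihoodRatio P Q ω = ∞} * P'.real {ω | likelihoodRatio P' Q' ω = ∞} := by
  have h1 := integral_likelihoodRatio (P.prod P') (Q.prod Q')
  have h2 : ∫ ω, (likelihoodRatio (P.prod P') (Q.prod Q') ω).toReal ∂(Q.prod Q') =
      (∫ ω, (likelihoodRatio P Q ω).toReal ∂Q) * ∫ ω, (likelihoodRatio P' Q' ω).toReal ∂Q' := by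
    rw [← integral_prod_mul]
    refine integral_congr_ae ?_
    filter_upwards [likelihoodRatio_prod P Q P' Q'] with ω h
    rw [h, ENNReal.toReal_mul]
  rw [h2, integral_likelihoodRatio, integral_likelihoodRatio] at h1
  linarith

variable {p : ℝ → ProbabilityMeasure Ω₁} {q : ℝ → ProbabilityMeasure Ω₂} {g : Ω₁ × Ω₂ → ℝ}

theorem tendstoL2_of_prod (h : IsL2Differentiable (fun t => (p t).prod (q t)) g) :
    TendstoL2 (𝓝[≠] 0) ((p 0 : Measure Ω₁).prod (q 0 : Measure Ω₂))
      (fun t ω => t⁻¹ * (rootScore (p t) (p 0) ω.1 + rootScore (q t) (q 0) ω.2 +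
        rootScore (p t) (p 0) ω.1 * rootScore (q t) (q 0) ω.2 / 2)) g := by
  obtain ⟨h1, h2⟩ := isL2Differentiable_iff.1 h
  simp only [ProbabilityMeasure.toMeasure_prod] at h1
  have hae : ∀ t, (fun ω => t⁻¹ * rootScore ((p t : Measure Ω₁).prod (q t : Measure Ω₂))
      ((p 0 : Measure Ω₁).prod (q 0 : Measure Ω₂)) ω) =ᵐ[(p 0 : Measure Ω₁).prod (q 0 : Measure Ω₂)]
      fun ω => t⁻¹ * (rootScore (p t) (p 0) ω.1 + rootScore (q t) (q 0) ω.2 +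
        rootScore (p t) (p 0) ω.1 * rootScore (q t) (q 0) ω.2 / 2) := by
    intro t
    filter_upwards [rootScore_prod (p t : Measure Ω₁) (p 0) (q t : Measure Ω₂) (q 0)] with ω hω
    rw [hω]
  refine ⟨fun t => (memLp_congr_ae (hae t)).1 (h1.memLp t), h1.memLp_lim,
    h1.tendsto_eLpNorm.congr fun t => ?_⟩
  exact eLpNorm_congr_ae ((hae t).sub EventuallyEq.rfl)

theorem tendsto_singular_of_prod (h : IsL2Differentiable (fun t => (p t).prod (q t)) g) :
    Tendsto (fun t : ℝ => ((p t : Measure Ω₁).real {ω | likelihoodRatio (p t) (p 0) ω = ∞} +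
      (q t : Measure Ω₂).real {ω | likelihoodRatio (q t) (q 0) ω = ∞} -
      (p t : Measure Ω₁).real {ω | likelihoodRatio (p t) (p 0) ω = ∞} *
        (q t : Measure Ω₂).real {ω | likelihoodRatio (q t) (q 0) ω = ∞}) / t ^ 2)
      (𝓝[≠] 0) (𝓝 0) := by
  obtain ⟨h1, h2⟩ := isL2Differentiable_iff.1 h
  simpa only [ProbabilityMeasure.toMeasure_prod, measureReal_likelihoodRatio_prod_eq_top] using h2

theorem isL2Differentiable_fst_of_prod (h : IsL2Differentiable (fun t => (p t).prod (q t)) g) :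
    IsL2Differentiable p (fun x => ∫ y, g (x, y) ∂(q 0 : Measure Ω₂)) ∧
      ∫ x, ∫ y, g (x, y) ∂(q 0 : Measure Ω₂) ∂(p 0 : Measure Ω₁) = 0 := by
  have hs := tendsto_singular_of_prod h
  have ht : Tendsto (fun t : ℝ => t) (𝓝[≠] 0) (𝓝 0) := tendsto_nhdsWithin_of_tendsto_nhds tendsto_id
  have ht0 : ∀ᶠ t : ℝ in 𝓝[≠] 0, t ≠ 0 := eventually_mem_nhdsWithin
  have hsing : Tendsto (fun t : ℝ => (p t : Measure Ω₁).real
      {ω | likelihoodRatio (p t) (p 0) ω = ∞} / t ^ 2) (𝓝[≠] 0) (𝓝 0) := by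
    refine tendsto_of_tendsto_of_tendsto_of_le_of_le tendsto_const_nhds hs
      (fun t => div_nonneg measureReal_nonneg (sq_nonneg t)) fun t => ?_
    refine div_le_div_of_nonneg_right ?_ (sq_nonneg t)
    have h1 : (p t : Measure Ω₁).real {ω | likelihoodRatio (p t) (p 0) ω = ∞} ≤ 1 :=
      measureReal_le_one
    have h2 : 0 ≤ (q t : Measure Ω₂).real {ω | likelihoodRatio (q t) (q 0) ω = ∞} :=
      measureReal_nonneg
    -- σ ≤ σ + τ − στ because τ(1 − σ) ≥ 0.
    nlinarith
  have h1 := TendstoL2.fst_of_prod ht ht0 (fun t => memLp_rootScore (p t : Measure Ω₁) (p 0))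
    (fun t => memLp_rootScore (q t : Measure Ω₂) (q 0)) (fun t => neg_two_le_rootScore _ _)
    (fun t => neg_two_le_rootScore _ _) (fun t => measureReal_nonneg) (fun t => measureReal_nonneg)
    (fun t => integral_rootScore _ _) (fun t => integral_rootScore _ _) hs (tendstoL2_of_prod h)
  refine ⟨isL2Differentiable_iff.2 ⟨h1, hsing⟩, ?_⟩
  have h2 := (tendsto_integral_marginals_of_prod ht ht0
    (fun t => memLp_rootScore (p t : Measure Ω₁) (p 0))
    (fun t => memLp_rootScore (q t : Measure Ω₂) (q 0)) (fun t => neg_two_le_rootScore _ _)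
    (fun t => neg_two_le_rootScore _ _) (fun t => measureReal_nonneg) (fun t => measureReal_nonneg)
    (fun t => integral_rootScore _ _) (fun t => integral_rootScore _ _) hs (tendstoL2_of_prod h)).1
  have h3 := h1.integral
  simp_rw [integral_const_mul] at h3
  -- The mean of a_t/t converges to the mean of the marginal tangent, but also to 0.
  exact tendsto_nhds_unique h3 h2

theorem IsL2Differentiable.swap_prod (h : IsL2Differentiable (fun t => (p t).prod (q t)) g) :
    IsL2Differentiable (fun t => (q t).prod (p t)) (g ∘ Prod.swap) := by
  have hs := tendsto_singular_of_prod h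
  have hw := (tendstoL2_of_prod h).comp_measurePreserving
    (Measure.measurePreserving_swap (μ := (q 0 : Measure Ω₂)) (ν := (p 0 : Measure Ω₁)))
  rw [isL2Differentiable_iff]
  simp only [ProbabilityMeasure.toMeasure_prod, measureReal_likelihoodRatio_prod_eq_top]
  refine ⟨?_, hs.congr fun t => by ring⟩
  have hae : ∀ t, (fun ω => t⁻¹ * rootScore ((q t : Measure Ω₂).prod (p t : Measure Ω₁))
      ((q 0 : Measure Ω₂).prod (p 0 : Measure Ω₁)) ω) =ᵐ[(q 0 : Measure Ω₂).prod (p 0 : Measure Ω₁)]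
      (fun ω : Ω₁ × Ω₂ => t⁻¹ * (rootScore (p t) (p 0) ω.1 + rootScore (q t) (q 0) ω.2 +
        rootScore (p t) (p 0) ω.1 * rootScore (q t) (q 0) ω.2 / 2)) ∘ Prod.swap := by
    intro t
    filter_upwards [rootScore_prod (q t : Measure Ω₂) (q 0) (p t : Measure Ω₁) (p 0)] with ω hω
    rw [hω]
    simp only [Function.comp_apply, Prod.fst_swap, Prod.snd_swap]
    ring
  refine ⟨fun t => (memLp_congr_ae (hae t)).2 (hw.memLp t), hw.memLp_lim,
    hw.tendsto_eLpNorm.congr fun t => ?_⟩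
  exact eLpNorm_congr_ae ((hae t).symm.sub EventuallyEq.rfl)

theorem isL2Differentiable_snd_of_prod (h : IsL2Differentiable (fun t => (p t).prod (q t)) g) :
    IsL2Differentiable q (fun y => ∫ x, g (x, y) ∂(p 0 : Measure Ω₁)) ∧
      ∫ y, ∫ x, g (x, y) ∂(p 0 : Measure Ω₁) ∂(q 0 : Measure Ω₂) = 0 :=
  isL2Differentiable_fst_of_prod h.swap_prod

/-- After division by t, the root score of the product and the sum of the marginal ones differ by
(t/2)(a_t/t)(b_t/t). Its squared norm factorises and is O(t²), so both have the same L₂ limit. -/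
theorem tangent_prod_ae_eq (h : IsL2Differentiable (fun t => (p t).prod (q t)) g) :
    g =ᵐ[(p 0 : Measure Ω₁).prod (q 0 : Measure Ω₂)] fun ω =>
      ∫ y, g (ω.1, y) ∂(q 0 : Measure Ω₂) + ∫ x, g (x, ω.2) ∂(p 0 : Measure Ω₁) := by
  have hw := tendstoL2_of_prod h
  have h1 := (isL2Differentiable_iff.1 (isL2Differentiable_fst_of_prod h).1).1
  have h2 := (isL2Differentiable_iff.1 (isL2Differentiable_snd_of_prod h).1).1
  have h1' := h1.comp_measurePreserving
    (measurePreserving_fst (μ := (p 0 : Measure Ω₁)) (ν := (q 0 : Measure Ω₂)))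
  have h2' := h2.comp_measurePreserving
    (measurePreserving_snd (μ := (p 0 : Measure Ω₁)) (ν := (q 0 : Measure Ω₂)))
  have hsum := h1'.add h2'
  have hdiff := hw.sub hsum
  have hcross : TendstoL2 (𝓝[≠] 0) ((p 0 : Measure Ω₁).prod (q 0 : Measure Ω₂)) (fun t =>
      (fun ω => t⁻¹ * (rootScore (p t) (p 0) ω.1 + rootScore (q t) (q 0) ω.2 +
        rootScore (p t) (p 0) ω.1 * rootScore (q t) (q 0) ω.2 / 2)) -
      ((fun ω => t⁻¹ * rootScore (p t) (p 0) ω) ∘ Prod.fst +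
        (fun ω => t⁻¹ * rootScore (q t) (q 0) ω) ∘ Prod.snd)) fun _ => 0 := by
    refine TendstoL2.of_integral_sq hdiff.memLp (memLp_const 0) ?_
    have ht : Tendsto (fun t : ℝ => t) (𝓝[≠] 0) (𝓝 0) :=
      tendsto_nhdsWithin_of_tendsto_nhds tendsto_id
    have h3 := (((h1.integral_sq.mul h2.integral_sq).mul (ht.pow 2)).div_const 4)
    rw [zero_pow two_ne_zero, mul_zero, zero_div] at h3
    refine h3.congr' ?_
    filter_upwards [eventually_mem_nhdsWithin] with t (ht : t ≠ 0)
    rw [← integral_prod_mul (fun ω => (t⁻¹ * rootScore (p t : Measure Ω₁) (p 0) ω) ^ 2)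
      fun ω => (t⁻¹ * rootScore (q t : Measure Ω₂) (q 0) ω) ^ 2, ← integral_mul_const,
      ← integral_div]
    refine integral_congr_ae (ae_of_all _ fun ω => ?_)
    simp only [Pi.sub_apply, Pi.add_apply, Function.comp_apply]
    field_simp
    ring
  have h4 := hdiff.ae_eq_of_tendsto hcross
  filter_upwards [h4] with ω hω
  simp only [Pi.sub_apply, Pi.add_apply, Function.comp_apply] at hω
  linarith

end ProductCurves

/-! ### Change of the base measure -/

section ChangeOfBase

/-- The law of the likelihood ratios `dP_k/dQ` under `Q`. -/
noncomputable def likelihoodRatioLaw {κ : Type*} {Ω : Type*} [MeasurableSpace Ω]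
    (P : κ → ProbabilityMeasure Ω) (Q : ProbabilityMeasure Ω) : ProbabilityMeasure (κ → ℝ≥0∞) :=
  Q.map (f := fun ω k => likelihoodRatio (P k : Measure Ω) (Q : Measure Ω) ω)
    (measurable_pi_lambda _ fun _ => measurable_likelihoodRatio _ _).aemeasurable

theorem integral_likelihoodRatioLaw {κ : Type*} {Ω : Type*} [MeasurableSpace Ω]
    (P : κ → ProbabilityMeasure Ω) (Q : ProbabilityMeasure Ω) {f : (κ → ℝ≥0∞) → ℝ}
    (hf : AEStronglyMeasurable f (likelihoodRatioLaw P Q : Measure (κ → ℝ≥0∞))) :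
    ∫ x, f x ∂(likelihoodRatioLaw P Q : Measure (κ → ℝ≥0∞)) =
      ∫ ω, f fun k => likelihoodRatio (P k : Measure Ω) (Q : Measure Ω) ω ∂(Q : Measure Ω) :=
  integral_map (measurable_pi_lambda _ fun _ => measurable_likelihoodRatio _ _).aemeasurable hf

/-- The change of the base measure from `R` to `P none`, with a cutoff `φ`. -/
theorem abs_integral_sub_integral_le {κ : Type*} [Countable κ] {Ω : Type*} [MeasurableSpace Ω]
    (P : Option κ → ProbabilityMeasure Ω) (R : ProbabilityMeasure Ω)
    (f : BoundedContinuousFunction (κ → ℝ≥0∞) ℝ) {φ : ℝ≥0∞ → ℝ} (hφ : Measurable φ)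
    (hφ0 : ∀ r, 0 ≤ φ r) (hφ1 : ∀ r, φ r ≤ 1) :
    |∫ ω, f (fun k => likelihoodRatio (P (some k) : Measure Ω) (P none) ω) ∂(P none : Measure Ω) -
      ∫ ω, f (fun k => likelihoodRatio (P (some k) : Measure Ω) R ω /
          likelihoodRatio (P none : Measure Ω) R ω) *
        ((likelihoodRatio (P none : Measure Ω) R ω).toReal *
          φ (likelihoodRatio (P none : Measure Ω) R ω)) ∂(R : Measure Ω)| ≤
    ‖f‖ * (1 - ∫ ω, (likelihoodRatio (P none : Measure Ω) R ω).toReal *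
          φ (likelihoodRatio (P none : Measure Ω) R ω) ∂(R : Measure Ω)) := by
  set L := likelihoodRatio (P none : Measure Ω) (R : Measure Ω) with hL
  have hLm : Measurable L := measurable_likelihoodRatio _ _
  set S := {ω | L ω ≠ ∞}
  have hS : MeasurableSet S := (hLm (measurableSet_singleton ∞)).compl
  have hres := (isLikelihoodRatio_likelihoodRatio (P none : Measure Ω) (R : Measure Ω)).restrict_ne_top
  set F : Ω → ℝ := fun ω => f fun k => likelihoodRatio (P (some k) : Measure Ω) (P none) ω with hF
  have hFm : Measurable F := f.continuous.measurable.comp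
    (measurable_pi_lambda _ fun _ => measurable_likelihoodRatio _ _)
  have hFb : ∀ ω, |F ω| ≤ ‖f‖ := fun ω => f.norm_coe_le_norm _
  have hψm : Measurable fun ω => φ (L ω) := hφ.comp hLm
  -- R weighted with L is `P none` restricted to {L < ∞}. The value 0 of `toReal` at ∞ does no harm,
  -- as L is finite R-almost surely.
  have hwd : ∀ G : Ω → ℝ, ∫ ω, G ω * (L ω).toReal ∂(R : Measure Ω) =
      ∫ ω, S.indicator G ω ∂(P none : Measure Ω) := by
    intro G
    rw [integral_indicator hS, hres,
      integral_withDensity_eq_integral_toReal_smul hLm (likelihoodRatio_ae_lt_top _ _)]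
    refine integral_congr_ae (ae_of_all _ fun ω => ?_)
    simp [hL, mul_comm]
  have e1 : ∫ ω, (L ω).toReal * φ (L ω) ∂(R : Measure Ω) =
      ∫ ω, S.indicator (fun ω => φ (L ω)) ω ∂(P none : Measure Ω) := by
    rw [← hwd]
    simp_rw [mul_comm]
  have e2 : ∫ ω, f (fun k => likelihoodRatio (P (some k) : Measure Ω) R ω / L ω) *
      ((L ω).toReal * φ (L ω)) ∂(R : Measure Ω) =
      ∫ ω, S.indicator (fun ω => F ω * φ (L ω)) ω ∂(P none : Measure Ω) := by
    have h1 : ∀ᵐ ω ∂((R : Measure Ω).withDensity L), F ω =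
        f (fun k => likelihoodRatio (P (some k) : Measure Ω) R ω / L ω) := by
      filter_upwards [ae_all_iff.2 fun k => likelihoodRatio_ae_eq_div_likelihoodRatio
        (P (some k) : Measure Ω) (P none) R] with ω hω
      simp only [hF, hω]
      rfl
    rw [← hwd]
    have h2 := (ae_withDensity_iff hLm).1 h1
    refine integral_congr_ae ?_
    filter_upwards [h2] with ω hω
    -- The quotient formula is known only where L ≠ 0, but where L = 0 the weight kills both sides.
    by_cases h0 : L ω = 0
    · simp [h0]
    · rw [← hω h0]
      ring
  rw [e1, e2]
  have i1 : Integrable F (P none : Measure Ω) :=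
    (integrable_const ‖f‖).mono' hFm.aestronglyMeasurable (ae_of_all _ hFb)
  have i2 : Integrable (S.indicator fun ω => φ (L ω)) (P none : Measure Ω) := by
    refine ((integrable_const (1 : ℝ)).mono' hψm.aestronglyMeasurable
      (ae_of_all _ fun ω => ?_)).indicator hS
    rw [Real.norm_of_nonneg (hφ0 _)]
    exact hφ1 _
  have i3 : Integrable (S.indicator fun ω => F ω * φ (L ω)) (P none : Measure Ω) := by
    refine ((integrable_const ‖f‖).mono' (hFm.mul hψm).aestronglyMeasurable
      (ae_of_all _ fun ω => ?_)).indicator hS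
    rw [Pi.mul_apply, norm_mul, Real.norm_of_nonneg (hφ0 _)]
    exact (mul_le_of_le_one_right (norm_nonneg _) (hφ1 _)).trans (hFb ω)
  rw [← integral_sub i1 i3]
  calc |∫ ω, F ω - S.indicator (fun ω => F ω * φ (L ω)) ω ∂(P none : Measure Ω)|
      ≤ ∫ ω, |F ω - S.indicator (fun ω => F ω * φ (L ω)) ω| ∂(P none : Measure Ω) :=
        abs_integral_le_integral_abs
    _ ≤ ∫ ω, ‖f‖ * (1 - S.indicator (fun ω => φ (L ω)) ω) ∂(P none : Measure Ω) := by
        refine integral_mono (i1.sub i3).abs (((integrable_const 1).sub i2).const_mul _) fun ω => ?_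
        have h1 : S.indicator (fun ω => F ω * φ (L ω)) ω =
            F ω * S.indicator (fun ω => φ (L ω)) ω := by
          by_cases hω : ω ∈ S <;> simp [hω]
        have h2 : 0 ≤ 1 - S.indicator (fun ω => φ (L ω)) ω := by
          by_cases hω : ω ∈ S
          · simpa [hω] using hφ1 (L ω)
          · simp [hω]
        dsimp only
        rw [h1, ← mul_one_sub, abs_mul, abs_of_nonneg h2]
        exact mul_le_mul_of_nonneg_right (hFb ω) h2
    _ = _ := by
        rw [integral_const_mul, integral_sub (integrable_const 1) i2]
        simp

/-- A continuous cutoff on `[0, ∞]`. -/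
noncomputable def ratioCutoff (m : ℕ) (r : ℝ≥0∞) : ℝ :=
  (min ((m + 1 : ℝ≥0∞) - r) 1).toReal * (min ((m + 1 : ℝ≥0∞) - r⁻¹) 1).toReal

/-- The projection of `[0, ∞]` to `[1 / (m + 1), m + 1]`. -/
noncomputable def ratioClamp (m : ℕ) (r : ℝ≥0∞) : ℝ≥0∞ :=
  max (min r (m + 1)) (m + 1 : ℝ≥0∞)⁻¹

theorem continuous_min_sub_toReal (m : ℕ) :
    Continuous fun r : ℝ≥0∞ => (min ((m + 1 : ℝ≥0∞) - r) 1).toReal := by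
  refine ENNReal.continuousOn_toReal.comp_continuous ?_ fun r => ?_
  · exact (ENNReal.continuous_sub_left (by finiteness)).min continuous_const
  · exact ne_of_lt ((min_le_right _ _).trans_lt ENNReal.one_lt_top)

theorem continuous_ratioCutoff (m : ℕ) : Continuous (ratioCutoff m) :=
  (continuous_min_sub_toReal m).mul ((continuous_min_sub_toReal m).comp continuous_inv)

theorem min_sub_toReal_le_one (m : ℕ) (r : ℝ≥0∞) : (min ((m + 1 : ℝ≥0∞) - r) 1).toReal ≤ 1 :=
  ENNReal.toReal_le_of_le_ofReal zero_le_one (by simp)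

theorem ratioCutoff_nonneg (m : ℕ) (r : ℝ≥0∞) : 0 ≤ ratioCutoff m r := by
  rw [ratioCutoff]; positivity

theorem ratioCutoff_le_one (m : ℕ) (r : ℝ≥0∞) : ratioCutoff m r ≤ 1 :=
  mul_le_one₀ (min_sub_toReal_le_one m r) ENNReal.toReal_nonneg (min_sub_toReal_le_one m r⁻¹)

theorem ratioClamp_ne_zero (m : ℕ) (r : ℝ≥0∞) : ratioClamp m r ≠ 0 := by
  refine ne_of_gt (lt_of_lt_of_le ?_ (le_max_right _ _))
  exact ENNReal.inv_pos.2 (by finiteness)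

theorem ratioClamp_ne_top (m : ℕ) (r : ℝ≥0∞) : ratioClamp m r ≠ ∞ := by
  refine ne_of_lt (max_lt ((min_le_right _ _).trans_lt (by finiteness)) ?_)
  exact ENNReal.inv_lt_top.2 (by positivity)

theorem continuous_ratioClamp (m : ℕ) : Continuous (ratioClamp m) :=
  (continuous_id.min continuous_const).max continuous_const

/-- Next to the cutoff factor the clamp is invisible. It is inserted because the quotient and
`toReal` are not continuous on all of [0, ∞], whereas they are after clamping. -/
theorem ratioClamp_eq_of_ratioCutoff_ne_zero {m : ℕ} {r : ℝ≥0∞} (h : ratioCutoff m r ≠ 0) :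
    ratioClamp m r = r := by
  rw [ratioCutoff] at h
  have h1 : r ≤ m + 1 := by
    by_contra hc
    refine h ?_
    rw [tsub_eq_zero_of_le (not_le.1 hc).le]
    simp
  have h2 : r⁻¹ ≤ m + 1 := by
    by_contra hc
    refine h ?_
    rw [tsub_eq_zero_of_le (not_le.1 hc).le]
    simp
  rw [ratioClamp, min_eq_left h1, max_eq_left]
  exact ENNReal.inv_le_iff_inv_le.1 h2

theorem tendsto_toReal_mul_ratioCutoff (r : ℝ≥0∞) :
    Tendsto (fun m => r.toReal * ratioCutoff m r) atTop (𝓝 r.toReal) := by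
  rcases eq_or_ne r 0 with rfl | h0
  · simp
  rcases eq_or_ne r ∞ with rfl | h1
  · simp
  refine tendsto_const_nhds.congr' ?_
  obtain ⟨a, ha⟩ := ENNReal.exists_nat_gt h1
  obtain ⟨b, hb⟩ := ENNReal.exists_nat_gt (ENNReal.inv_ne_top.2 h0)
  have key : ∀ (x : ℝ≥0∞) (c m : ℕ), x < c → c ≤ m → min ((m + 1 : ℝ≥0∞) - x) 1 = 1 := by
    intro x c m hx hcm
    refine min_eq_right ?_
    refine ENNReal.le_sub_of_add_le_right hx.ne_top ?_
    rw [add_comm]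
    gcongr
    exact hx.le.trans (by exact_mod_cast hcm)
  filter_upwards [eventually_ge_atTop a, eventually_ge_atTop b] with m hma hmb
  rw [ratioCutoff, key r a m ha hma, key r⁻¹ b m hb hmb]
  simp

theorem continuous_clamped_ratio {κ : Type*} (m : ℕ) :
    Continuous fun (x : Option κ → ℝ≥0∞) (k : κ) => x (some k) / ratioClamp m (x none) := by
  refine continuous_pi fun k => ?_
  rw [continuous_iff_continuousAt]
  intro x
  refine ENNReal.Tendsto.div (continuous_apply _).continuousAt
    (Or.inr (ratioClamp_ne_zero _ _))
    ((continuous_ratioClamp m).comp (continuous_apply _)).continuousAt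
    (Or.inl (ratioClamp_ne_top _ _))

theorem continuous_ratioClamp_toReal_mul (m : ℕ) :
    Continuous fun r => (ratioClamp m r).toReal * ratioCutoff m r :=
  (ENNReal.continuousOn_toReal.comp_continuous (continuous_ratioClamp m)
    (ratioClamp_ne_top m)).mul (continuous_ratioCutoff m)

theorem ratioClamp_toReal_mul (m : ℕ) (r : ℝ≥0∞) :
    (ratioClamp m r).toReal * ratioCutoff m r = r.toReal * ratioCutoff m r := by
  by_cases h : ratioCutoff m r = 0
  · simp [h]
  · rw [ratioClamp_eq_of_ratioCutoff_ne_zero h]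

theorem norm_ratioClamp_toReal_mul_le (m : ℕ) (r : ℝ≥0∞) :
    ‖(ratioClamp m r).toReal * ratioCutoff m r‖ ≤ m + 1 := by
  rw [norm_mul, Real.norm_of_nonneg ENNReal.toReal_nonneg, Real.norm_of_nonneg (ratioCutoff_nonneg _ _)]
  refine (mul_le_of_le_one_right ENNReal.toReal_nonneg (ratioCutoff_le_one _ _)).trans ?_
  refine ENNReal.toReal_le_of_le_ofReal (by positivity) ?_
  have h1 : ENNReal.ofReal (m + 1 : ℝ) = (m + 1 : ℝ≥0∞) := by
    rw [ENNReal.ofReal_add (by positivity) zero_le_one]; simp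
  rw [h1]
  refine max_le (min_le_right _ _) ?_
  calc (m + 1 : ℝ≥0∞)⁻¹ ≤ 1 := ENNReal.inv_le_one.2 (by simp)
    _ ≤ _ := by simp

/-- The bounded continuous function `x ↦ x none`, cut off. -/
noncomputable def cutoffWeight (κ : Type*) (m : ℕ) :
    BoundedContinuousFunction (Option κ → ℝ≥0∞) ℝ :=
  BoundedContinuousFunction.ofNormedAddCommGroup
    (fun x => (ratioClamp m (x none)).toReal * ratioCutoff m (x none))
    ((continuous_ratioClamp_toReal_mul m).comp (continuous_apply none)) (m + 1)
    fun x => norm_ratioClamp_toReal_mul_le m (x none)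

/-- The bounded continuous function `x ↦ f (x (some ·) / x none) * x none`, cut off. -/
noncomputable def cutoffTest {κ : Type*} (f : BoundedContinuousFunction (κ → ℝ≥0∞) ℝ) (m : ℕ) :
    BoundedContinuousFunction (Option κ → ℝ≥0∞) ℝ :=
  f.compContinuous ⟨_, continuous_clamped_ratio m⟩ * cutoffWeight κ m

/-- The same estimate serves every n and the limit. Its right side is the integral of a bounded
continuous function of the likelihood ratios, so smallness in the limit carries over to large n. -/
theorem abs_integral_sub_integral_cutoffTest_le {κ : Type*} [Finite κ] {Ω : Type*}
    [MeasurableSpace Ω] (f : BoundedContinuousFunction (κ → ℝ≥0∞) ℝ) (m : ℕ)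
    (P : Option κ → ProbabilityMeasure Ω) (R : ProbabilityMeasure Ω) :
    |∫ x, f x ∂(likelihoodRatioLaw (fun k => P (some k)) (P none) : Measure (κ → ℝ≥0∞)) -
      ∫ x, cutoffTest f m x ∂(likelihoodRatioLaw P R : Measure (Option κ → ℝ≥0∞))| ≤
    ‖f‖ * (1 - ∫ x, cutoffWeight κ m x
      ∂(likelihoodRatioLaw P R : Measure (Option κ → ℝ≥0∞))) := by
  rw [integral_likelihoodRatioLaw _ _ f.continuous.aestronglyMeasurable,
    integral_likelihoodRatioLaw _ _ (cutoffTest f m).continuous.aestronglyMeasurable,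
    integral_likelihoodRatioLaw _ _ (cutoffWeight κ m).continuous.aestronglyMeasurable]
  have h1 := abs_integral_sub_integral_le P R f (continuous_ratioCutoff m).measurable
    (ratioCutoff_nonneg m) (ratioCutoff_le_one m)
  have hw : ∀ x, cutoffWeight κ m x = (x none).toReal * ratioCutoff m (x none) := fun x =>
    ratioClamp_toReal_mul m (x none)
  have hF : ∀ x, cutoffTest f m x = f (fun k => x (some k) / x none) *
      ((x none).toReal * ratioCutoff m (x none)) := by
    intro x
    have : cutoffTest f m x = f (fun k => x (some k) / ratioClamp m (x none)) * cutoffWeight κ m x := rfl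
    rw [this, hw]
    by_cases h : ratioCutoff m (x none) = 0
    · simp [h]
    · rw [ratioClamp_eq_of_ratioCutoff_ne_zero h]
  simp_rw [hw, hF]
  exact h1

/-- **Change of base.** If the laws of the likelihood ratios with respect to `R n` converge, and
`P' none` is absolutely continuous with respect to the limiting base `R'`, then the laws of the
likelihood ratios with respect to `P n none` converge. -/
theorem tendsto_likelihoodRatioLaw_of_base {κ : Type*} [Finite κ] {X : ℕ → Type*}
    [∀ n, MeasurableSpace (X n)] {Y : Type*} [MeasurableSpace Y]
    (P : ∀ n, Option κ → ProbabilityMeasure (X n)) (R : ∀ n, ProbabilityMeasure (X n))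
    (P' : Option κ → ProbabilityMeasure Y) (R' : ProbabilityMeasure Y)
    (h : Tendsto (fun n => likelihoodRatioLaw (P n) (R n)) atTop (𝓝 (likelihoodRatioLaw P' R')))
    (hac : (P' none : Measure Y) {y | likelihoodRatio (P' none : Measure Y) R' y = ∞} = 0) :
    Tendsto (fun n => likelihoodRatioLaw (fun k => P n (some k)) (P n none)) atTop
      (𝓝 (likelihoodRatioLaw (fun k => P' (some k)) (P' none))) := by
  rw [ProbabilityMeasure.tendsto_iff_forall_integral_tendsto] at h ⊢
  intro f
  -- As `P' none` has no singular part, its density has total mass 1, and the cut off mass increases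
  -- to all of it. This is the contiguity that makes the change of base possible.
  have hlim : Tendsto (fun m => ∫ x, cutoffWeight κ m x ∂(likelihoodRatioLaw P' R' : Measure (Option κ → ℝ≥0∞)))
      atTop (𝓝 1) := by
    have h1 : ∀ m, ∫ x, cutoffWeight κ m x ∂(likelihoodRatioLaw P' R' : Measure (Option κ → ℝ≥0∞)) =
        ∫ y, (likelihoodRatio (P' none : Measure Y) R' y).toReal *
          ratioCutoff m (likelihoodRatio (P' none : Measure Y) R' y) ∂(R' : Measure Y) := by
      intro m
      rw [integral_likelihoodRatioLaw _ _ (cutoffWeight κ m).continuous.aestronglyMeasurable]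
      exact integral_congr_ae (ae_of_all _ fun y => ratioClamp_toReal_mul m _)
    simp_rw [h1]
    have h2 : ∫ y, (likelihoodRatio (P' none : Measure Y) R' y).toReal ∂(R' : Measure Y) = 1 := by
      rw [integral_likelihoodRatio, measureReal_def, hac]
      simp
    rw [← h2]
    have hm := measurable_likelihoodRatio (P' none : Measure Y) (R' : Measure Y)
    refine tendsto_integral_of_dominated_convergence
      (fun y => (likelihoodRatio (P' none : Measure Y) R' y).toReal) (fun m => ?_)
      (integrable_likelihoodRatio _ _) (fun m => ae_of_all _ fun y => ?_)
      (ae_of_all _ fun y => tendsto_toReal_mul_ratioCutoff _)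
    · exact (hm.ennreal_toReal.mul
        ((continuous_ratioCutoff m).measurable.comp hm)).aestronglyMeasurable
    · rw [norm_mul, Real.norm_of_nonneg ENNReal.toReal_nonneg,
        Real.norm_of_nonneg (ratioCutoff_nonneg _ _)]
      exact mul_le_of_le_one_right ENNReal.toReal_nonneg (ratioCutoff_le_one _ _)
  rw [Metric.tendsto_nhds]
  intro ε hε
  have hlim2 : Tendsto (fun m => ‖f‖ * (1 - ∫ x, cutoffWeight κ m x
      ∂(likelihoodRatioLaw P' R' : Measure (Option κ → ℝ≥0∞)))) atTop (𝓝 0) := by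
    simpa using ((tendsto_const_nhds (x := (1 : ℝ))).sub hlim).const_mul ‖f‖
  -- The cutoff level m is fixed in the limit experiment, before n. The three errors, two from the
  -- cutoff and one from weak convergence, are each below ε/4.
  obtain ⟨m, hm⟩ := (hlim2.eventually (gt_mem_nhds (by positivity : 0 < ε / 4))).exists
  have h1 := ((tendsto_const_nhds (x := (1 : ℝ))).sub (h (cutoffWeight κ m))).const_mul ‖f‖
  have h2 := h (cutoffTest f m)
  rw [Metric.tendsto_nhds] at h2
  filter_upwards [h1.eventually (gt_mem_nhds hm), h2 (ε / 4) (by positivity)] with n hn1 hn2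
  have h3 := (abs_integral_sub_integral_cutoffTest_le f m (P n) (R n)).trans_lt hn1
  have h4 := (abs_integral_sub_integral_cutoffTest_le f m P' R').trans_lt hm
  rw [Real.dist_eq] at hn2 ⊢
  rw [abs_lt] at h3 h4 hn2 ⊢
  constructor <;> linarith

end ChangeOfBase

/-! ### Asymptotic normality of the two-sample likelihood ratios -/

section TwoSampleLimit

variable {κ : Type*} [Fintype κ]

/-- Used to pass from the exponentials of truncated logarithms to the true likelihood ratios; the
exceptional sets are where some truncation is active. -/
theorem tendsto_map_of_tendsto_measureReal_ne {E : Type*} [TopologicalSpace E] [MeasurableSpace E]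
    [OpensMeasurableSpace E] {X : ℕ → Type*} [∀ n, MeasurableSpace (X n)]
    {R : ∀ n, ProbabilityMeasure (X n)} {U V : ∀ n, X n → E} (hU : ∀ n, Measurable (U n))
    (hV : ∀ n, Measurable (V n)) {B : ∀ n, Set (X n)} (hB : ∀ n, MeasurableSet (B n))
    (hUV : ∀ n, ∀ᵐ x ∂(R n : Measure (X n)), x ∉ B n → U n x = V n x)
    (hlim : Tendsto (fun n => (R n : Measure (X n)).real (B n)) atTop (𝓝 0))
    {ν : ProbabilityMeasure E}
    (h : Tendsto (fun n => (R n).map (hU n).aemeasurable) atTop (𝓝 ν)) :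
    Tendsto (fun n => (R n).map (hV n).aemeasurable) atTop (𝓝 ν) := by
  rw [ProbabilityMeasure.tendsto_iff_forall_integral_tendsto] at h ⊢
  intro f
  have hdiff : Tendsto (fun n => ∫ x, f x ∂((R n).map (hV n).aemeasurable : Measure E) -
      ∫ x, f x ∂((R n).map (hU n).aemeasurable : Measure E)) atTop (𝓝 0) := by
    have h0 := hlim.const_mul (2 * ‖f‖)
    rw [mul_zero] at h0
    refine squeeze_zero_norm (fun n => ?_) h0
    have i1 : ∀ {W : X n → E}, Measurable W → Integrable (fun x => f (W x)) (R n : Measure (X n)) :=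
      fun hW => (integrable_const ‖f‖).mono' (f.continuous.measurable.comp hW).aestronglyMeasurable
        (ae_of_all _ fun x => f.norm_coe_le_norm _)
    rw [ProbabilityMeasure.toMeasure_map, ProbabilityMeasure.toMeasure_map,
      integral_map (hV n).aemeasurable f.continuous.measurable.aestronglyMeasurable,
      integral_map (hU n).aemeasurable f.continuous.measurable.aestronglyMeasurable,
      ← integral_sub (i1 (hV n)) (i1 (hU n))]
    refine (norm_integral_le_integral_norm _).trans ?_
    calc ∫ x, ‖f (V n x) - f (U n x)‖ ∂(R n : Measure (X n))
        ≤ ∫ x, (B n).indicator (fun _ => 2 * ‖f‖) x ∂(R n : Measure (X n)) := by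
          refine integral_mono_ae ((i1 (hV n)).sub (i1 (hU n))).norm
            ((integrable_const _).indicator (hB n)) ?_
          filter_upwards [hUV n] with x hx
          by_cases hxB : x ∈ B n
          · rw [Set.indicator_of_mem hxB, two_mul]
            exact (norm_sub_le _ _).trans
              (add_le_add (f.norm_coe_le_norm _) (f.norm_coe_le_norm _))
          · rw [Set.indicator_of_notMem hxB, hx hxB, sub_self, norm_zero]
      _ = 2 * ‖f‖ * (R n : Measure (X n)).real (B n) := by
          rw [integral_indicator (hB n), setIntegral_const, smul_eq_mul, mul_comm]
  simpa using hdiff.add (h f)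

/-- The logarithm of the likelihood ratio of one observation, truncated. -/
noncomputable def truncLogRatio {Ω : Type*} [MeasurableSpace Ω] (P Q : Measure Ω) (ω : Ω) : ℝ :=
  truncLog (rootScore P Q ω)

theorem measurable_truncLogRatio {Ω : Type*} [MeasurableSpace Ω] (P Q : Measure Ω) :
    Measurable (truncLogRatio P Q) :=
  measurable_truncLog.comp (measurable_rootScore P Q)

theorem likelihoodRatio_eq_exp_truncLogRatio {Ω : Type*} [MeasurableSpace Ω] {P Q : Measure Ω}
    {ω : Ω} (h1 : likelihoodRatio P Q ω < ∞) (h2 : -1 < rootScore P Q ω) :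
    likelihoodRatio P Q ω = ENNReal.ofReal (Real.exp (truncLogRatio P Q ω)) := by
  rw [truncLogRatio, exp_truncLog h2, one_add_rootScore_sq, ENNReal.ofReal_toReal h1.ne]

/-! ### Log-likelihood ratios of one sample. -/

section OneSample

variable {Ω : Type*} [MeasurableSpace Ω] {P₀ : ProbabilityMeasure Ω}

/-- The contribution of one sample to the joint characteristic function at τ. Each linear
combination of truncated logarithms is again a triangular array, with score Σ τ_k a_k and mean of
order t² equal to −Σ τ_k ∫ a_k²/2. -/
theorem tendsto_integral_cexp_truncLogRatio_pow {p : κ → ℝ → ProbabilityMeasure Ω}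
    (h0 : ∀ k, p k 0 = P₀) {a : κ → Ω → ℝ} (hd : ∀ k, IsL2Differentiable (p k) (a k)) (τ : κ → ℝ)
    {t : ℕ → ℝ} (ht : Tendsto t atTop (𝓝[≠] 0)) {N : ℕ → ℕ} {r : ℝ}
    (hN : Tendsto (fun n => N n * t n ^ 2) atTop (𝓝 r)) :
    Tendsto (fun n => (∫ ω, Complex.exp ((∑ k, τ k * truncLogRatio (p k (t n) : Measure Ω) P₀ ω : ℝ)
        * Complex.I) ∂(P₀ : Measure Ω)) ^ N n) atTop
      (𝓝 (Complex.exp (r * ((-(∑ k, τ k * ∫ ω, a k ω ^ 2 ∂(P₀ : Measure Ω)) / 2 : ℝ) * Complex.I -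
        (∫ ω, (∑ k, τ k * a k ω) ^ 2 ∂(P₀ : Measure Ω) : ℝ) / 2)))) := by
  have ht1 : Tendsto t atTop (𝓝 0) := tendsto_nhds_of_tendsto_nhdsWithin ht
  have ht0 : ∀ᶠ n in atTop, t n ≠ 0 := (tendsto_nhdsWithin_iff.1 ht).2
  have hy : ∀ k, TendstoL2 atTop (P₀ : Measure Ω)
      (fun n ω => (t n)⁻¹ * rootScore (p k (t n) : Measure Ω) P₀ ω) (a k) := by
    intro k
    have := (isL2Differentiable_iff.1 (hd k)).1
    rw [h0 k] at this
    exact this.comp ht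
  have hE : ∀ k, Tendsto (fun n => (∫ ω, rootScore (p k (t n) : Measure Ω) P₀ ω
      ∂(P₀ : Measure Ω)) / t n ^ 2) atTop (𝓝 (-(∫ ω, a k ω ^ 2 ∂(P₀ : Measure Ω)) / 4)) := by
    intro k
    have := (hd k).tendsto_integral_rootScore
    rw [h0 k] at this
    exact this.comp ht
  have hm2 : ∀ k n, MemLp (rootScore (p k (t n) : Measure Ω) P₀) 2 (P₀ : Measure Ω) :=
    fun k n => memLp_rootScore _ _
  have hmeas : ∀ k n, Measurable (rootScore (p k (t n) : Measure Ω) P₀) :=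
    fun k n => measurable_rootScore _ _
  have hX : ∀ k, TendstoL2 atTop (P₀ : Measure Ω)
      (fun n ω => (t n)⁻¹ * truncLogRatio (p k (t n) : Measure Ω) P₀ ω) (a k) := fun k =>
    TendstoL2.truncLog ht1 ht0 (hm2 k) (hy k) (hmeas k)
  have hEX := fun k => tendsto_integral_truncLog ht1 ht0 (hm2 k) (hy k) (hmeas k) (hE k)
  have hsum := TendstoL2.sum Finset.univ fun k => (hX k).const_mul (τ k)
  have hsum' : TendstoL2 atTop (P₀ : Measure Ω)
      (fun n ω => (t n)⁻¹ * ∑ k, τ k * truncLogRatio (p k (t n) : Measure Ω) P₀ ω)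
      (fun ω => ∑ k, τ k * a k ω) := by
    convert hsum using 1
    · ext n ω
      rw [Finset.sum_apply, Finset.mul_sum]
      exact Finset.sum_congr rfl fun k _ => by ring
    · ext ω
      rw [Finset.sum_apply]
  refine tendsto_integral_cexp_pow ht1 ht0 hsum' (fun n => ?_) ?_ hN
  · exact Finset.measurable_sum _ fun k _ => (measurable_truncLogRatio _ _).const_mul _
  · have h1 := tendsto_finsetSum Finset.univ fun k (_ : k ∈ Finset.univ) => (hEX k).const_mul (τ k)
    have h2 : ∑ k, τ k * (-(∫ ω, a k ω ^ 2 ∂(P₀ : Measure Ω)) / 2) =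
        -(∑ k, τ k * ∫ ω, a k ω ^ 2 ∂(P₀ : Measure Ω)) / 2 := by
      rw [← Finset.sum_neg_distrib, Finset.sum_div]
      exact Finset.sum_congr rfl fun k _ => by ring
    rw [h2] at h1
    refine h1.congr' ?_
    filter_upwards [ht0] with n hn
    rw [integral_finsetSum]
    · rw [Finset.sum_div]
      refine Finset.sum_congr rfl fun k _ => ?_
      rw [integral_const_mul, mul_div_assoc]
      rfl
    · intro k _
      have h3 := (((hX k).memLp n).integrable (by norm_num)).const_mul (t n)
      refine (h3.congr (ae_of_all _ fun ω => ?_)).const_mul _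
      dsimp only
      field_simp

theorem tendsto_mul_measureReal_rootScore_le {p : ℝ → ProbabilityMeasure Ω} (h0 : p 0 = P₀)
    {a : Ω → ℝ} (hd : IsL2Differentiable p a) {t : ℕ → ℝ} (ht : Tendsto t atTop (𝓝[≠] 0))
    {N : ℕ → ℕ} {r : ℝ} (hN : Tendsto (fun n => N n * t n ^ 2) atTop (𝓝 r)) :
    Tendsto (fun n => N n * (P₀ : Measure Ω).real
      {ω | rootScore (p (t n) : Measure Ω) P₀ ω ≤ -1}) atTop (𝓝 0) := by
  have h1 := (isL2Differentiable_iff.1 hd).1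
  rw [h0] at h1
  have h2 := tendsto_measureReal_le_neg_one (tendsto_nhds_of_tendsto_nhdsWithin ht)
    (tendsto_nhdsWithin_iff.1 ht).2 (h1.comp ht) fun n => measurable_rootScore _ _
  have h3 := hN.mul h2
  rw [mul_zero] at h3
  refine h3.congr' ?_
  filter_upwards [(tendsto_nhdsWithin_iff.1 ht).2] with n (hn : t n ≠ 0)
  field_simp

theorem ae_pi_likelihoodRatio_lt_top (P Q : Measure Ω) [IsProbabilityMeasure P]
    [IsProbabilityMeasure Q] (n : ℕ) :
    ∀ᵐ ω ∂(Measure.pi fun _ : Fin n => Q), ∀ i, likelihoodRatio P Q (ω i) < ∞ :=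
  ae_all_iff.2 fun i => (measurePreserving_eval (fun _ : Fin n => Q) i).quasiMeasurePreserving.ae
    (likelihoodRatio_ae_lt_top P Q)

theorem measureReal_pi_exists_le (P : Measure Ω) [IsProbabilityMeasure P] (n : ℕ) {A : Set Ω}
    (hA : MeasurableSet A) :
    (Measure.pi fun _ : Fin n => P).real {ω | ∃ i, ω i ∈ A} ≤ n * P.real A := by
  have h1 : {ω : Fin n → Ω | ∃ i, ω i ∈ A} = ⋃ i, (fun ω => ω i) ⁻¹' A := by ext; simp
  rw [h1]
  refine (measureReal_iUnion_fintype_le _).trans (le_of_eq ?_)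
  have h2 : ∀ i : Fin n, (Measure.pi fun _ : Fin n => P).real ((fun ω => ω i) ⁻¹' A) = P.real A :=
    fun i => (measurePreserving_eval (fun _ : Fin n => P) i).measureReal_preimage hA.nullMeasurableSet
  simp [h2]

end OneSample

variable {Ω₁ : Type*} {Ω₂ : Type*} [MeasurableSpace Ω₁] [MeasurableSpace Ω₂]

/-- The truncated log-likelihood ratios of two samples. -/
noncomputable def twoSampleLog (P : κ → Measure Ω₁) (P₀ : Measure Ω₁) (Q : κ → Measure Ω₂)
    (Q₀ : Measure Ω₂) (n₁ n₂ : ℕ) (ω : (Fin n₁ → Ω₁) × (Fin n₂ → Ω₂)) : EuclideanSpace ℝ κ :=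
  WithLp.toLp 2 fun k => ∑ i, truncLogRatio (P k) P₀ (ω.1 i) + ∑ j, truncLogRatio (Q k) Q₀ (ω.2 j)

omit [Fintype κ] in
theorem measurable_twoSampleLog (P : κ → Measure Ω₁) (P₀ : Measure Ω₁) (Q : κ → Measure Ω₂)
    (Q₀ : Measure Ω₂) (n₁ n₂ : ℕ) : Measurable (twoSampleLog P P₀ Q Q₀ n₁ n₂) := by
  refine (WithLp.measurable_toLp 2 _).comp (measurable_pi_lambda _ fun k => ?_)
  refine (Finset.measurable_sum _ fun i _ => ?_).add (Finset.measurable_sum _ fun j _ => ?_)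
  · exact (measurable_truncLogRatio _ _).comp ((measurable_pi_apply i).comp measurable_fst)
  · exact (measurable_truncLogRatio _ _).comp ((measurable_pi_apply j).comp measurable_snd)

theorem charFun_map_twoSampleLog (P : κ → Measure Ω₁) (P₀ : Measure Ω₁) [IsProbabilityMeasure P₀]
    (Q : κ → Measure Ω₂) (Q₀ : Measure Ω₂) [IsProbabilityMeasure Q₀] (n₁ n₂ : ℕ)
    (τ : EuclideanSpace ℝ κ) :
    charFun (((Measure.pi fun _ : Fin n₁ => P₀).prod (Measure.pi fun _ : Fin n₂ => Q₀)).map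
        (twoSampleLog P P₀ Q Q₀ n₁ n₂)) τ =
      (∫ ω, Complex.exp ((∑ k, τ k * truncLogRatio (P k) P₀ ω : ℝ) * Complex.I) ∂P₀) ^ n₁ *
      (∫ ω, Complex.exp ((∑ k, τ k * truncLogRatio (Q k) Q₀ ω : ℝ) * Complex.I) ∂Q₀) ^ n₂ := by
  rw [charFun_apply, integral_map (measurable_twoSampleLog _ _ _ _ _ _).aemeasurable
    (by fun_prop : Continuous fun x : EuclideanSpace ℝ κ =>
      Complex.exp ((inner ℝ x τ : ℝ) * Complex.I)).aestronglyMeasurable]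
  have h1 : ∀ ω : (Fin n₁ → Ω₁) × (Fin n₂ → Ω₂),
      Complex.exp ((inner ℝ (twoSampleLog P P₀ Q Q₀ n₁ n₂ ω) τ : ℝ) * Complex.I) =
      (∏ i, Complex.exp ((∑ k, τ k * truncLogRatio (P k) P₀ (ω.1 i) : ℝ) * Complex.I)) *
      ∏ j, Complex.exp ((∑ k, τ k * truncLogRatio (Q k) Q₀ (ω.2 j) : ℝ) * Complex.I) := by
    intro ω
    rw [← Complex.exp_sum, ← Complex.exp_sum, ← Complex.exp_add, ← Finset.sum_mul,
      ← Finset.sum_mul, ← add_mul, ← Complex.ofReal_sum, ← Complex.ofReal_sum,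
      ← Complex.ofReal_add]
    congr 3
    rw [PiLp.inner_apply, Finset.sum_comm, Finset.sum_comm (s := Finset.univ (α := Fin n₂)),
      ← Finset.sum_add_distrib]
    refine Finset.sum_congr rfl fun k _ => ?_
    simp only [twoSampleLog, RCLike.inner_apply, conj_trivial]
    rw [← Finset.mul_sum, ← Finset.mul_sum, mul_add]
  simp_rw [h1]
  rw [integral_prod_mul (fun ω : Fin n₁ → Ω₁ => ∏ i, Complex.exp
      ((∑ k, τ k * truncLogRatio (P k) P₀ (ω i) : ℝ) * Complex.I))
    (fun ω : Fin n₂ → Ω₂ => ∏ j, Complex.exp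
      ((∑ k, τ k * truncLogRatio (Q k) Q₀ (ω j) : ℝ) * Complex.I)),
    integral_fintype_prod_eq_pow (fun ω => Complex.exp
      ((∑ k, τ k * truncLogRatio (P k) P₀ ω : ℝ) * Complex.I)),
    integral_fintype_prod_eq_pow (fun ω => Complex.exp
      ((∑ k, τ k * truncLogRatio (Q k) Q₀ ω : ℝ) * Complex.I))]
  simp

theorem likelihoodRatio_twoSample_ae_eq (P P₀ : Measure Ω₁) [IsProbabilityMeasure P]
    [IsProbabilityMeasure P₀] (Q Q₀ : Measure Ω₂) [IsProbabilityMeasure Q]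
    [IsProbabilityMeasure Q₀] (n₁ n₂ : ℕ) :
    ∀ᵐ ω ∂((Measure.pi fun _ : Fin n₁ => P₀).prod (Measure.pi fun _ : Fin n₂ => Q₀)),
      (∀ i, -1 < rootScore P P₀ (ω.1 i)) → (∀ j, -1 < rootScore Q Q₀ (ω.2 j)) →
      likelihoodRatio ((Measure.pi fun _ : Fin n₁ => P).prod (Measure.pi fun _ : Fin n₂ => Q))
        ((Measure.pi fun _ : Fin n₁ => P₀).prod (Measure.pi fun _ : Fin n₂ => Q₀)) ω =
      ENNReal.ofReal (Real.exp
        (∑ i, truncLogRatio P P₀ (ω.1 i) + ∑ j, truncLogRatio Q Q₀ (ω.2 j))) := by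
  filter_upwards [likelihoodRatio_prod (Measure.pi fun _ : Fin n₁ => P)
      (Measure.pi fun _ : Fin n₁ => P₀) (Measure.pi fun _ : Fin n₂ => Q)
      (Measure.pi fun _ : Fin n₂ => Q₀),
    Measure.quasiMeasurePreserving_fst.ae (likelihoodRatio_pi P P₀ n₁),
    Measure.quasiMeasurePreserving_snd.ae (likelihoodRatio_pi Q Q₀ n₂),
    Measure.quasiMeasurePreserving_fst.ae (ae_pi_likelihoodRatio_lt_top P P₀ n₁),
    Measure.quasiMeasurePreserving_snd.ae (ae_pi_likelihoodRatio_lt_top Q Q₀ n₂)] with ω h1 h2 h3 h4 h5 h6 h7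
  rw [h1, h2, h3, Real.exp_add, Real.exp_sum, Real.exp_sum,
    ENNReal.ofReal_mul (Finset.prod_nonneg fun i _ => (Real.exp_pos _).le),
    ENNReal.ofReal_prod_of_nonneg fun i _ => (Real.exp_pos _).le,
    ENNReal.ofReal_prod_of_nonneg fun i _ => (Real.exp_pos _).le]
  congr 1
  · exact Finset.prod_congr rfl fun i _ => likelihoodRatio_eq_exp_truncLogRatio (h4 i) (h6 i)
  · exact Finset.prod_congr rfl fun j _ => likelihoodRatio_eq_exp_truncLogRatio (h5 j) (h7 j)

end TwoSampleLimit

/-! ### Gaussian shifts -/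

section GaussianShiftLemmas

theorem Lp.coeFn_sum_smul {Ω : Type*} [MeasurableSpace Ω] {μ : Measure Ω} {ι : Type*}
    (s : Finset ι) (c : ι → ℝ) (f : ι → Lp ℝ 2 μ) :
    ⇑(∑ i ∈ s, c i • f i) =ᵐ[μ] fun ω => ∑ i ∈ s, c i * f i ω := by
  classical
  induction s using Finset.induction_on with
  | empty => simp only [Finset.sum_empty]; exact Lp.coeFn_zero ℝ 2 μ
  | insert a s ha ih =>
    simp only [Finset.sum_insert ha]
    filter_upwards [Lp.coeFn_add (c a • f a) (∑ i ∈ s, c i • f i), Lp.coeFn_smul (c a) (f a), ih]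
      with ω h1 h2 h3
    rw [h1, Pi.add_apply, h2, h3, Pi.smul_apply, smul_eq_mul]

theorem norm_cexp_sub_cexp_le (a b : ℝ) :
    ‖Complex.exp (a * Complex.I) - Complex.exp (b * Complex.I)‖ ≤ ‖a - b‖ := by
  have h1 : Complex.exp (a * Complex.I) - Complex.exp (b * Complex.I) =
      Complex.exp (b * Complex.I) * (Complex.exp (Complex.I * ((a - b : ℝ) : ℂ)) - 1) := by
    rw [mul_sub, mul_one, ← Complex.exp_add]
    congr 2
    push_cast
    ring
  rw [h1, norm_mul, Complex.norm_exp_ofReal_mul_I, one_mul]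
  exact Real.norm_exp_I_mul_ofReal_sub_one_le

/-- x ↦ exp(ix) is 1-Lipschitz, and the L₁ distance is at most the L₂ distance for a probability
measure. -/
theorem tendsto_integral_cexp_of_tendsto_Lp {Ω : Type*} [MeasurableSpace Ω] {μ : Measure Ω}
    [IsProbabilityMeasure μ] {ι : Type*} {l : Filter ι} {U : ι → Lp ℝ 2 μ} {V : Lp ℝ 2 μ}
    (h : Tendsto U l (𝓝 V)) :
    Tendsto (fun i => ∫ ω, Complex.exp (U i ω * Complex.I) ∂μ) l
      (𝓝 (∫ ω, Complex.exp (V ω * Complex.I) ∂μ)) := by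
  rw [tendsto_iff_norm_sub_tendsto_zero] at h ⊢
  have hint : ∀ W : Lp ℝ 2 μ, Integrable (fun ω => Complex.exp (W ω * Complex.I)) μ := fun W =>
    (integrable_const (1 : ℝ)).mono' (Complex.continuous_exp.comp_aestronglyMeasurable
      ((Complex.continuous_ofReal.comp_aestronglyMeasurable
        (Lp.aestronglyMeasurable W)).mul_const Complex.I))
      (ae_of_all _ fun ω => by rw [Complex.norm_exp_ofReal_mul_I])
  refine squeeze_zero (fun _ => norm_nonneg _) (fun i => ?_) h
  rw [← integral_sub (hint _) (hint _)]
  refine (norm_integral_le_integral_norm _).trans ?_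
  have hm : MemLp (fun ω => U i ω - V ω) 2 μ := (Lp.memLp _).sub (Lp.memLp _)
  calc ∫ ω, ‖Complex.exp (U i ω * Complex.I) - Complex.exp (V ω * Complex.I)‖ ∂μ
      ≤ ∫ ω, ‖U i ω - V ω‖ ∂μ :=
        integral_mono ((hint _).sub (hint _)).norm (hm.integrable (by norm_num)).norm
          fun ω => norm_cexp_sub_cexp_le _ _
    _ = (eLpNorm (fun ω => U i ω - V ω) 1 μ).toReal := by
        rw [eLpNorm_one_eq_lintegral_enorm, integral_norm_eq_lintegral_enorm hm.aestronglyMeasurable]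
    _ ≤ (eLpNorm (fun ω => U i ω - V ω) 2 μ).toReal :=
        ENNReal.toReal_mono hm.eLpNorm_lt_top.ne
          (eLpNorm_le_eLpNorm_of_exponent_le (by norm_num) hm.aestronglyMeasurable)
    _ = ‖U i - V‖ := by
        rw [Lp.norm_def]
        congr 1
        exact eLpNorm_congr_ae (Lp.coeFn_sub _ _).symm

variable {H : Type v} [NormedAddCommGroup H] [InnerProductSpace ℝ H]

theorem IsStandardGaussianProcess.integral_cexp {Ω : Type w} [MeasurableSpace Ω] {P₀ : Measure Ω}
    {L : H →ₗ[ℝ] Lp ℝ 2 P₀} (hL : IsStandardGaussianProcess L) (h : H) :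
    ∫ ω, Complex.exp (L h ω * Complex.I) ∂P₀ = Complex.exp (-(‖h‖ ^ 2 / 2 : ℝ)) := by
  have h1 : charFun (P₀.map (L h)) 1 = charFun (gaussianReal 0 (‖h‖₊ ^ 2)) 1 := by rw [hL h]
  rw [charFun_gaussianReal, charFun_apply_real, integral_map
    (Lp.aestronglyMeasurable (L h)).aemeasurable
    (by fun_prop : Continuous fun x : ℝ => Complex.exp ((1 : ℝ) * x * Complex.I)).aestronglyMeasurable]
    at h1
  simp only [Complex.ofReal_one, one_mul] at h1
  rw [h1]
  congr 1
  simp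

theorem IsStandardGaussianProcess.integral_exp {Ω : Type w} [MeasurableSpace Ω] {P₀ : Measure Ω}
    {L : H →ₗ[ℝ] Lp ℝ 2 P₀} (hL : IsStandardGaussianProcess L) (h : H) :
    ∫ ω, Real.exp (L h ω - ‖h‖ ^ 2 / 2) ∂P₀ = 1 := by
  have h1 := mgf_gaussianReal (hL h) 1
  rw [mgf] at h1
  simp_rw [sub_eq_add_neg, Real.exp_add]
  rw [integral_mul_const]
  simp only [one_mul] at h1
  rw [h1, ← Real.exp_add]
  simp

theorem IsStandardGaussianProcess.integrable_exp {Ω : Type w} [MeasurableSpace Ω] {P₀ : Measure Ω}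
    {L : H →ₗ[ℝ] Lp ℝ 2 P₀} (hL : IsStandardGaussianProcess L) (h : H) :
    Integrable (fun ω => Real.exp (L h ω - ‖h‖ ^ 2 / 2)) P₀ := by
  -- The Bochner integral of a non-integrable function is 0, so an integral equal to 1 proves
  -- integrability.
  refine Integrable.of_integral_ne_zero ?_
  rw [hL.integral_exp]
  exact one_ne_zero

/-- The log-likelihood ratios of a Gaussian shift. -/
noncomputable def gaussianLog {Ω : Type w} [MeasurableSpace Ω] {P₀ : Measure Ω} {κ : Type*}
    (L : H →ₗ[ℝ] Lp ℝ 2 P₀) (h : κ → H) (ω : Ω) : EuclideanSpace ℝ κ :=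
  WithLp.toLp 2 fun k => L (h k) ω - ‖h k‖ ^ 2 / 2

theorem measurable_gaussianLog {Ω : Type w} [MeasurableSpace Ω] {P₀ : Measure Ω} {κ : Type*}
    (L : H →ₗ[ℝ] Lp ℝ 2 P₀) (h : κ → H) : Measurable (gaussianLog L h) :=
  (WithLp.measurable_toLp 2 _).comp
    (measurable_pi_lambda _ fun k => (Lp.stronglyMeasurable (L (h k))).measurable.sub_const _)

/-- Only the one-dimensional laws of L are postulated. Linearity turns Σ τ_k L(h_k) into L(Σ τ_k
h_k), so they determine the joint laws. -/
theorem charFun_map_gaussianLog {Ω : Type w} [MeasurableSpace Ω] {P₀ : Measure Ω}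
    [IsProbabilityMeasure P₀] {κ : Type*} [Fintype κ] {L : H →ₗ[ℝ] Lp ℝ 2 P₀}
    (hL : IsStandardGaussianProcess L) (h : κ → H) (τ : EuclideanSpace ℝ κ) :
    charFun (P₀.map (gaussianLog L h)) τ =
      Complex.exp (-(∑ k, τ k * ‖h k‖ ^ 2 : ℝ) / 2 * Complex.I -
        (‖∑ k, τ k • h k‖ ^ 2 : ℝ) / 2) := by
  rw [charFun_apply, integral_map (measurable_gaussianLog _ _).aemeasurable
    (by fun_prop : Continuous fun x : EuclideanSpace ℝ κ =>
      Complex.exp ((inner ℝ x τ : ℝ) * Complex.I)).aestronglyMeasurable]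
  have h1 : (fun ω => Complex.exp ((inner ℝ (gaussianLog L h ω) τ : ℝ) * Complex.I)) =ᵐ[P₀]
      fun ω => Complex.exp (L (∑ k, τ k • h k) ω * Complex.I) *
        Complex.exp (-(∑ k, τ k * ‖h k‖ ^ 2 : ℝ) / 2 * Complex.I) := by
    have h2 : L (∑ k, τ k • h k) = ∑ k, τ k • L (h k) := by simp
    rw [h2]
    filter_upwards [Lp.coeFn_sum_smul Finset.univ (fun k => τ k) fun k => L (h k)] with ω hω
    rw [hω, ← Complex.exp_add, ← add_mul]
    congr 2
    have h3 : (inner ℝ (gaussianLog L h ω) τ : ℝ) =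
        ∑ k, τ k * L (h k) ω + -(∑ k, τ k * ‖h k‖ ^ 2) / 2 := by
      rw [PiLp.inner_apply, ← Finset.sum_neg_distrib, Finset.sum_div, ← Finset.sum_add_distrib]
      refine Finset.sum_congr rfl fun k _ => ?_
      simp only [gaussianLog, RCLike.inner_apply, conj_trivial]
      ring
    rw [h3]
    push_cast
    ring
  rw [integral_congr_ae h1, integral_mul_const, hL.integral_cexp, ← Complex.exp_add]
  congr 1
  push_cast
  ring

/-! ### Existence of Gaussian shifts -/

section Existence

variable {ι : Type*}

/-- The infinite product of standard normal distributions. -/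
noncomputable def gaussianProduct (ι : Type*) : Measure (ι → ℝ) :=
  Measure.infinitePi fun _ => gaussianReal 0 1

instance : IsProbabilityMeasure (gaussianProduct ι) := by
  unfold gaussianProduct; infer_instance

theorem measurePreserving_eval_gaussianProduct (i : ι) :
    MeasurePreserving (Function.eval i) (gaussianProduct ι) (gaussianReal 0 1) :=
  measurePreserving_eval_infinitePi (fun _ => gaussianReal 0 1) i

theorem memLp_eval_gaussianProduct (i : ι) :
    MemLp (fun ω : ι → ℝ => ω i) 2 (gaussianProduct ι) :=
  (memLp_id_gaussianReal' 2 (by norm_num)).comp_measurePreserving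
    (measurePreserving_eval_gaussianProduct i)

/-- The coordinates, as elements of `L₂`. -/
noncomputable def gaussianCoord (i : ι) : Lp ℝ 2 (gaussianProduct ι) :=
  (memLp_eval_gaussianProduct i).toLp _

theorem coeFn_gaussianCoord (i : ι) :
    gaussianCoord i =ᵐ[gaussianProduct ι] fun ω => ω i :=
  MemLp.coeFn_toLp _

theorem orthonormal_gaussianCoord : Orthonormal ℝ (gaussianCoord (ι := ι)) := by
  classical
  have hint : ∀ i j, inner ℝ (gaussianCoord (ι := ι) i) (gaussianCoord j) =
      ∫ ω, ω i * ω j ∂(gaussianProduct ι) := by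
    intro i j
    rw [L2.inner_def]
    refine integral_congr_ae ?_
    filter_upwards [coeFn_gaussianCoord i, coeFn_gaussianCoord j] with ω h1 h2
    rw [h1, h2]
    simp [mul_comm]
  rw [orthonormal_iff_ite]
  intro i j
  rw [hint]
  split_ifs with hij
  · subst hij
    have h1 : ∫ ω, ω i * ω i ∂(gaussianProduct ι) = ∫ x, x * x ∂(gaussianReal 0 1) := by
      rw [← (measurePreserving_eval_gaussianProduct i).map_eq,
        integral_map (measurable_pi_apply i).aemeasurable (by fun_prop)]
    have h2 := variance_fun_id_gaussianReal (μ := 0) (v := 1)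
    rw [variance_eq_integral (by fun_prop)] at h2
    rw [h1]
    simpa [sq] using h2
  · have hind : iIndepFun (fun (i : ι) (ω : ι → ℝ) => ω i) (gaussianProduct ι) :=
      iIndepFun_infinitePi (X := fun _ x => x) fun _ => measurable_id
    have h1 := (hind.indepFun hij).integral_fun_mul_eq_mul_integral
      (measurable_pi_apply i).aestronglyMeasurable (measurable_pi_apply j).aestronglyMeasurable
    rw [h1]
    have h2 : ∫ ω, ω i ∂(gaussianProduct ι) = ∫ x, x ∂(gaussianReal 0 1) := by
      rw [← (measurePreserving_eval_gaussianProduct i).map_eq,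
        integral_map (measurable_pi_apply i).aemeasurable (by fun_prop)]
    rw [h2, integral_id_gaussianReal, zero_mul]

theorem integral_cexp_sum_gaussianProduct (s : Finset ι) (c : ι → ℝ) :
    ∫ ω, Complex.exp ((∑ i ∈ s, c i * ω i : ℝ) * Complex.I) ∂(gaussianProduct ι) =
      Complex.exp (-(∑ i ∈ s, c i ^ 2 : ℝ) / 2) := by
  have h1 : ∀ ω : ι → ℝ, Complex.exp ((∑ i ∈ s, c i * ω i : ℝ) * Complex.I) =
      (fun x : s → ℝ => ∏ i : s, Complex.exp (c i * x i * Complex.I)) (s.restrict ω) := by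
    intro ω
    simp only [Finset.restrict]
    rw [← Complex.exp_sum, ← Finset.sum_mul, ← Finset.sum_coe_sort s]
    push_cast
    rfl
  have hmeas : Measurable fun x : s → ℝ => ∏ i : s, Complex.exp (c i * x i * Complex.I) := by
    fun_prop
  rw [integral_congr_ae (ae_of_all _ h1),
    ← integral_map (μ := gaussianProduct ι) (φ := s.restrict)
      (f := fun x : s → ℝ => ∏ i : s, Complex.exp (c i * x i * Complex.I))
      (Finset.measurable_restrict s).aemeasurable hmeas.aestronglyMeasurable, gaussianProduct,
    Measure.infinitePi_map_restrict,
    integral_fintype_prod_eq_prod fun (i : s) (x : ℝ) => Complex.exp (c i * x * Complex.I)]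
  have h2 : ∀ a : ℝ, ∫ x : ℝ, Complex.exp (a * x * Complex.I) ∂(gaussianReal 0 1) =
      Complex.exp (-(a ^ 2 : ℝ) / 2) := by
    intro a
    rw [← charFun_apply_real, charFun_gaussianReal]
    congr 1
    push_cast
    simp
    ring
  simp_rw [h2]
  rw [← Complex.exp_sum, ← Finset.sum_coe_sort s]
  congr 1
  push_cast
  rw [← Finset.sum_neg_distrib, Finset.sum_div]

/-- L is the isometry that sends a Hilbert basis to independent standard normal coordinates. Finite
partial sums have Gaussian characteristic functions, and these pass to the L₂ limit. -/
theorem exists_isStandardGaussianProcess (H : Type v) [NormedAddCommGroup H]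
    [InnerProductSpace ℝ H] [CompleteSpace H] :
    ∃ (ι : Type v) (L : H →ₗ[ℝ] Lp ℝ 2 (gaussianProduct ι)), IsStandardGaussianProcess L := by
  obtain ⟨w, b, _⟩ := exists_hilbertBasis ℝ H
  have hV := (orthonormal_gaussianCoord (ι := w)).orthogonalFamily
  let L : H →ₗᵢ[ℝ] Lp ℝ 2 (gaussianProduct w) :=
    hV.linearIsometry.comp b.repr.toLinearIsometry
  refine ⟨w, L.toLinearMap, fun h => ?_⟩
  have hsum : ∀ h : H, HasSum (fun i => b.repr h i • gaussianCoord i) (L h) := fun h => by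
    have h1 : HasSum (fun i => b.repr h i • gaussianCoord i) (hV.linearIsometry (b.repr h)) := by
      simpa using hV.hasSum_linearIsometry (b.repr h)
    exact h1
  have hchar : ∀ h : H, ∫ ω, Complex.exp (L h ω * Complex.I) ∂(gaussianProduct w) =
      Complex.exp (-(‖h‖ ^ 2 : ℝ) / 2) := by
    intro h
    have h1 := tendsto_integral_cexp_of_tendsto_Lp (hsum h)
    have h2 : ∀ s : Finset w, ∫ ω, Complex.exp
        ((∑ i ∈ s, b.repr h i • gaussianCoord i : Lp ℝ 2 (gaussianProduct w)) ω * Complex.I)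
        ∂(gaussianProduct w) = Complex.exp (-(∑ i ∈ s, b.repr h i ^ 2 : ℝ) / 2) := by
      intro s
      rw [← integral_cexp_sum_gaussianProduct s fun i => b.repr h i]
      refine integral_congr_ae ?_
      have h3 : ∀ᵐ ω ∂(gaussianProduct w), ∀ i ∈ s, gaussianCoord i ω = ω i :=
        (Finset.eventually_all s).2 fun i _ => coeFn_gaussianCoord i
      filter_upwards [Lp.coeFn_sum_smul s (fun i => b.repr h i) gaussianCoord, h3] with ω h4 h5
      rw [h4]
      congr 3
      exact Finset.sum_congr rfl fun i hi => by rw [h5 i hi]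
    rw [funext h2] at h1
    have h3 : HasSum (fun i => b.repr h i ^ 2) (‖h‖ ^ 2) := by
      have := b.hasSum_inner_mul_inner h h
      rw [real_inner_self_eq_norm_sq] at this
      refine this.congr_fun fun i => ?_
      rw [b.repr_apply_apply, real_inner_comm h, sq]
    have h4 : Tendsto (fun s : Finset w => Complex.exp (-(∑ i ∈ s, b.repr h i ^ 2 : ℝ) / 2)) atTop
        (𝓝 (Complex.exp (-(‖h‖ ^ 2 : ℝ) / 2))) := by
      have h5 : Continuous fun x : ℝ => Complex.exp (-(x : ℂ) / 2) := by fun_prop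
      exact (h5.tendsto _).comp h3
    exact tendsto_nhds_unique h1 h4
  have hm : AEMeasurable (L h) (gaussianProduct w) := (Lp.aestronglyMeasurable (L h)).aemeasurable
  have : IsProbabilityMeasure ((gaussianProduct w).map (L h)) :=
    Measure.isProbabilityMeasure_map hm
  refine Measure.ext_of_charFun (funext fun t => ?_)
  rw [charFun_gaussianReal]
  change charFun ((gaussianProduct w).map (L h)) t = _
  rw [charFun_apply_real, integral_map hm
    (by fun_prop : Continuous fun x : ℝ => Complex.exp (t * x * Complex.I)).aestronglyMeasurable]
  -- The characteristic function of L h at t is that of L (t h) at 1.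
  have h1 := hchar (t • h)
  rw [map_smul] at h1
  have h2 : ∫ ω, Complex.exp ((t • L h : Lp ℝ 2 (gaussianProduct w)) ω * Complex.I)
      ∂(gaussianProduct w) = ∫ ω, Complex.exp (t * L h ω * Complex.I) ∂(gaussianProduct w) := by
    refine integral_congr_ae ?_
    filter_upwards [Lp.coeFn_smul t (L h)] with ω hω
    rw [hω]
    simp
  rw [← h2, h1, norm_smul]
  congr 1
  push_cast
  simp only [mul_pow, Real.norm_eq_abs, ← Complex.ofReal_pow, sq_abs]
  push_cast
  ring

theorem exists_isGaussianShift (H : Type v) [NormedAddCommGroup H] [InnerProductSpace ℝ H]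
    [CompleteSpace H] : ∃ E : Experiment.{v, v} H, IsGaussianShift E := by
  obtain ⟨ι, L, hL⟩ := exists_isStandardGaussianProcess H
  let D : H → (ι → ℝ) → ℝ≥0∞ := fun h ω => ENNReal.ofReal (Real.exp (L h ω - ‖h‖ ^ 2 / 2))
  have hD : ∀ h, Measurable (D h) := fun h =>
    (((Lp.stronglyMeasurable (L h)).measurable.sub_const _).exp).ennreal_ofReal
  have hprob : ∀ h, IsProbabilityMeasure ((gaussianProduct ι).withDensity (D h)) := by
    intro h
    refine ⟨?_⟩
    rw [withDensity_apply _ MeasurableSet.univ, Measure.restrict_univ,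
      ← ofReal_integral_eq_lintegral_ofReal (hL.integrable_exp h)
        (ae_of_all _ fun ω => (Real.exp_pos _).le), hL.integral_exp, ENNReal.ofReal_one]
  let E : Experiment.{v, v} H := ⟨ι → ℝ, fun h => ⟨(gaussianProduct ι).withDensity (D h), hprob h⟩⟩
  have hE0 : (E.P 0 : Measure (ι → ℝ)) = gaussianProduct ι := by
    have h1 : D 0 =ᵐ[gaussianProduct ι] 1 := by
      refine ae_of_all _ fun ω => ?_
      simp [D]
    change (gaussianProduct ι).withDensity (D 0) = _
    rw [withDensity_congr_ae h1, withDensity_one]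
  refine ⟨E, ?_⟩
  -- The density at h = 0 is 1, so `E.P 0` equals the Gaussian product, though not by definition.
  -- Quantifying over R lets L be transported between the two L₂ spaces.
  have key : ∀ R : Measure (ι → ℝ), R = gaussianProduct ι → ∃ L : H →ₗ[ℝ] Lp ℝ 2 R,
      IsStandardGaussianProcess L ∧ ∀ h : H,
        likelihoodRatio (E.P h : Measure (ι → ℝ)) R =ᵐ[R]
          fun ω => ENNReal.ofReal (Real.exp (L h ω - ‖h‖ ^ 2 / 2)) := by
    rintro R rfl
    refine ⟨L, hL, fun h => ?_⟩
    refine likelihoodRatio_ae_eq_of_restrict_eq_withDensity (hD h) MeasurableSet.univ (by simp) ?_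
    rw [Measure.restrict_univ]
    rfl
  exact key _ hE0

end Existence

end GaussianShiftLemmas

/-! ### Tangent spaces of product families -/

section TangentSpaceProd

variable {Ω : Type u} [MeasurableSpace Ω]

open scoped RealInnerProductSpace

theorem MeasureTheory.L2.real_inner_eq_integral_mul {μ : Measure Ω} (f g : Lp ℝ 2 μ) :
    ⟪f, g⟫ = ∫ ω, f ω * g ω ∂μ := by
  rw [L2.inner_def]
  refine integral_congr_ae (.of_forall fun ω => ?_)
  simp [mul_comm]

/-- The mean is the inner product with the constant 1, hence its kernel is a closed subspace; it
contains the cone. -/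
theorem integral_eq_zero_of_mem_tangentSpace {P₀ : ProbabilityMeasure Ω}
    {Pfam : Set (ProbabilityMeasure Ω)} {g : Lp ℝ 2 (P₀ : Measure Ω)}
    (hg : g ∈ tangentSpace P₀ Pfam) : ∫ ω, g ω ∂(P₀ : Measure Ω) = 0 := by
  have key (f : Lp ℝ 2 (P₀ : Measure Ω)) :
      ⟪indicatorConstLp 2 MeasurableSet.univ (measure_ne_top (P₀ : Measure Ω) _) (1 : ℝ), f⟫
        = ∫ ω, f ω ∂(P₀ : Measure Ω) := by
    rw [L2.inner_indicatorConstLp_one, setIntegral_univ]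
  have hle : tangentSpace P₀ Pfam ≤ (innerSL ℝ (indicatorConstLp 2 MeasurableSet.univ
      (measure_ne_top (P₀ : Measure Ω) _) (1 : ℝ))).ker := by
    refine Submodule.topologicalClosure_minimal _ (Submodule.span_le.2 fun f hf => ?_)
      (ContinuousLinearMap.isClosed_ker _)
    exact (key f).trans hf.1
  exact (key g).symm.trans (hle hg)

theorem tangentCone_subset_tangentSpace {P₀ : ProbabilityMeasure Ω}
    {Pfam : Set (ProbabilityMeasure Ω)} :
    tangentCone P₀ Pfam ⊆ (tangentSpace P₀ Pfam : Set (Lp ℝ 2 (P₀ : Measure Ω))) :=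
  fun _ hf => Submodule.le_topologicalClosure _ (Submodule.subset_span hf)

variable {Ω₁ : Type u} {Ω₂ : Type v} [MeasurableSpace Ω₁] [MeasurableSpace Ω₂]

/-- The map `(g₁, g₂) ↦ g₁ ∘ π₁ + g₂ ∘ π₂` between `L₂` spaces. -/
noncomputable def sumOfMarginals (P₀ : ProbabilityMeasure Ω₁) (Q₀ : ProbabilityMeasure Ω₂) :
    (Lp ℝ 2 (P₀ : Measure Ω₁) × Lp ℝ 2 (Q₀ : Measure Ω₂)) →L[ℝ]
      Lp ℝ 2 (P₀.prod Q₀ : Measure (Ω₁ × Ω₂)) :=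
  (Lp.compMeasurePreservingₗᵢ ℝ (μb := (P₀ : Measure Ω₁)) Prod.fst
    (measurePreserving_fst (μ := (P₀ : Measure Ω₁))
      (ν := (Q₀ : Measure Ω₂)))).toContinuousLinearMap.coprod
  (Lp.compMeasurePreservingₗᵢ ℝ (μb := (Q₀ : Measure Ω₂)) Prod.snd
    (measurePreserving_snd (μ := (P₀ : Measure Ω₁))
      (ν := (Q₀ : Measure Ω₂)))).toContinuousLinearMap

variable {P₀ : ProbabilityMeasure Ω₁} {Q₀ : ProbabilityMeasure Ω₂}

theorem coeFn_sumOfMarginals (a : Lp ℝ 2 (P₀ : Measure Ω₁) × Lp ℝ 2 (Q₀ : Measure Ω₂)) :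
    sumOfMarginals P₀ Q₀ a =ᵐ[(P₀.prod Q₀ : Measure (Ω₁ × Ω₂))]
      fun ω => a.1 ω.1 + a.2 ω.2 := by
  have h1 := Lp.coeFn_compMeasurePreserving a.1
    (measurePreserving_fst (μ := (P₀ : Measure Ω₁)) (ν := (Q₀ : Measure Ω₂)))
  have h2 := Lp.coeFn_compMeasurePreserving a.2
    (measurePreserving_snd (μ := (P₀ : Measure Ω₁)) (ν := (Q₀ : Measure Ω₂)))
  refine (Lp.coeFn_add _ _).trans ?_
  filter_upwards [h1, h2] with ω h1 h2
  exact congrArg₂ (· + ·) h1 h2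

theorem isSumOfMarginals_iff {g : Lp ℝ 2 (P₀.prod Q₀ : Measure (Ω₁ × Ω₂))}
    {g₁ : Lp ℝ 2 (P₀ : Measure Ω₁)} {g₂ : Lp ℝ 2 (Q₀ : Measure Ω₂)} :
    IsSumOfMarginals g g₁ g₂ ↔ sumOfMarginals P₀ Q₀ (g₁, g₂) = g := by
  have h := coeFn_sumOfMarginals (P₀ := P₀) (Q₀ := Q₀) (g₁, g₂)
  exact ⟨fun hg => Lp.ext (h.trans (EventuallyEq.symm hg)), fun hg => by rwa [hg] at h⟩

/-- The cross term is the product of the two means, so one vanishing mean suffices for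
orthogonality. -/
theorem norm_sumOfMarginals_sq (a : Lp ℝ 2 (P₀ : Measure Ω₁) × Lp ℝ 2 (Q₀ : Measure Ω₂))
    (h : ∫ x, a.1 x ∂(P₀ : Measure Ω₁) = 0) :
    ‖sumOfMarginals P₀ Q₀ a‖ ^ 2 = ‖a.1‖ ^ 2 + ‖a.2‖ ^ 2 := by
  have h1 := Lp.coeFn_compMeasurePreserving a.1
    (measurePreserving_fst (μ := (P₀ : Measure Ω₁)) (ν := (Q₀ : Measure Ω₂)))
  have h2 := Lp.coeFn_compMeasurePreserving a.2
    (measurePreserving_snd (μ := (P₀ : Measure Ω₁)) (ν := (Q₀ : Measure Ω₂)))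
  have hcross : ⟪Lp.compMeasurePreserving Prod.fst
      (measurePreserving_fst (μ := (P₀ : Measure Ω₁)) (ν := (Q₀ : Measure Ω₂))) a.1,
      Lp.compMeasurePreserving Prod.snd
      (measurePreserving_snd (μ := (P₀ : Measure Ω₁)) (ν := (Q₀ : Measure Ω₂))) a.2⟫ = 0 := by
    rw [L2.real_inner_eq_integral_mul]
    calc _ = ∫ ω, a.1 ω.1 * a.2 ω.2 ∂((P₀ : Measure Ω₁).prod (Q₀ : Measure Ω₂)) := by
          refine integral_congr_ae ?_
          filter_upwards [h1, h2] with ω h1 h2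
          rw [h1, h2]; rfl
      _ = 0 := by rw [integral_prod_mul (fun x => a.1 x) (fun y => a.2 y), h, zero_mul]
  have := norm_add_sq_real (Lp.compMeasurePreserving Prod.fst
      (measurePreserving_fst (μ := (P₀ : Measure Ω₁)) (ν := (Q₀ : Measure Ω₂))) a.1)
    (Lp.compMeasurePreserving Prod.snd
      (measurePreserving_snd (μ := (P₀ : Measure Ω₁)) (ν := (Q₀ : Measure Ω₂))) a.2)
  rw [hcross, Lp.norm_compMeasurePreserving, Lp.norm_compMeasurePreserving, mul_zero,
    add_zero] at this
  exact this

variable (P₀ Q₀) (Pfam : Set (ProbabilityMeasure Ω₁)) (Qfam : Set (ProbabilityMeasure Ω₂))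

/-- The map `(g₁, g₂) ↦ g₁ ∘ π₁ + g₂ ∘ π₂` on the product of the marginal tangent spaces. -/
noncomputable def sumOfTangents :
    (tangentSpace P₀ Pfam × tangentSpace Q₀ Qfam) →L[ℝ]
      Lp ℝ 2 (P₀.prod Q₀ : Measure (Ω₁ × Ω₂)) :=
  (sumOfMarginals P₀ Q₀).comp
    ((tangentSpace P₀ Pfam).subtypeL.prodMap (tangentSpace Q₀ Qfam).subtypeL)

variable {Pfam Qfam}

theorem norm_sumOfTangents_sq (a : tangentSpace P₀ Pfam × tangentSpace Q₀ Qfam) :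
    ‖sumOfTangents P₀ Q₀ Pfam Qfam a‖ ^ 2 = ‖a.1‖ ^ 2 + ‖a.2‖ ^ 2 :=
  norm_sumOfMarginals_sq (P₀ := P₀) (Q₀ := Q₀) (a.1, a.2)
    (integral_eq_zero_of_mem_tangentSpace a.1.2)

/-- The product space carries the maximum norm, so Pythagoras gives a lower bound rather than an
isometry; this is enough for injectivity and closed range. -/
theorem antilipschitz_sumOfTangents :
    AntilipschitzWith 1 (sumOfTangents P₀ Q₀ Pfam Qfam) := by
  refine AddMonoidHomClass.antilipschitz_of_bound _ fun a => ?_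
  have h := norm_sumOfTangents_sq P₀ Q₀ a
  rw [NNReal.coe_one, one_mul, Prod.norm_def, max_le_iff]
  constructor
  · refine (pow_le_pow_iff_left₀ (norm_nonneg _) (norm_nonneg _) two_ne_zero).1 ?_
    linarith [sq_nonneg ‖a.2‖]
  · refine (pow_le_pow_iff_left₀ (norm_nonneg _) (norm_nonneg _) two_ne_zero).1 ?_
    linarith [sq_nonneg ‖a.1‖]

instance : CompleteSpace (tangentSpace P₀ Pfam) :=
  (Submodule.isClosed_topologicalClosure _).completeSpace_coe

/-- A product curve in the family yields marginal curves in `Pfam` and `Qfam`; their tangents are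
the partial integrals of g, and g is their sum. -/
theorem tangentCone_prod_subset (hP₀ : P₀ ∈ Pfam) (hQ₀ : Q₀ ∈ Qfam)
    {g : Lp ℝ 2 (P₀.prod Q₀ : Measure (Ω₁ × Ω₂))}
    (hg : g ∈ tangentCone (P₀.prod Q₀) (productFamily Pfam Qfam)) :
    g ∈ Set.range (sumOfTangents P₀ Q₀ Pfam Qfam) := by
  classical
  obtain ⟨-, ε, hε, R, hR0, hR, hd⟩ := hg
  have : Nonempty (ProbabilityMeasure Ω₁) := ⟨P₀⟩
  have : Nonempty (ProbabilityMeasure Ω₂) := ⟨Q₀⟩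
  choose! p hp q hq hpq using hR
  -- The chosen factors are replaced by P₀ and Q₀ at 0 and outside (−ε, ε). The base points become
  -- those required, and on a punctured neighbourhood of 0 nothing changes.
  let p' : ℝ → ProbabilityMeasure Ω₁ := fun t => if t ∈ Set.Ioo (-ε) ε ∧ t ≠ 0 then p t else P₀
  let q' : ℝ → ProbabilityMeasure Ω₂ := fun t => if t ∈ Set.Ioo (-ε) ε ∧ t ≠ 0 then q t else Q₀
  have hp0 : p' 0 = P₀ := by simp [p']
  have hq0 : q' 0 = Q₀ := by simp [q']
  have hp' (t) : p' t ∈ Pfam := by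
    by_cases ht : t ∈ Set.Ioo (-ε) ε ∧ t ≠ 0
    · simpa only [p', if_pos ht] using hp t ht.1
    · simpa only [p', if_neg ht] using hP₀
  have hq' (t) : q' t ∈ Qfam := by
    by_cases ht : t ∈ Set.Ioo (-ε) ε ∧ t ≠ 0
    · simpa only [q', if_pos ht] using hq t ht.1
    · simpa only [q', if_neg ht] using hQ₀
  have hd' : IsL2Differentiable (fun t => (p' t).prod (q' t)) g := by
    refine hd.congr_curve (by simp only [hR0, hp0, hq0]) ?_
    have hev : ∀ᶠ t in 𝓝[≠] (0 : ℝ), t ∈ Set.Ioo (-ε) ε :=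
      nhdsWithin_le_nhds (Ioo_mem_nhds (by linarith) hε)
    filter_upwards [hev, self_mem_nhdsWithin] with t ht ht0
    rw [hpq t ht]
    simp only [p', q', if_pos (show t ∈ Set.Ioo (-ε) ε ∧ t ≠ 0 from ⟨ht, ht0⟩)]
  obtain ⟨h1, m1⟩ := isL2Differentiable_fst_of_prod hd'
  obtain ⟨h2, m2⟩ := isL2Differentiable_snd_of_prod hd'
  have hsum := tangent_prod_ae_eq hd'
  have l1 := h1.memLp
  have l2 := h2.memLp
  simp only [hp0, hq0] at l1 l2 m1 m2 hsum h1 h2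
  have c1 : l1.toLp ∈ tangentCone P₀ Pfam := by
    refine ⟨by rw [integral_congr_ae l1.coeFn_toLp]; exact m1, ε, hε, p', hp0, fun t _ => hp' t,
      h1.congr_tangent ?_⟩
    rw [hp0]
    exact l1.coeFn_toLp.symm
  have c2 : l2.toLp ∈ tangentCone Q₀ Qfam := by
    refine ⟨by rw [integral_congr_ae l2.coeFn_toLp]; exact m2, ε, hε, q', hq0, fun t _ => hq' t,
      h2.congr_tangent ?_⟩
    rw [hq0]
    exact l2.coeFn_toLp.symm
  refine ⟨(⟨_, tangentCone_subset_tangentSpace c1⟩, ⟨_, tangentCone_subset_tangentSpace c2⟩), isSumOfMarginals_iff.1 ?_⟩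
  have e1 := (measurePreserving_fst (μ := (P₀ : Measure Ω₁))
    (ν := (Q₀ : Measure Ω₂))).quasiMeasurePreserving.ae_eq_comp l1.coeFn_toLp
  have e2 := (measurePreserving_snd (μ := (P₀ : Measure Ω₁))
    (ν := (Q₀ : Measure Ω₂))).quasiMeasurePreserving.ae_eq_comp l2.coeFn_toLp
  refine EventuallyEq.trans hsum ?_
  filter_upwards [e1, e2] with ω e1 e2
  exact congrArg₂ (· + ·) e1.symm e2.symm

/-- A map bounded below on a complete space has closed range, so the inclusion of the cone passes to
its closed span. -/
theorem tangentSpace_prod_le_range (hP₀ : P₀ ∈ Pfam) (hQ₀ : Q₀ ∈ Qfam) :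
    tangentSpace (P₀.prod Q₀) (productFamily Pfam Qfam) ≤
      (sumOfTangents P₀ Q₀ Pfam Qfam).range := by
  refine Submodule.topologicalClosure_minimal _ (Submodule.span_le.2 fun g hg => ?_) ?_
  · exact tangentCone_prod_subset P₀ Q₀ hP₀ hQ₀ hg
  · exact (antilipschitz_sumOfTangents P₀ Q₀).isClosed_range
      (sumOfTangents P₀ Q₀ Pfam Qfam).uniformContinuous

/-- The decomposition `g ↦ (g₁, g₂)` of the tangents of a product family. -/
theorem exists_tangentSpace_prod_decomposition (hP₀ : P₀ ∈ Pfam) (hQ₀ : Q₀ ∈ Qfam) :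
    ∃ D : tangentSpace (P₀.prod Q₀) (productFamily Pfam Qfam) →ₗ[ℝ]
        tangentSpace P₀ Pfam × tangentSpace Q₀ Qfam,
      ∀ g, sumOfTangents P₀ Q₀ Pfam Qfam (D g) = g := by
  have hinj : Function.Injective (sumOfTangents P₀ Q₀ Pfam Qfam).toLinearMap :=
    (antilipschitz_sumOfTangents P₀ Q₀).injective
  refine ⟨(LinearEquiv.ofInjective _ hinj).symm.toLinearMap ∘ₗ
    Submodule.inclusion (tangentSpace_prod_le_range P₀ Q₀ hP₀ hQ₀), fun g => ?_⟩
  have := congrArg Subtype.val ((LinearEquiv.ofInjective _ hinj).apply_symm_apply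
    (Submodule.inclusion (tangentSpace_prod_le_range P₀ Q₀ hP₀ hQ₀) g))
  exact this

end TangentSpaceProd

/-! ### Weighted inner products -/

section WeightedInner

open scoped RealInnerProductSpace

variable {V E F : Type*} [AddCommGroup V] [Module ℝ V] [NormedAddCommGroup E]
  [InnerProductSpace ℝ E] [NormedAddCommGroup F] [InnerProductSpace ℝ F]

/-- The inner product `⟨g, h⟩ = a ⟨g₁, h₁⟩ + b ⟨g₂, h₂⟩` obtained from an injective linear map
`g ↦ (g₁, g₂)`. -/
@[reducible]
noncomputable def weightedInnerCore (D : V →ₗ[ℝ] E × F) (hD : Function.Injective D) {a b : ℝ}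
    (ha : 0 < a) (hb : 0 < b) : InnerProductSpace.Core ℝ V where
  inner g h := a * ⟪(D g).1, (D h).1⟫ + b * ⟪(D g).2, (D h).2⟫
  conj_inner_symm g h := by simp [real_inner_comm]
  re_inner_nonneg g := by
    simp only [RCLike.re_to_real]
    exact add_nonneg (mul_nonneg ha.le real_inner_self_nonneg)
      (mul_nonneg hb.le real_inner_self_nonneg)
  add_left f g h := by simp [inner_add_left]; ring
  smul_left f g r := by simp [inner_smul_left]; ring
  definite g hg := by
    have h1 := mul_nonneg ha.le (real_inner_self_nonneg (x := (D g).1))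
    have h2 := mul_nonneg hb.le (real_inner_self_nonneg (x := (D g).2))
    have e1 : ⟪(D g).1, (D g).1⟫ = 0 := by
      refine (mul_eq_zero.1 (?_ : a * _ = 0)).resolve_left ha.ne'
      linarith
    have e2 : ⟪(D g).2, (D g).2⟫ = 0 := by
      refine (mul_eq_zero.1 (?_ : b * _ = 0)).resolve_left hb.ne'
      linarith
    refine hD ?_
    rw [map_zero]
    exact Prod.ext (inner_self_eq_zero.1 e1) (inner_self_eq_zero.1 e2)

theorem WithInner.norm_sq (c : InnerProductSpace.Core ℝ V) (g : WithInner c) :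
    ‖g‖ ^ 2 = c.inner g.val g.val :=
  (real_inner_self_eq_norm_sq g).symm

/-- The two bounds say that the norms are equivalent, so the identity is a linear homeomorphism and
completeness is transferred. -/
theorem WithInner.completeSpace {V : Type*} [NormedAddCommGroup V] [NormedSpace ℝ V]
    [CompleteSpace V] (c : InnerProductSpace.Core ℝ V) {C m : ℝ} (hC : 0 ≤ C) (hm : 0 < m)
    (h1 : ∀ g : V, c.inner g g ≤ C * ‖g‖ ^ 2) (h2 : ∀ g : V, m * ‖g‖ ^ 2 ≤ c.inner g g) :
    CompleteSpace (WithInner c) := by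
  let e : V ≃ₗ[ℝ] WithInner c :=
    { toFun := fun g => g
      invFun := fun g => g
      map_add' := fun _ _ => rfl
      map_smul' := fun _ _ => rfl
      left_inv := fun _ => rfl
      right_inv := fun _ => rfl }
  have hn (g : V) : ‖e g‖ ^ 2 = c.inner g g := WithInner.norm_sq c (e g)
  let e' : V ≃L[ℝ] WithInner c := e.toContinuousLinearEquivOfBounds (√C) (√m⁻¹)
    (fun g => by
      refine (pow_le_pow_iff_left₀ (norm_nonneg _) (by positivity) two_ne_zero).1 ?_
      rw [hn, mul_pow, Real.sq_sqrt hC]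
      exact h1 g)
    (fun g => by
      obtain ⟨g, rfl⟩ := e.surjective g
      rw [e.symm_apply_apply]
      refine (pow_le_pow_iff_left₀ (norm_nonneg _) (by positivity) two_ne_zero).1 ?_
      rw [mul_pow, hn, Real.sq_sqrt (by positivity), inv_mul_eq_div, le_div_iff₀ hm, mul_comm]
      exact h2 g)
  exact e'.isUniformEmbedding.isUniformInducing.completeSpace_congr e'.surjective |>.1 inferInstance

end WeightedInner

/-! ### Weak convergence of the two-sample experiments -/

section TwoSampleConvergence

variable {Ω₁ : Type u} {Ω₂ : Type v} [MeasurableSpace Ω₁] [MeasurableSpace Ω₂]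
  {P₀ : ProbabilityMeasure Ω₁} {Q₀ : ProbabilityMeasure Ω₂}

/-! ### Limits under the base measure P₀ ⊗ Q₀. -/

section BaseMeasure

variable {κ : Type*} [Fintype κ] {p : κ → ℝ → ProbabilityMeasure Ω₁}
  {q : κ → ℝ → ProbabilityMeasure Ω₂} {a : κ → Ω₁ → ℝ} {b : κ → Ω₂ → ℝ}
  {t : ℕ → ℝ} {N₁ N₂ : ℕ → ℕ} {r₁ r₂ : ℝ}
  {H : Type*} [NormedAddCommGroup H] [InnerProductSpace ℝ H] {Ω : Type*} [MeasurableSpace Ω]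
  {R' : ProbabilityMeasure Ω} {L : H →ₗ[ℝ] Lp ℝ 2 (R' : Measure Ω)} {h : κ → H}

/-- The log-likelihood ratios of two samples, with the base measure `P₀ ⊗ Q₀`, converge in law to
the log-likelihood ratios of a Gaussian shift. -/
theorem tendsto_map_twoSampleLog (hp0 : ∀ k, p k 0 = P₀) (hq0 : ∀ k, q k 0 = Q₀)
    (hp : ∀ k, IsL2Differentiable (p k) (a k)) (hq : ∀ k, IsL2Differentiable (q k) (b k))
    (ht : Tendsto t atTop (𝓝[≠] 0)) (hN₁ : Tendsto (fun n => N₁ n * t n ^ 2) atTop (𝓝 r₁))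
    (hN₂ : Tendsto (fun n => N₂ n * t n ^ 2) atTop (𝓝 r₂)) (hL : IsStandardGaussianProcess L)
    (hh : ∀ τ : κ → ℝ, r₁ * ∫ ω, (∑ k, τ k * a k ω) ^ 2 ∂(P₀ : Measure Ω₁) +
      r₂ * ∫ ω, (∑ k, τ k * b k ω) ^ 2 ∂(Q₀ : Measure Ω₂) = ‖∑ k, τ k • h k‖ ^ 2) :
    Tendsto (fun n => ((ProbabilityMeasure.pi fun _ : Fin (N₁ n) => P₀).prod
        (ProbabilityMeasure.pi fun _ : Fin (N₂ n) => Q₀)).map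
        (measurable_twoSampleLog (fun k => (p k (t n) : Measure Ω₁)) P₀
          (fun k => (q k (t n) : Measure Ω₂)) Q₀ (N₁ n) (N₂ n)).aemeasurable) atTop
      (𝓝 (R'.map (measurable_gaussianLog L h).aemeasurable)) := by
  classical
  refine ProbabilityMeasure.tendsto_of_tendsto_charFun fun τ => ?_
  have hself (k : κ) : r₁ * ∫ ω, a k ω ^ 2 ∂(P₀ : Measure Ω₁) +
      r₂ * ∫ ω, b k ω ^ 2 ∂(Q₀ : Measure Ω₂) = ‖h k‖ ^ 2 := by
    -- The quadratic form at a unit vector gives the single norms ‖h k‖², which are needed for the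
    -- means.
    simpa [Pi.single_apply] using hh (Pi.single k 1)
  have hsum : r₁ * ∑ k, τ k * ∫ ω, a k ω ^ 2 ∂(P₀ : Measure Ω₁) +
      r₂ * ∑ k, τ k * ∫ ω, b k ω ^ 2 ∂(Q₀ : Measure Ω₂) = ∑ k, τ k * ‖h k‖ ^ 2 := by
    rw [Finset.mul_sum, Finset.mul_sum, ← Finset.sum_add_distrib]
    refine Finset.sum_congr rfl fun k _ => ?_
    rw [← hself]
    ring
  have key := (tendsto_integral_cexp_truncLogRatio_pow hp0 hp τ ht hN₁).mul
    (tendsto_integral_cexp_truncLogRatio_pow hq0 hq τ ht hN₂)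
  rw [← Complex.exp_add] at key
  refine (tendsto_congr fun n => ?_).2 (key.trans_eq ?_)
  · exact charFun_map_twoSampleLog (fun k => (p k (t n) : Measure Ω₁)) P₀
      (fun k => (q k (t n) : Measure Ω₂)) Q₀ (N₁ n) (N₂ n) τ
  · have e := charFun_map_gaussianLog hL h τ
    refine congrArg 𝓝 (Eq.trans ?_ e.symm)
    rw [← hh, ← hsum]
    congr 1
    push_cast
    ring

theorem tendsto_likelihoodRatioLaw_twoSample (hp0 : ∀ k, p k 0 = P₀) (hq0 : ∀ k, q k 0 = Q₀)
    (hp : ∀ k, IsL2Differentiable (p k) (a k)) (hq : ∀ k, IsL2Differentiable (q k) (b k))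
    (ht : Tendsto t atTop (𝓝[≠] 0)) (hN₁ : Tendsto (fun n => N₁ n * t n ^ 2) atTop (𝓝 r₁))
    (hN₂ : Tendsto (fun n => N₂ n * t n ^ 2) atTop (𝓝 r₂)) (hL : IsStandardGaussianProcess L)
    (hh : ∀ τ : κ → ℝ, r₁ * ∫ ω, (∑ k, τ k * a k ω) ^ 2 ∂(P₀ : Measure Ω₁) +
      r₂ * ∫ ω, (∑ k, τ k * b k ω) ^ 2 ∂(Q₀ : Measure Ω₂) = ‖∑ k, τ k • h k‖ ^ 2)
    {P' : κ → ProbabilityMeasure Ω}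
    (hP' : ∀ k, likelihoodRatio (P' k : Measure Ω) (R' : Measure Ω) =ᵐ[(R' : Measure Ω)]
      fun ω => ENNReal.ofReal (Real.exp (L (h k) ω - ‖h k‖ ^ 2 / 2))) :
    Tendsto (fun n => likelihoodRatioLaw (fun k =>
        (ProbabilityMeasure.pi fun _ : Fin (N₁ n) => p k (t n)).prod
          (ProbabilityMeasure.pi fun _ : Fin (N₂ n) => q k (t n)))
        ((ProbabilityMeasure.pi fun _ : Fin (N₁ n) => P₀).prod
          (ProbabilityMeasure.pi fun _ : Fin (N₂ n) => Q₀))) atTop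
      (𝓝 (likelihoodRatioLaw P' R')) := by
  let E : EuclideanSpace ℝ κ → (κ → ℝ≥0∞) := fun x k => ENNReal.ofReal (Real.exp (x k))
  have hE : Continuous E := by
    refine continuous_pi fun k => ENNReal.continuous_ofReal.comp (Real.continuous_exp.comp ?_)
    fun_prop
  let A (n : ℕ) (k : κ) : Set Ω₁ := {ω | rootScore (p k (t n) : Measure Ω₁) P₀ ω ≤ -1}
  let B (n : ℕ) (k : κ) : Set Ω₂ := {ω | rootScore (q k (t n) : Measure Ω₂) Q₀ ω ≤ -1}
  have hA (n k) : MeasurableSet (A n k) := measurable_rootScore _ _ measurableSet_Iic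
  have hB (n k) : MeasurableSet (B n k) := measurable_rootScore _ _ measurableSet_Iic
  have hA' (n k) : MeasurableSet {ω : Fin (N₁ n) → Ω₁ | ∃ i, ω i ∈ A n k} := by
    rw [Set.ofPred_exists]
    exact MeasurableSet.iUnion fun i => measurable_pi_apply i (hA n k)
  have hB' (n k) : MeasurableSet {ω : Fin (N₂ n) → Ω₂ | ∃ i, ω i ∈ B n k} := by
    rw [Set.ofPred_exists]
    exact MeasurableSet.iUnion fun i => measurable_pi_apply i (hB n k)
  -- The event that some observation triggers the cutoff. Off it the likelihood ratio is the
  -- exponential of the sum of truncated logarithms; its probability is at most N₁ and N₂ times a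
  -- quantity o(t²).
  let S (n : ℕ) (k : κ) : Set ((Fin (N₁ n) → Ω₁) × (Fin (N₂ n) → Ω₂)) :=
    Prod.fst ⁻¹' {ω | ∃ i, ω i ∈ A n k} ∪ Prod.snd ⁻¹' {ω | ∃ i, ω i ∈ B n k}
  have hS (n k) : MeasurableSet (S n k) :=
    (measurable_fst (hA' n k)).union (measurable_snd (hB' n k))
  have h1 := ProbabilityMeasure.tendsto_map_of_tendsto_of_continuous _ _
    (tendsto_map_twoSampleLog hp0 hq0 hp hq ht hN₁ hN₂ hL hh) hE
  have hlimit : (R'.map (measurable_gaussianLog L h).aemeasurable).map hE.measurable.aemeasurable =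
      likelihoodRatioLaw P' R' := by
    refine Subtype.ext ?_
    refine (Measure.map_map hE.measurable (measurable_gaussianLog L h)).trans ?_
    refine Measure.map_congr ?_
    filter_upwards [ae_all_iff.2 hP'] with ω hω
    funext k
    exact (hω k).symm
  rw [hlimit] at h1
  have hU (n : ℕ) := hE.measurable.comp (measurable_twoSampleLog
    (fun k => (p k (t n) : Measure Ω₁)) P₀ (fun k => (q k (t n) : Measure Ω₂)) Q₀ (N₁ n) (N₂ n))
  refine tendsto_map_of_tendsto_measureReal_ne (B := fun n => ⋃ k, S n k) hU
    (fun n => measurable_pi_lambda _ fun _ => measurable_likelihoodRatio _ _)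
    (fun n => MeasurableSet.iUnion fun k => hS n k) (fun n => ?_) ?_ ?_
  · have h2 := ae_all_iff.2 fun k : κ => likelihoodRatio_twoSample_ae_eq
      (p k (t n) : Measure Ω₁) P₀ (q k (t n) : Measure Ω₂) Q₀ (N₁ n) (N₂ n)
    refine (show ∀ᵐ x ∂((Measure.pi fun _ : Fin (N₁ n) => (P₀ : Measure Ω₁)).prod
      (Measure.pi fun _ : Fin (N₂ n) => (Q₀ : Measure Ω₂))), _ from ?_)
    filter_upwards [h2] with ω hω hbad
    funext k
    have hk : ω ∉ S n k := fun hk => hbad (Set.mem_iUnion.2 ⟨k, hk⟩)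
    refine (hω k (fun i => ?_) fun j => ?_).symm
    · exact not_le.1 fun hi => hk (Or.inl ⟨i, hi⟩)
    · exact not_le.1 fun hj => hk (Or.inr ⟨j, hj⟩)
  · have h2 := (tendsto_finsetSum Finset.univ fun k (_ : k ∈ Finset.univ) =>
      (tendsto_mul_measureReal_rootScore_le (hp0 k) (hp k) ht hN₁).add
        (tendsto_mul_measureReal_rootScore_le (hq0 k) (hq k) ht hN₂))
    simp only [add_zero, Finset.sum_const_zero] at h2
    refine squeeze_zero (fun _ => measureReal_nonneg) (fun n => ?_) h2
    refine (measureReal_iUnion_fintype_le _).trans (Finset.sum_le_sum fun k _ => ?_)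
    refine (measureReal_union_le _ _).trans (add_le_add ?_ ?_)
    · refine le_trans (le_of_eq ?_) (measureReal_pi_exists_le (P₀ : Measure Ω₁) (N₁ n) (hA n k))
      exact (measurePreserving_fst (μ := Measure.pi fun _ : Fin (N₁ n) => (P₀ : Measure Ω₁))
        (ν := Measure.pi fun _ : Fin (N₂ n) => (Q₀ : Measure Ω₂))).measureReal_preimage
        (hA' n k).nullMeasurableSet
    · refine le_trans (le_of_eq ?_) (measureReal_pi_exists_le (Q₀ : Measure Ω₂) (N₂ n) (hB n k))
      exact (measurePreserving_snd (μ := Measure.pi fun _ : Fin (N₁ n) => (P₀ : Measure Ω₁))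
        (ν := Measure.pi fun _ : Fin (N₂ n) => (Q₀ : Measure Ω₂))).measureReal_preimage
        (hB' n k).nullMeasurableSet
  · refine (tendsto_congr fun n => ?_).1 h1
    exact Subtype.ext (Measure.map_map hE.measurable (measurable_twoSampleLog _ _ _ _ _ _))

end BaseMeasure

/-- The density integrates to 1, which leaves no mass for a singular part. -/
theorem IsStandardGaussianProcess.measure_likelihoodRatio_eq_top {H : Type*} [NormedAddCommGroup H]
    [InnerProductSpace ℝ H] {Ω : Type*} [MeasurableSpace Ω] {P R : ProbabilityMeasure Ω}
    {L : H →ₗ[ℝ] Lp ℝ 2 (R : Measure Ω)} (hL : IsStandardGaussianProcess L) {h : H}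
    (hP : likelihoodRatio (P : Measure Ω) (R : Measure Ω) =ᵐ[(R : Measure Ω)]
      fun ω => ENNReal.ofReal (Real.exp (L h ω - ‖h‖ ^ 2 / 2))) :
    (P : Measure Ω) {ω | likelihoodRatio (P : Measure Ω) (R : Measure Ω) ω = ∞} = 0 := by
  have h1 : ∫ ω, (likelihoodRatio (P : Measure Ω) (R : Measure Ω) ω).toReal ∂(R : Measure Ω) =
      1 := by
    rw [← hL.integral_exp h]
    refine integral_congr_ae ?_
    filter_upwards [hP] with ω hω
    rw [hω, ENNReal.toReal_ofReal (Real.exp_pos _).le]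
  rw [integral_likelihoodRatio] at h1
  rw [← measureReal_eq_zero_iff]
  linarith

theorem tendsto_inv_sqrt_nat : Tendsto (fun n : ℕ => 1 / √(n : ℝ)) atTop (𝓝[≠] 0) := by
  refine tendsto_nhdsWithin_iff.2 ⟨?_, ?_⟩
  · simp_rw [one_div]
    exact (Real.tendsto_sqrt_atTop.comp tendsto_natCast_atTop_atTop).inv_tendsto_atTop
  · filter_upwards [eventually_gt_atTop 0] with n hn
    have : (0 : ℝ) < n := by exact_mod_cast hn
    exact (by positivity : 1 / √(n : ℝ) ≠ 0)

theorem integral_sum_mul_sq {H : Type*} [AddCommGroup H] [Module ℝ H] {Ω : Type*}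
    [MeasurableSpace Ω] {μ : Measure Ω} (C : H →ₗ[ℝ] Lp ℝ 2 μ) {κ : Type*} [Fintype κ] (h : κ → H)
    (τ : κ → ℝ) : ∫ ω, (∑ k, τ k * C (h k) ω) ^ 2 ∂μ = ‖C (∑ k, τ k • h k)‖ ^ 2 := by
  rw [← real_inner_self_eq_norm_sq, L2.real_inner_eq_integral_mul, map_sum]
  simp_rw [map_smul]
  refine integral_congr_ae ?_
  filter_upwards [Lp.coeFn_sum_smul Finset.univ τ fun k => C (h k)] with ω hω
  rw [hω, sq]

/-- The powers of P₀ and Q₀ need not form a member of the experiment, as the curve for the parameter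
0 need not be constant. They serve as an auxiliary base, which is then replaced by the measure with
parameter s, even if s = 0. -/
theorem weaklyConvergesTo_twoSampleExperiment {H : Type*} [NormedAddCommGroup H]
    [InnerProductSpace ℝ H] {A : H →ₗ[ℝ] Lp ℝ 2 (P₀ : Measure Ω₁)}
    {B : H →ₗ[ℝ] Lp ℝ 2 (Q₀ : Measure Ω₂)} {r₁ r₂ : ℝ}
    (hnorm : ∀ h, ‖h‖ ^ 2 = r₁ * ‖A h‖ ^ 2 + r₂ * ‖B h‖ ^ 2)
    {p : H → ℝ → ProbabilityMeasure Ω₁} {q : H → ℝ → ProbabilityMeasure Ω₂}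
    (hp0 : ∀ h, p h 0 = P₀) (hq0 : ∀ h, q h 0 = Q₀) (hp : ∀ h, IsL2Differentiable (p h) (A h))
    (hq : ∀ h, IsL2Differentiable (q h) (B h)) {n₁ n₂ : ℕ → ℕ}
    (hn₁ : Tendsto (fun n => (n₁ n : ℝ) / n) atTop (𝓝 r₁))
    (hn₂ : Tendsto (fun n => (n₂ n : ℝ) / n) atTop (𝓝 r₂)) {E : Experiment.{_, w} H}
    (hE : IsGaussianShift E) :
    WeaklyConvergesTo (fun n => twoSampleExperiment p q n (n₁ n) (n₂ n)) E := by
  intro Z s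
  obtain ⟨L, hL, hLR⟩ := hE
  -- The parameter s is adjoined as `none`, so that the ratio of the new base measure is a
  -- coordinate of the converging vector.
  let h : Option Z → H := fun k => k.elim s Subtype.val
  have hsq (n : ℕ) (x : ℝ) : x / n = x * (1 / √(n : ℝ)) ^ 2 := by
    rw [div_pow, one_pow, Real.sq_sqrt n.cast_nonneg, mul_one_div]
  refine tendsto_likelihoodRatioLaw_of_base
    (fun n k => (twoSampleExperiment p q n (n₁ n) (n₂ n)).P (h k)) _ (fun k => E.P (h k)) (E.P 0)
    (tendsto_likelihoodRatioLaw_twoSample (P₀ := P₀) (Q₀ := Q₀) (fun k => hp0 (h k))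
      (fun k => hq0 (h k)) (fun k => hp (h k)) (fun k => hq (h k)) tendsto_inv_sqrt_nat
      (hn₁.congr fun n => hsq n _) (hn₂.congr fun n => hsq n _) hL (fun τ => ?_)
      fun k => hLR (h k)) (hL.measure_likelihoodRatio_eq_top (hLR (h none)))
  rw [integral_sum_mul_sq A h, integral_sum_mul_sq B h, hnorm]

/-- Partial integration of g₁ + g₂ returns g₁ and g₂ because both have mean zero. The curves need
not lie in the families. -/
theorem IsSumOfMarginals.isL2Differentiable {p : ℝ → ProbabilityMeasure Ω₁}
    {q : ℝ → ProbabilityMeasure Ω₂} (hp0 : p 0 = P₀) (hq0 : q 0 = Q₀)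
    {g : Lp ℝ 2 (P₀.prod Q₀ : Measure (Ω₁ × Ω₂))}
    {g₁ : Lp ℝ 2 (P₀ : Measure Ω₁)} {g₂ : Lp ℝ 2 (Q₀ : Measure Ω₂)}
    (hg : IsSumOfMarginals g g₁ g₂) (h1 : ∫ x, g₁ x ∂(P₀ : Measure Ω₁) = 0)
    (h2 : ∫ y, g₂ y ∂(Q₀ : Measure Ω₂) = 0)
    (hd : IsL2Differentiable (fun t => (p t).prod (q t)) g) :
    IsL2Differentiable p g₁ ∧ IsL2Differentiable q g₂ := by
  have i1 := (Lp.memLp g₁).integrable (by norm_num)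
  have i2 := (Lp.memLp g₂).integrable (by norm_num)
  refine ⟨(isL2Differentiable_fst_of_prod hd).1.congr_tangent ?_,
    (isL2Differentiable_snd_of_prod hd).1.congr_tangent ?_⟩
  · rw [hp0, hq0]
    have hae : ∀ᵐ x ∂(P₀ : Measure Ω₁), ∀ᵐ y ∂(Q₀ : Measure Ω₂), g (x, y) = g₁ x + g₂ y :=
      Measure.ae_ae_of_ae_prod hg
    filter_upwards [hae] with x hx
    rw [integral_congr_ae hx, integral_add (integrable_const _) i2, h2]
    simp
  · rw [hp0, hq0]
    have hswap : ∀ᵐ ω ∂((Q₀ : Measure Ω₂).prod (P₀ : Measure Ω₁)),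
        g (ω.2, ω.1) = g₁ ω.2 + g₂ ω.1 :=
      Measure.measurePreserving_swap.quasiMeasurePreserving.ae hg
    have hae : ∀ᵐ y ∂(Q₀ : Measure Ω₂), ∀ᵐ x ∂(P₀ : Measure Ω₁), g (x, y) = g₁ x + g₂ y :=
      Measure.ae_ae_of_ae_prod hswap
    filter_upwards [hae] with y hy
    rw [integral_congr_ae hy, integral_add i1 (integrable_const _), h1]
    simp

end TwoSampleConvergence

theorem mainTheorem6 {Ω₁ : Type u} {Ω₂ : Type v} [MeasurableSpace Ω₁] [MeasurableSpace Ω₂]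
    (Pfam : Set (ProbabilityMeasure Ω₁)) (Qfam : Set (ProbabilityMeasure Ω₂))
    (P₀ : ProbabilityMeasure Ω₁) (Q₀ : ProbabilityMeasure Ω₂) (hP₀ : P₀ ∈ Pfam) (hQ₀ : Q₀ ∈ Qfam)
    (d : ℝ) (hd : d ∈ Set.Ioo (0 : ℝ) 1)
    (n₁ n₂ : ℕ → ℕ) (hn : ∀ n, n₁ n + n₂ n = n)
    (hlim : Tendsto (fun n : ℕ => (n₂ n : ℝ) / (n : ℝ)) atTop (𝓝 d)) :
    -- unique representation `g = g₁ ∘ π₁ + g₂ ∘ π₂` on the two-sample tangent space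
    (∀ g : tangentSpace (P₀.prod Q₀) (productFamily Pfam Qfam),
      ∃! gg : tangentSpace P₀ Pfam × tangentSpace Q₀ Qfam,
        IsSumOfMarginals (g : Lp ℝ 2 (P₀.prod Q₀ : Measure (Ω₁ × Ω₂)))
          (gg.1 : Lp ℝ 2 (P₀ : Measure Ω₁)) (gg.2 : Lp ℝ 2 (Q₀ : Measure Ω₂))) ∧
    -- `c` is the inner product `⟨·,·⟩_d`, and `WithInner c` is the Hilbert space `H_d`
    ∃ c : InnerProductSpace.Core ℝ (tangentSpace (P₀.prod Q₀) (productFamily Pfam Qfam)),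
      (∀ (g h : tangentSpace (P₀.prod Q₀) (productFamily Pfam Qfam))
        (g₁ h₁ : tangentSpace P₀ Pfam) (g₂ h₂ : tangentSpace Q₀ Qfam),
        IsSumOfMarginals (g : Lp ℝ 2 (P₀.prod Q₀ : Measure (Ω₁ × Ω₂)))
          (g₁ : Lp ℝ 2 (P₀ : Measure Ω₁)) (g₂ : Lp ℝ 2 (Q₀ : Measure Ω₂)) →
        IsSumOfMarginals (h : Lp ℝ 2 (P₀.prod Q₀ : Measure (Ω₁ × Ω₂)))
          (h₁ : Lp ℝ 2 (P₀ : Measure Ω₁)) (h₂ : Lp ℝ 2 (Q₀ : Measure Ω₂)) →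
        c.inner g h =
          (1 - d) * ∫ ω, (g₁ : Lp ℝ 2 (P₀ : Measure Ω₁)) ω * (h₁ : Lp ℝ 2 (P₀ : Measure Ω₁)) ω
              ∂(P₀ : Measure Ω₁)
            + d * ∫ ω, (g₂ : Lp ℝ 2 (Q₀ : Measure Ω₂)) ω * (h₂ : Lp ℝ 2 (Q₀ : Measure Ω₂)) ω
              ∂(Q₀ : Measure Ω₂)) ∧
      CompleteSpace (WithInner c) ∧
      -- for any choice of differentiable product curves with tangents `g`
      ∀ (p : WithInner c → ℝ → ProbabilityMeasure Ω₁) (q : WithInner c → ℝ → ProbabilityMeasure Ω₂),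
        (∀ g : WithInner c, p g 0 = P₀ ∧ q g 0 = Q₀ ∧
          IsL2Differentiable (fun t => (p g t).prod (q g t))
            (g.val : Lp ℝ 2 (P₀.prod Q₀ : Measure (Ω₁ × Ω₂)))) →
        (∀ E : Experiment.{max u v, w} (WithInner c), IsGaussianShift E →
          WeaklyConvergesTo (fun n => twoSampleExperiment p q n (n₁ n) (n₂ n)) E) ∧
        IsLAN (fun n => twoSampleExperiment p q n (n₁ n) (n₂ n)) := by

  obtain ⟨D, hD⟩ := exists_tangentSpace_prod_decomposition P₀ Q₀ hP₀ hQ₀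
  have hinj : Function.Injective (sumOfTangents P₀ Q₀ Pfam Qfam) :=
    (antilipschitz_sumOfTangents P₀ Q₀).injective
  have hDsum (g : tangentSpace (P₀.prod Q₀) (productFamily Pfam Qfam)) :
      IsSumOfMarginals (g : Lp ℝ 2 (P₀.prod Q₀ : Measure (Ω₁ × Ω₂)))
        ((D g).1 : Lp ℝ 2 (P₀ : Measure Ω₁)) ((D g).2 : Lp ℝ 2 (Q₀ : Measure Ω₂)) :=
    isSumOfMarginals_iff.2 (hD g)
  have hDunique {g : tangentSpace (P₀.prod Q₀) (productFamily Pfam Qfam)}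
      {gg : tangentSpace P₀ Pfam × tangentSpace Q₀ Qfam}
      (h : IsSumOfMarginals (g : Lp ℝ 2 (P₀.prod Q₀ : Measure (Ω₁ × Ω₂)))
        (gg.1 : Lp ℝ 2 (P₀ : Measure Ω₁)) (gg.2 : Lp ℝ 2 (Q₀ : Measure Ω₂))) : gg = D g :=
    hinj ((isSumOfMarginals_iff.1 h).trans (hD g).symm)
  have hDinj : Function.Injective D := fun g h hgh =>
    Subtype.ext ((hD g).symm.trans ((congrArg _ hgh).trans (hD h)))
  have hnormD (g : tangentSpace (P₀.prod Q₀) (productFamily Pfam Qfam)) :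
      ‖g‖ ^ 2 = ‖(D g).1‖ ^ 2 + ‖(D g).2‖ ^ 2 := by
    rw [← norm_sumOfTangents_sq P₀ Q₀, hD]
    rfl
  have hd0 : 0 < 1 - d := sub_pos.2 hd.2
  let c := weightedInnerCore D hDinj hd0 hd.1
  have hc (g : tangentSpace (P₀.prod Q₀) (productFamily Pfam Qfam)) :
      c.inner g g = (1 - d) * ‖(D g).1‖ ^ 2 + d * ‖(D g).2‖ ^ 2 := by
    rw [← real_inner_self_eq_norm_sq, ← real_inner_self_eq_norm_sq]
    rfl
  have hcomplete : CompleteSpace (WithInner c) := by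
    -- Both weights lie between min (1 − d) d and 1, and the L₂ norm is the case of weights 1, 1.
    refine WithInner.completeSpace c zero_le_one (lt_min hd0 hd.1) (fun g => ?_) fun g => ?_
    · rw [hc, hnormD]
      nlinarith [mul_nonneg hd0.le (sq_nonneg ‖(D g).2‖), mul_nonneg hd.1.le (sq_nonneg ‖(D g).1‖)]
    · rw [hc, hnormD, mul_add]
      gcongr
      · exact min_le_left _ _
      · exact min_le_right _ _
  refine ⟨fun g => ⟨D g, hDsum g, fun gg hgg => hDunique hgg⟩, c, fun g h g₁ h₁ g₂ h₂ hg hh => ?_,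
    hcomplete, fun p q hpq => ?_⟩
  · have eg := hDunique (gg := (g₁, g₂)) hg
    have eh := hDunique (gg := (h₁, h₂)) hh
    rw [← L2.real_inner_eq_integral_mul, ← L2.real_inner_eq_integral_mul]
    change (1 - d) * inner ℝ (D g).1 (D h).1 + d * inner ℝ (D g).2 (D h).2 = _
    rw [← eg, ← eh]
    rfl
  · have hlim₁ : Tendsto (fun n : ℕ => (n₁ n : ℝ) / n) atTop (𝓝 (1 - d)) := by
      refine (hlim.const_sub 1).congr' ?_
      filter_upwards [eventually_gt_atTop 0] with n hn0
      have h1 : (n₁ n : ℝ) + n₂ n = n := by exact_mod_cast hn n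
      have h2 : (n : ℝ) ≠ 0 := by exact_mod_cast hn0.ne'
      field_simp
      linarith
    let V : WithInner c →ₗ[ℝ] tangentSpace (P₀.prod Q₀) (productFamily Pfam Qfam) :=
      { toFun := fun g => g.val
        map_add' := fun _ _ => rfl
        map_smul' := fun _ _ => rfl }
    let A : WithInner c →ₗ[ℝ] Lp ℝ 2 (P₀ : Measure Ω₁) :=
      (tangentSpace P₀ Pfam).subtype ∘ₗ LinearMap.fst ℝ _ _ ∘ₗ D ∘ₗ V
    let B : WithInner c →ₗ[ℝ] Lp ℝ 2 (Q₀ : Measure Ω₂) :=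
      (tangentSpace Q₀ Qfam).subtype ∘ₗ LinearMap.snd ℝ _ _ ∘ₗ D ∘ₗ V
    have hcurves (g : WithInner c) : IsL2Differentiable (p g) (A g) ∧
        IsL2Differentiable (q g) (B g) :=
      (hDsum g.val).isL2Differentiable (hpq g).1 (hpq g).2.1
        (integral_eq_zero_of_mem_tangentSpace (D g.val).1.2)
        (integral_eq_zero_of_mem_tangentSpace (D g.val).2.2) (hpq g).2.2
    have hnorm (g : WithInner c) : ‖g‖ ^ 2 = (1 - d) * ‖A g‖ ^ 2 + d * ‖B g‖ ^ 2 :=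
      (WithInner.norm_sq c g).trans (hc g.val)
    have hconv : ∀ E : Experiment.{max u v, w} (WithInner c), IsGaussianShift E →
        WeaklyConvergesTo (fun n => twoSampleExperiment p q n (n₁ n) (n₂ n)) E := fun E hE =>
      weaklyConvergesTo_twoSampleExperiment hnorm (fun g => (hpq g).1) (fun g => (hpq g).2.1)
        (fun g => (hcurves g).1) (fun g => (hcurves g).2) hlim₁ hlim hE
    refine ⟨hconv, ?_⟩
    -- This shift lives in the universe of the parameter space, not in the universe w of `hconv`, so
    -- the convergence lemma is applied afresh.
    obtain ⟨E, hE⟩ := exists_isGaussianShift (WithInner c)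
    exact ⟨E, hE, weaklyConvergesTo_twoSampleExperiment hnorm (fun g => (hpq g).1)
      (fun g => (hpq g).2.1) (fun g => (hcurves g).1) (fun g => (hcurves g).2) hlim₁ hlim hE⟩
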